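/- All objects are smooth ($C^\infty$), and $i=\sqrt{-1}$. Let $(M,c,D)$ be a Weyl space of dimension $m$: $M$ is a manifold, $c$ is a (Riemannian) conformal structure on $M$, and $D$ is a torsion-free connection on $TM$ such that, for any representative metric $g$ of $c$, $Dg=\alpha\otimes g$ for some $1$-form $\alpha$. Let $1\le r<\tfrac12 m$. **Definitions.** An *almost $f$-structure* on a manifold is a section $F$ of the endomorphisms of its tangent bundle with $F^3+F=0$; denote by $T^0$ and $T^{0,1}$ its eigenbundles corresponding to $0$ and $-i$. The *complex distribution associated to* $F$ is $\mathscr F=T^0\oplus T^{0,1}$, a subbundle of the complexified tangent bundle; $F$ is *integrable* if the sections of $\mathscr F$ are closed under the Lie bracket. A map between manifolds with almost $f$-structures is *holomorphic* if its differential maps the complex distribution of the domain into that of the codomain. An almost complex structure $J$ is an almost $f$-structure with $T^0=0$; a *complex manifold* $(N,J)$ is a manifold endowed with an integrable almost complex structure. Let $\pi:Q_{M,r}\to M$ be the bundle of isotropic complex subspaces, of complex dimension $r$, of $(T^{\mathbb C}M,c)$. For $p\in Q_{M,r}$, let $F^p$ be the skew-adjoint $f$-structure on $(T_{\pi(p)}M,c)$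 whose eigenspace corresponding to $-i$ is $p$; thus $p\mapsto F^p$ embeds $Q_{M,r}$ in ${\rm End}(TM)$, and a section $p$ of $Q_{M,r}$ determines an almost $f$-structure $F^p$ on $M$. Let $\mathscr H\subseteq TQ_{M,r}$ be the connection induced by $D$. The fibres of $Q_{M,r}$ are complex submanifolds of Grassmannians, so $(\ker d\pi)^{\mathbb C}=(\ker d\pi)^{1,0}\oplus(\ker d\pi)^{0,1}$. Let $\mathcal F_{M,r}$ be the almost $f$-structure on $Q_{M,r}$ whose eigenspaces at $p\in Q_{M,r}$ are: for $0$, the space of $\xi\in\mathscr H_p$ with $d\pi(\xi)\in\ker F^p$; for $-i$, the space $\{\xi\in\mathscr H_p^{\mathbb C} : d\pi(\xi)\in p\}\oplus(\ker d\pi)_p^{0,1}$. **Statement.** Let $p$ be a section of $Q_{M,r}$ and let $F^p$ be the corresponding almost $f$-structure on $(M,c)$. The following assertions are equivalent. (a) $p:(M,F^p)\to(Q_{M,r},\mathcal F_{M,r})$ is holomorphic. (b) $F^p$ is integrable and any point of $M$ has an open neighbourhood $U$ on which $F^p$ is defined by a submersion $\varphi:U\to N$ onto a complex manifold $(N,J)$,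 that is, $\varphi:(U,F^p|_U)\to(N,J)$ is holomorphic and $\ker d\varphi=\ker F^p$ on $U$, such that: - $\varphi$ is pseudo horizontally conformal: it pulls back $(1,0)$-forms on $N$ to isotropic $1$-forms on $(U,c)$; - the fibres of $\varphi$ are geodesic: $D_XY$ is tangent to the fibres for any local vector fields $X$ and $Y$ tangent to the fibres; - the integrability tensor of the horizontal distribution $\mathscr D=(\ker d\varphi)^\perp$, which maps sections $X,Y$ of $\mathscr D$ to minus the component of $[X,Y]$ in $\ker d\varphi$, is of degree $(1,1)$ with respect to the complex structure on $\mathscr D$ for which $d\varphi|_{\mathscr D}$ is complex linear: it vanishes on any two vectors which are both of type $(1,0)$ or both of type $(0,1)$. -/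

import Mathlib

open Bundle Manifold ContDiff VectorField
open scoped TensorProduct

noncomputable section

namespace FTwistor

section LinearAlgebra

variable {V : Type*} [AddCommGroup V] [Module ℝ V]

/-- The complex vector `u + i v` of the complexification `ℂ ⊗ V`. -/
def cvec (u v : V) : ℂ ⊗[ℝ] V := (1 : ℂ) ⊗ₜ[ℝ] u + Complex.I ⊗ₜ[ℝ] v

/-- Real part of a complex vector. -/
def cre : ℂ ⊗[ℝ] V →ₗ[ℝ] V :=
  (TensorProduct.lid ℝ V).toLinearMap ∘ₗ LinearMap.rTensor V Complex.reLm

/-- Imaginary part of a complex vector. -/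
def cim : ℂ ⊗[ℝ] V →ₗ[ℝ] V :=
  (TensorProduct.lid ℝ V).toLinearMap ∘ₗ LinearMap.rTensor V Complex.imLm

theorem cre_cvec (u v : V) : cre (cvec u v) = u := by simp [cre, cvec]
theorem cim_cvec (u v : V) : cim (cvec u v) = v := by simp [cim, cvec]

theorem cvec_eta (z : ℂ ⊗[ℝ] V) : cvec (cre z) (cim z) = z := by
  induction z with
  | zero => simp [cvec]
  | add x y hx hy =>
    have h : cvec (cre (x + y)) (cim (x + y)) = cvec (cre x) (cim x) + cvec (cre y) (cim y) := by
      simp only [map_add, cvec, TensorProduct.tmul_add]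
      abel
    rw [h, hx, hy]
  | tmul a v =>
    simp only [cvec, cre, cim, LinearMap.comp_apply, LinearMap.rTensor_tmul]
    simp only [LinearEquiv.coe_coe, TensorProduct.lid_tmul, Complex.reLm_coe, Complex.imLm_coe]
    rw [← TensorProduct.smul_tmul, ← TensorProduct.smul_tmul, ← TensorProduct.add_tmul]
    congr 1
    simp

theorem I_smul_cvec (u v : V) : Complex.I • cvec u v = cvec (-v) u := by
  simp [cvec, smul_add, TensorProduct.smul_tmul', TensorProduct.neg_tmul, TensorProduct.tmul_neg]
  abel

theorem cvec_inj {u v u' v' : V} : cvec u v = cvec u' v' ↔ u = u' ∧ v = v' := by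
  constructor
  · intro h
    exact ⟨by simpa [cre_cvec] using congrArg cre h, by simpa [cim_cvec] using congrArg cim h⟩
  · rintro ⟨rfl, rfl⟩; rfl

theorem baseChange_cvec (F : V →ₗ[ℝ] V) (u v : V) :
    F.baseChange ℂ (cvec u v) = cvec (F u) (F v) := by
  simp [cvec]

theorem form_cvec (g : LinearMap.BilinForm ℝ V) (u v u' v' : V) :
    g.baseChange ℂ (cvec u v) (cvec u' v') =
      ((g u u' - g v v' : ℝ) : ℂ) + ((g u v' + g v u' : ℝ) : ℂ) * Complex.I := by
  simp only [cvec, map_add, LinearMap.add_apply, LinearMap.BilinForm.baseChange_tmul]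
  apply Complex.ext <;> simp <;> ring

theorem eigen_cvec (F : V →ₗ[ℝ] V) (u v : V) :
    cvec u v ∈ Module.End.eigenspace (F.baseChange ℂ) (-Complex.I) ↔ F u = v ∧ F v = -u := by
  rw [Module.End.mem_eigenspace_iff, baseChange_cvec, neg_smul, I_smul_cvec]
  have : -cvec (-v) u = cvec v (-u) := by
    simp [cvec, TensorProduct.tmul_neg, add_comm]
  rw [this, cvec_inj]

/-- Every isotropic complex subspace of the complexification of a Euclidean vector space is the
`-i`-eigenspace of exactly one skew-adjoint `f`-structure. -/
theorem existsUnique_fStructure [FiniteDimensional ℝ V] (g : LinearMap.BilinForm ℝ V)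
    (hs : ∀ u v, g u v = g v u) (hp : ∀ u, u ≠ 0 → 0 < g u u)
    (q : Submodule ℂ (ℂ ⊗[ℝ] V)) (hq : ∀ z ∈ q, ∀ w ∈ q, g.baseChange ℂ z w = 0) :
    ∃! F : V →ₗ[ℝ] V, (∀ u v, g (F u) v = -g u (F v)) ∧ F ∘ₗ F ∘ₗ F + F = 0 ∧
      Module.End.eigenspace (F.baseChange ℂ) (-Complex.I) = q := by
  classical
  have iso : ∀ u v u' v', cvec u v ∈ q → cvec u' v' ∈ q →
      g u u' = g v v' ∧ g u v' = -g v u' := by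
    intro u v u' v' h h'
    have := hq _ h _ h'
    rw [form_cvec] at this
    have h1 := congrArg Complex.re this
    have h2 := congrArg Complex.im this
    simp at h1 h2
    constructor <;> linarith
  have rot : ∀ u v, cvec u v ∈ q → cvec v (-u) ∈ q := by
    intro u v h
    have h' := q.smul_mem (-Complex.I) h
    rw [neg_smul, I_smul_cvec] at h'
    have e : -cvec (-v) u = cvec v (-u) := by
      simp [cvec, TensorProduct.tmul_neg, add_comm]
    rwa [e] at h'
  have zero_im : ∀ v, cvec 0 v ∈ q → v = 0 := by
    intro v h
    by_contra hv
    have := (iso _ _ _ _ h h).1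
    have h3 := hp v hv
    simp at this
    linarith
  let qr : Submodule ℝ (ℂ ⊗[ℝ] V) := q.restrictScalars ℝ
  let W : Submodule ℝ V := qr.map cre
  have memW : ∀ u, u ∈ W ↔ ∃ v, cvec u v ∈ q := by
    intro u
    constructor
    · rintro ⟨z, hz, rfl⟩
      exact ⟨cim z, by rw [cvec_eta]; exact hz⟩
    · rintro ⟨v, hv⟩
      exact ⟨_, hv, cre_cvec _ _⟩
  let f : qr →ₗ[ℝ] W := (cre.restrict (fun z hz => ⟨z, hz, rfl⟩) : qr →ₗ[ℝ] W)
  have finj : Function.Injective f := by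
    rw [← LinearMap.ker_eq_bot, LinearMap.ker_eq_bot']
    rintro ⟨z, hz⟩ h
    have h1 : cre z = 0 := congrArg Subtype.val h
    have h2 : cvec 0 (cim z) ∈ q := by
      have := cvec_eta z
      rw [h1] at this
      rw [this]; exact hz
    have h3 := zero_im _ h2
    apply Subtype.ext
    change z = 0
    rw [← cvec_eta z, h1, h3]
    simp [cvec]
  have fsurj : Function.Surjective f := by
    rintro ⟨u, z, hz, rfl⟩
    exact ⟨⟨z, hz⟩, rfl⟩
  let e : qr ≃ₗ[ℝ] W := LinearEquiv.ofBijective f ⟨finj, fsurj⟩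
  have hWc : IsCompl W (g.orthogonal W) := by
    rw [LinearMap.BilinForm.isCompl_orthogonal_iff_disjoint (fun u v h => by rw [hs, h]),
      Submodule.disjoint_def]
    intro u hu hu'
    by_contra hne
    exact absurd (hu' u hu) (hp u hne).ne'
  let P : V →ₗ[ℝ] W := W.projectionOnto _ hWc
  let F : V →ₗ[ℝ] V := cim ∘ₗ qr.subtype ∘ₗ e.symm.toLinearMap ∘ₗ P
  have Fq : ∀ u v, cvec u v ∈ q → F u = v := by
    intro u v h
    have hu : u ∈ W := (memW u).2 ⟨v, h⟩
    have h1 : P u = ⟨u, hu⟩ := Submodule.projectionOnto_apply_left hWc ⟨u, hu⟩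
    have h2 : e.symm ⟨u, hu⟩ = ⟨cvec u v, h⟩ := by
      rw [LinearEquiv.symm_apply_eq]
      exact Subtype.ext (cre_cvec u v).symm
    simp only [F, LinearMap.comp_apply, h1, LinearEquiv.coe_coe, h2]
    exact cim_cvec u v
  have Fo : ∀ u, u ∈ g.orthogonal W → F u = 0 := by
    intro u h
    have h1 : P u = 0 := Submodule.projectionOnto_apply_right hWc ⟨u, h⟩
    simp [F, h1]
  have dec : ∀ u, ∃ a b, cvec a b ∈ q ∧ ∃ c ∈ g.orthogonal W, u = a + c := by
    intro u
    have : u ∈ W ⊔ g.orthogonal W := by rw [hWc.sup_eq_top]; trivial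
    obtain ⟨a, ha, c, hc, rfl⟩ := Submodule.mem_sup.1 this
    obtain ⟨b, hb⟩ := (memW a).1 ha
    exact ⟨a, b, hb, c, hc, rfl⟩
  have orth : ∀ a b, cvec a b ∈ q → ∀ c ∈ g.orthogonal W, g a c = 0 ∧ g b c = 0 := by
    intro a b h c hc
    exact ⟨hc a ((memW a).2 ⟨b, h⟩), hc b ((memW b).2 ⟨-a, rot a b h⟩)⟩
  refine ⟨F, ⟨?_, ?_, ?_⟩, ?_⟩
  · intro u v
    obtain ⟨a, b, h, c, hc, rfl⟩ := dec u
    obtain ⟨a', b', h', c', hc', rfl⟩ := dec v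
    simp only [map_add, Fq _ _ h, Fq _ _ h', Fo _ hc, Fo _ hc', add_zero, LinearMap.add_apply]
    rw [(orth _ _ h _ hc').2, hs c b', (orth _ _ h' _ hc).2, (iso _ _ _ _ h h').2]
    ring
  · ext u
    obtain ⟨a, b, h, c, hc, rfl⟩ := dec u
    have h2 := rot _ _ h
    have h3 := rot _ _ h2
    simp only [LinearMap.add_apply, LinearMap.comp_apply, map_add, Fo _ hc, Fq _ _ h, Fq _ _ h2,
      Fq _ _ h3, map_zero]
    simp
  · ext z
    rw [← cvec_eta z, eigen_cvec]
    generalize cre z = u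
    generalize cim z = v
    constructor
    · rintro ⟨h1, h2⟩
      obtain ⟨a, b, h, c, hc, rfl⟩ := dec v
      have : F (a + c) = b := by rw [map_add, Fq _ _ h, Fo _ hc, add_zero]
      rw [this] at h2
      have hu : cvec u (-(-a)) ∈ q := by
        have := rot _ _ (rot _ _ (rot _ _ h))
        have hb : u = -b := by rw [h2, neg_neg]
        rwa [← hb] at this
      have := Fq _ _ hu
      rw [neg_neg] at this hu
      rwa [← h1, this]
    · intro h
      exact ⟨Fq _ _ h, Fq _ _ (rot _ _ h)⟩
  · rintro F' ⟨hk, hf, he⟩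
    have Fq' : ∀ u v, cvec u v ∈ q → F' u = v := by
      intro u v h
      rw [← he, eigen_cvec] at h
      exact h.1
    ext u
    obtain ⟨a, b, h, c, hc, rfl⟩ := dec u
    rw [map_add, map_add, Fq _ _ h, Fq' _ _ h, Fo _ hc]
    congr 1
    have h1 : F' (F' (F' c)) = -F' c := by
      have := LinearMap.congr_fun hf c
      simp only [LinearMap.add_apply, LinearMap.comp_apply, LinearMap.zero_apply] at this
      exact eq_neg_of_add_eq_zero_left this
    have h2 : cvec (F' c) (F' (F' c)) ∈ q := by
      rw [← he, eigen_cvec]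
      exact ⟨rfl, h1⟩
    have h3 := rot _ _ h2
    have h4 : g (F' c) (F' c) = 0 := by
      rw [hk, hs, (orth _ _ h2 c hc).2, neg_zero]
    by_contra hne
    exact absurd h4 (hp _ hne).ne'

end LinearAlgebra

section Manifold

variable {E : Type*} [NormedAddCommGroup E] [NormedSpace ℝ E]
  {H : Type*} [TopologicalSpace H] (I : ModelWithCorners ℝ E H)
  {M : Type*} [TopologicalSpace M] [ChartedSpace H M]
  {EN : Type*} [NormedAddCommGroup EN] [NormedSpace ℝ EN]
  {HN : Type*} [TopologicalSpace HN] (IN : ModelWithCorners ℝ EN HN)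
  {N : Type*} [TopologicalSpace N] [ChartedSpace HN N]

/-- The complexified tangent space `T_x^ℂ M = ℂ ⊗ T_x M`. -/
abbrev CTangent (x : M) : Type _ := ℂ ⊗[ℝ] TangentSpace I x

/-- The complexified differential `dφ_x : T_x^ℂ M → T_{φ x}^ℂ N`. -/
def cdiff (φ : M → N) (x : M) : CTangent I x →ₗ[ℂ] CTangent IN (φ x) :=
  (mfderiv I IN φ x).toLinearMap.baseChange ℂ

variable (M) in
/-- A complex vector field `re + i im`. -/
structure CVectorField where
  /-- real part -/
  re : ∀ x : M, TangentSpace I x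
  /-- imaginary part -/
  im : ∀ x : M, TangentSpace I x

variable {I}

/-- The value of a complex vector field at a point. -/
def CVectorField.val (X : CVectorField I M) (x : M) : CTangent I x := cvec (X.re x) (X.im x)

/-- Smoothness of a vector field on a set. -/
def SmoothFieldOn [IsManifold I 1 M] (X : ∀ x : M, TangentSpace I x) (U : Set M) : Prop :=
  ContMDiffOn I I.tangent ∞ (fun x => (⟨x, X x⟩ : TangentBundle I M)) U

/-- Smoothness of a complex vector field on a set. -/
def CVectorField.SmoothOn [IsManifold I 1 M] (X : CVectorField I M) (U : Set M) : Prop :=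
  SmoothFieldOn X.re U ∧ SmoothFieldOn X.im U

/-- The complex bilinear extension of the Lie bracket of vector fields. -/
def CVectorField.bracket (X Y : CVectorField I M) : CVectorField I M where
  re x := mlieBracket I X.re Y.re x - mlieBracket I X.im Y.im x
  im x := mlieBracket I X.re Y.im x + mlieBracket I X.im Y.re x

/-- A complex distribution is integrable if its space of (local) sections is closed under the
bracket. -/
def IsIntegrable [IsManifold I 1 M] (D : ∀ x : M, Submodule ℂ (CTangent I x)) : Prop :=
  ∀ (U : Set M), IsOpen U → ∀ X Y : CVectorField I M, X.SmoothOn U → Y.SmoothOn U →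
    (∀ x ∈ U, X.val x ∈ D x) → (∀ x ∈ U, Y.val x ∈ D x) → ∀ x ∈ U, (X.bracket Y).val x ∈ D x

/-- The eigenspace, in `T_x^ℂ M`, of (the complexification of) an endomorphism of `T_x M`. -/
def eigen {x : M} (F : TangentSpace I x →L[ℝ] TangentSpace I x) (a : ℂ) :
    Submodule ℂ (CTangent I x) :=
  Module.End.eigenspace (F.toLinearMap.baseChange ℂ) a

/-- The complex distribution `T^0 ⊕ T^{0,1}` associated to an almost `f`-structure. (For an almost
complex structure `T^0 = 0` and this is `T^{0,1}`.) -/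
def fDistribution (F : ∀ x : M, TangentSpace I x →L[ℝ] TangentSpace I x) (x : M) :
    Submodule ℂ (CTangent I x) :=
  eigen (F x) 0 ⊔ eigen (F x) (-Complex.I)

variable (I) in
/-- Holomorphy of `φ`, on a set `U`, with respect to a complex distribution `D` on the domain and a
complex distribution `D'` on the codomain (given along `φ`): `dφ(D) ⊆ D'`. -/
def IsHolomorphicOn (φ : M → N) (U : Set M) (D : ∀ x : M, Submodule ℂ (CTangent I x))
    (D' : ∀ x : M, Submodule ℂ (CTangent IN (φ x))) : Prop :=
  ∀ x ∈ U, (D x).map (cdiff I IN φ x) ≤ D' x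

/-- The fibre at `x` of the endomorphism bundle of the tangent bundle. -/
abbrev EndFibre (I : ModelWithCorners ℝ E H) (x : M) : Type _ :=
  TangentSpace I x →L[ℝ] TangentSpace I x

variable (I M) in
/-- The total space of the endomorphism bundle `End(TM)`. -/
abbrev EndBundle : Type _ := TotalSpace (E →L[ℝ] E) (fun x : M => EndFibre I x)

variable (I) in
/-- The model of the manifold `End(TM)`. -/
abbrev endModel : ModelWithCorners ℝ (E × (E →L[ℝ] E)) (ModelProd H (E →L[ℝ] E)) :=
  I.prod 𝓘(ℝ, E →L[ℝ] E)

/-- A smooth almost complex structure `J` which is integrable: the bundle of its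
`-i`-eigenspaces is closed under the bracket. -/
structure IsComplexStructure [IsManifold I 1 M] (J : ∀ x : M, EndFibre I x) : Prop where
  smooth : ContMDiff I (endModel I) ∞ (fun x => (⟨x, J x⟩ : EndBundle I M))
  sq : ∀ x v, J x (J x v) = -v
  integrable : IsIntegrable (fun x => eigen (J x) (-Complex.I))

variable (I M) in
/-- A conformal structure: a nonempty set of Riemannian metrics which is the class of each of its
elements under multiplication by smooth positive functions. -/
structure ConformalStructure [IsManifold I 1 M] where
  /-- the representatives of the conformal structure -/
  metrics : Set (ContMDiffRiemannianMetric I ∞ E (fun x : M => TangentSpace I x))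
  nonempty : metrics.Nonempty
  mem_iff : ∀ g ∈ metrics, ∀ g', g' ∈ metrics ↔ ∃ f : M → ℝ, ContMDiff I 𝓘(ℝ, ℝ) ∞ f ∧
    (∀ x, 0 < f x) ∧ ∀ x v w, g'.inner x v w = f x * g.inner x v w

section Conformal

variable [IsManifold I 1 M] (c : ConformalStructure I M)

/-- Orthogonality of complex vectors with respect to the complex bilinear extension of a conformal
structure. -/
def ConformalStructure.IsOrtho {x : M} (z w : CTangent I x) : Prop :=
  ∀ g ∈ c.metrics, LinearMap.BilinForm.baseChange ℂ (g.inner x).toBilinForm z w = 0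

/-- Skew-adjoint endomorphisms of a tangent space, `F^* + F = 0`. -/
def ConformalStructure.IsSkew {x : M} (F : EndFibre I x) : Prop :=
  ∀ g ∈ c.metrics, ∀ v w, g.inner x (F v) w = -g.inner x v (F w)

/-- The fibre at `x` of the bundle `Q_{M,r}`: the isotropic subspaces, of complex dimension `r`, of
`(T_x^ℂ M, c_x)`. -/
structure ConformalStructure.IsotropicSpace (r : ℕ) (x : M) where
  /-- the isotropic subspace -/
  space : Submodule ℂ (CTangent I x)
  isotropic : ∀ z ∈ space, ∀ w ∈ space, c.IsOrtho z w
  finrank_eq : Module.finrank ℂ space = r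

variable {c} in
/-- An isotropic space is the `-i`-eigenspace of a unique skew-adjoint `f`-structure. -/
theorem ConformalStructure.IsotropicSpace.existsUnique [FiniteDimensional ℝ E] {r : ℕ} {x : M}
    (q : c.IsotropicSpace r x) :
    ∃! F : EndFibre I x, c.IsSkew F ∧ F ∘L F ∘L F + F = 0 ∧ eigen F (-Complex.I) = q.space := by
  have : FiniteDimensional ℝ (TangentSpace I x) := inferInstanceAs (FiniteDimensional ℝ E)
  have : T2Space (TangentSpace I x) := inferInstanceAs (T2Space E)
  obtain ⟨g, hg⟩ := c.nonempty
  obtain ⟨F, ⟨h1, h2, h3⟩, hu⟩ := existsUnique_fStructure (g.inner x).toBilinForm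
    (fun u v => g.symm x u v) (fun u hu => g.pos x u hu) q.space
    (fun z hz w hw => q.isotropic z hz w hw g hg)
  refine ⟨LinearMap.toContinuousLinearMap F, ⟨?_, ?_, h3⟩, ?_⟩
  · intro g' hg' v w
    obtain ⟨f, -, -, hf⟩ := (c.mem_iff g hg g').1 hg'
    rw [hf, hf, ← mul_neg]
    exact congrArg _ (h1 v w)
  · ext v
    exact LinearMap.congr_fun h2 v
  · rintro F' ⟨k1, k2, k3⟩
    have := hu F'.toLinearMap ⟨fun u v => k1 g hg u v, ?_, k3⟩
    · ext v
      exact LinearMap.congr_fun this v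
    · ext v
      exact DFunLike.congr_fun k2 v

variable {c} in
/-- The skew-adjoint `f`-structure `F^q` on `(T_x M, c_x)` whose eigenspace corresponding to `-i` is
the isotropic space `q`. -/
def ConformalStructure.IsotropicSpace.fStructure [FiniteDimensional ℝ E] {r : ℕ} {x : M}
    (q : c.IsotropicSpace r x) : EndFibre I x :=
  q.existsUnique.choose

variable {c} in
/-- The embedding `q ↦ F^q` of `Q_{M,r}` in `End(TM)`, as the bundle of skew-adjoint
`f`-structures with kernels of codimension `2r`. The bundle `Q_{M,r}` is regarded as a submanifold of
`End(TM)` through this embedding. -/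
def ConformalStructure.IsotropicSpace.point [FiniteDimensional ℝ E] {r : ℕ} {x : M}
    (q : c.IsotropicSpace r x) : EndBundle I M :=
  ⟨x, q.fStructure⟩

/-- `D` is a Weyl connection on `(M, c)`: a smooth torsion-free connection on `TM` such that, for any
representative `g` of `c`, we have `D g = α ⊗ g` for some one-form `α`. -/
structure ConformalStructure.IsWeylConnection [FiniteDimensional ℝ E] [IsManifold I 2 M]
    (D : CovariantDerivative I E (TangentSpace I : M → Type _)) : Prop where
  smooth : CovariantDerivative.ContMDiffCovariantDerivative D ∞
  torsion_eq_zero : D.torsion = 0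
  conformal : ∀ g ∈ c.metrics, ∀ x : M, ∃ α : TangentSpace I x →L[ℝ] ℝ,
    ∀ Y Z : (∀ y : M, TangentSpace I y),
      ContMDiffAt I I.tangent ∞ (fun y => (⟨y, Y y⟩ : TangentBundle I M)) x →
      ContMDiffAt I I.tangent ∞ (fun y => (⟨y, Z y⟩ : TangentBundle I M)) x →
      ∀ v : TangentSpace I x,
        mvfderiv I (fun y => g.inner y (Y y) (Z y)) x v -
          g.inner x (D Y x v) (Z x) - g.inner x (Y x) (D Z x v) = α v * g.inner x (Y x) (Z x)

end Conformal

section TwistorBundle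

variable [IsManifold I 1 M]

/-- The vertical lift to `End(TM)`: the velocity at `F` of the line `t ↦ F + t A`. -/
def verticalLift {x : M} (F A : EndFibre I x) :
    TangentSpace (endModel I) (⟨x, F⟩ : EndBundle I M) :=
  mfderiv 𝓘(ℝ, ℝ) (endModel I) (fun t : ℝ => (⟨x, F + t • A⟩ : EndBundle I M)) 0 (1 : ℝ)

/-- The covariant derivative induced by a connection `D` on `End(TM)` vanishes on the section `s`, at
`x` and in the direction `v`: `0 = (D_v s)(Y) = D_v(s Y) - s(D_v Y)` for any vector field `Y`. -/
def IsParallelAt (D : CovariantDerivative I E (TangentSpace I : M → Type _))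
    (s : ∀ y : M, EndFibre I y) (x : M) (v : TangentSpace I x) : Prop :=
  ∀ Y : (∀ y : M, TangentSpace I y),
    ContMDiffAt I I.tangent ∞ (fun y => (⟨y, Y y⟩ : TangentBundle I M)) x →
    D (fun y => s y (Y y)) x v - s x (D Y x v) = 0

/-- The horizontal space at `F` of the connection induced by `D` on `End(TM)`: it is formed of the
vectors `ds(v)`, for local sections `s` with `s_x = F` and `D_v s = 0`. If `D` is a Weyl connection and
`F` is in `Q_{M,r}` then this is the horizontal space, at `F`, of the connection induced on
`Q_{M,r}`. -/
def horizontalSpace (D : CovariantDerivative I E (TangentSpace I : M → Type _)) {x : M}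
    (F : EndFibre I x) : Submodule ℝ (TangentSpace (endModel I) (⟨x, F⟩ : EndBundle I M)) :=
  Submodule.span ℝ {ξ | ∃ (s : ∀ y : M, EndFibre I y) (v : TangentSpace I x),
    ContMDiffAt I (endModel I) ∞ (fun y => (⟨y, s y⟩ : EndBundle I M)) x ∧ s x = F ∧
    IsParallelAt D s x v ∧
    ξ = mfderiv I (endModel I) (fun y => (⟨y, s y⟩ : EndBundle I M)) x v}

variable (I M) in
/-- The differential, at a point of `End(TM)`, of the projection onto `M`. -/
def dproj (e : EndBundle I M) : TangentSpace (endModel I) e →L[ℝ] TangentSpace I e.proj :=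
  mfderiv (endModel I) I (TotalSpace.proj : EndBundle I M → M) e

variable {c : ConformalStructure I M} {r : ℕ} {x : M} [FiniteDimensional ℝ E]

namespace ConformalStructure.IsotropicSpace

/-- `A` is tangent to the fibre of `Q_{M,r}` at `q`: it is the velocity of a curve in that fibre. -/
def IsTangentToFibre (q : c.IsotropicSpace r x) (A : EndFibre I x) : Prop :=
  ∃ γ : ℝ → c.IsotropicSpace r x, γ 0 = q ∧ HasDerivAt (fun t => (γ t).fStructure) A 0

/-- The tangent vector at `q` to the Grassmannian of `T_x^ℂ M`, as an element of
`Hom(q, T_x^ℂ M / q)`, corresponding to the tangent vector `A` to the fibre of `Q_{M,r}`. As the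
projection onto the `-i`-eigenspace of an `f`-structure `F` is `(i F - F²) / 2`, the tangent vector is
`Y ↦ (i A - A F - F A) Y / 2` modulo `q`. -/
def grassmannVelocity (q : c.IsotropicSpace r x) (A : EndFibre I x) :
    q.space →ₗ[ℂ] CTangent I x ⧸ q.space :=
  q.space.mkQ ∘ₗ
    ((1 / 2 : ℂ) • (Complex.I • A.toLinearMap.baseChange ℂ -
      (A ∘L q.fStructure + q.fStructure ∘L A).toLinearMap.baseChange ℂ)) ∘ₗ q.space.subtype

/-- The space `(ker dπ)^{0,1}` at `q`: it is formed of the vectors `A + i 𝒥A`, with `A` tangent to the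
fibre of `Q_{M,r}` and `𝒥` the complex structure of the fibre, as a complex submanifold of the
Grassmannian. -/
def vertical01 (q : c.IsotropicSpace r x) : Submodule ℂ (CTangent (endModel I) q.point) :=
  Submodule.span ℂ {ζ | ∃ A B : EndFibre I x, q.IsTangentToFibre A ∧ q.IsTangentToFibre B ∧
    q.grassmannVelocity B = Complex.I • q.grassmannVelocity A ∧
    ζ = cvec (verticalLift q.fStructure A) (verticalLift q.fStructure B)}

variable (D : CovariantDerivative I E (TangentSpace I : M → Type _))

/-- The (complexification of the) space `T^0 Q_{M,r}` at `q`: the horizontal vectors projected by `dπ`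
in `ker F^q`. -/
def horizontal0 (q : c.IsotropicSpace r x) : Submodule ℂ (CTangent (endModel I) q.point) :=
  (horizontalSpace D q.fStructure ⊓
    (LinearMap.ker q.fStructure.toLinearMap).comap (dproj I M q.point).toLinearMap).baseChange ℂ

/-- The space of complex horizontal vectors at `q` projected by `dπ` in `q`. -/
def horizontal01 (q : c.IsotropicSpace r x) : Submodule ℂ (CTangent (endModel I) q.point) :=
  (horizontalSpace D q.fStructure).baseChange ℂ ⊓
    q.space.comap ((dproj I M q.point).toLinearMap.baseChange ℂ)

/-- The complex distribution associated to the almost `f`-structure `ℱ_{M,r}` on `Q_{M,r}`, whose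
eigenspaces corresponding to `0` and `-i` are, respectively, `T^0 Q_{M,r}` and
`horizontal01 ⊕ (ker dπ)^{0,1}`. -/
def distribution (q : c.IsotropicSpace r x) : Submodule ℂ (CTangent (endModel I) q.point) :=
  q.horizontal0 D ⊔ (q.horizontal01 D ⊔ q.vertical01)

end ConformalStructure.IsotropicSpace

end TwistorBundle

section Submersions

variable {IN}

variable [IsManifold I 1 M] [IsManifold IN 1 N] (c : ConformalStructure I M)
  (D : CovariantDerivative I E (TangentSpace I : M → Type _))
  (F : ∀ x : M, EndFibre I x) (φ : M → N) (U : Set M) (J : ∀ y : N, EndFibre IN y)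

variable (I IN) in
/-- A smooth submersion on the open set `U`. -/
def IsSubmersionOn : Prop :=
  ContMDiffOn I IN ∞ φ U ∧ ∀ x ∈ U, Function.Surjective (mfderiv I IN φ x)

/-- The almost `f`-structure `F` is defined, on `U`, by the submersion `φ` onto the complex manifold
`(N, J)`: `φ` is holomorphic and `ker dφ = T^0 M`. -/
def IsDefinedBy : Prop :=
  IsSubmersionOn I IN φ U ∧ φ '' U = Set.univ ∧
    IsHolomorphicOn I IN φ U (fDistribution F) (fun x => fDistribution J (φ x)) ∧
    ∀ x ∈ U, LinearMap.ker (mfderiv I IN φ x).toLinearMap = LinearMap.ker (F x).toLinearMap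

/-- A (complex) covector `θ` at `x` is isotropic if the vector dual to it, with respect to any
representative of the conformal structure, is isotropic. -/
def ConformalStructure.IsIsotropicCovector {x : M} (θ : CTangent I x →ₗ[ℂ] ℂ) : Prop :=
  ∀ g ∈ c.metrics, ∀ z : CTangent I x,
    (∀ w, LinearMap.BilinForm.baseChange ℂ (g.inner x).toBilinForm z w = θ w) →
    LinearMap.BilinForm.baseChange ℂ (g.inner x).toBilinForm z z = 0

/-- Pseudo horizontally conformal maps on `U`: submersions which pull back `(1,0)`-forms (that is,
forms `θ` with `θ ∘ J = i θ`) to isotropic forms. -/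
def IsPseudoHorizontallyConformalOn : Prop :=
  IsSubmersionOn I IN φ U ∧
    ∀ x ∈ U, ∀ θ : CTangent IN (φ x) →ₗ[ℂ] ℂ,
      θ ∘ₗ (J (φ x)).toLinearMap.baseChange ℂ = Complex.I • θ →
      c.IsIsotropicCovector (θ ∘ₗ cdiff I IN φ x)

variable (IN) in
/-- The fibres of `φ|_U` are geodesic: `D_X Y` is tangent to the fibres for any local vector fields `X`
and `Y` tangent to the fibres. -/
def HasGeodesicFibresOn : Prop :=
  ∀ W ⊆ U, IsOpen W → ∀ X Y : (∀ x : M, TangentSpace I x), SmoothFieldOn X W → SmoothFieldOn Y W →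
    (∀ x ∈ W, mfderiv I IN φ x (X x) = 0) → (∀ x ∈ W, mfderiv I IN φ x (Y x) = 0) →
    ∀ x ∈ W, mfderiv I IN φ x (D Y x (X x)) = 0

variable (IN) in
/-- The complexification of the horizontal space `(ker dφ_x)^⊥`. -/
def IsHorizontal {x : M} (z : CTangent I x) : Prop :=
  ∀ w : CTangent I x, cdiff I IN φ x w = 0 → c.IsOrtho w z

/-- The integrability tensor of the horizontal distribution of `φ`, which maps horizontal fields `X`, `Y`
to the opposite of the vertical component of `[X, Y]`, is of degree `(1,1)` with respect to the complex structure for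
which `dφ`, restricted to the horizontal distribution, is holomorphic: the integrability tensor is zero
(that is, `[X, Y]` is horizontal) whenever `X` and `Y` are both of type `(1,0)` or both of
type `(0,1)`. -/
def HasOneOneIntegrabilityTensorOn : Prop :=
  ∀ a : ℂ, (a = Complex.I ∨ a = -Complex.I) →
    ∀ W ⊆ U, IsOpen W → ∀ X Y : CVectorField I M, X.SmoothOn W → Y.SmoothOn W →
      (∀ x ∈ W, IsHorizontal IN c φ (X.val x) ∧ cdiff I IN φ x (X.val x) ∈ eigen (J (φ x)) a) →
      (∀ x ∈ W, IsHorizontal IN c φ (Y.val x) ∧ cdiff I IN φ x (Y.val x) ∈ eigen (J (φ x)) a) →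
      ∀ x ∈ W, IsHorizontal IN c φ ((X.bracket Y).val x)

end Submersions

end Manifold
end FTwistor

end

open FTwistor

/-! Write F for the `f`-structure of p, identify p with the eigenbundle of F for -i, and let T⁰ =
ker F (complexified where needed). Since F is skew, the orthogonal complement of p is exactly T⁰ ⊕
p, the complex distribution of F. Everything is reduced to one condition on the covariant
derivative.

The differential of the section p in a direction z is the horizontal lift of z plus the vertical
vector D_z F. For z in T⁰ ⊕ p the horizontal part always lies in the distribution of the twistor
space, so holomorphy only constrains D_z F. By the description of the complex structure of the
Grassmannian, the vertical part is of type (0,1) precisely when the complex endomorphism D_z F maps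
p into p. This is `distribution_mem_iff`, whose outcome is `PreservesType`. Differentiating FY = -iY
gives (D_z F)Y = -(F + i) D_z Y for a section Y of p. Hence (a) says that D_z Y is again in p, for
every z in T⁰ ⊕ p and every section Y of p.

From (a) to (b): a Weyl connection preserves orthogonality, so D_z also preserves sections of the
complement T⁰ ⊕ p (`PreservesType.cov_mem_fDistribution`). As D is torsion-free, F is integrable. A
real vector of T⁰ ⊕ p lies in T⁰, which makes the fibres geodesic. The bundles p and its conjugate
are closed under brackets, which makes the integrability tensor of degree (1,1). The submersion
itself comes from the Frobenius theorem applied to ker F (`exists_flattening`). In the resulting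
product chart, brackets with fields tangent to the leaves show that F induces a well-defined J on
the leaf space (`exists_complexStructure_of_flat`). A complex structure here is an almost complex
structure whose (0,1)-bundle is closed under brackets, so no holomorphic coordinates are needed.

From (b) to (a): it must be shown that g(D_z Y, w) = 0 for Y in p and z, w in T⁰ ⊕ p. Taking z and w
in T⁰ or in p gives four cases. Each is settled by a Koszul-type argument which plays the skewness
coming from orthogonality against the symmetry coming from integrability, from the (1,1) condition,
or from the geodesic fibres (`preservesType_of_submersion`).

The Frobenius theorem is proved by solving γ' = B(γ)v on [0, 1] with the inverse function theorem in
the Banach space of continuous curves. The needed smooth dependence on v then rests on the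
smoothness of γ ↦ B ∘ γ. -/

/-! ### Smoothness of superposition operators on spaces of continuous functions. -/

section Nemytskii

open Topology

universe u
variable {K : Type*} [TopologicalSpace K] [CompactSpace K]

namespace ContinuousMap

variable {X Y Z : Type*} [NormedAddCommGroup X] [NormedSpace ℝ X] [NormedAddCommGroup Y]
  [NormedSpace ℝ Y] [NormedAddCommGroup Z] [NormedSpace ℝ Z]

/-- The pointwise extension to continuous functions of a continuous bilinear map. -/
noncomputable def bilin (K : Type*) [TopologicalSpace K] [CompactSpace K]
    (β : X →L[ℝ] Y →L[ℝ] Z) : C(K, X) →L[ℝ] C(K, Y) →L[ℝ] C(K, Z) :=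
  LinearMap.mkContinuous₂
    (LinearMap.mk₂ ℝ (fun a η => (⟨fun t => β (a t) (η t), by fun_prop⟩ : C(K, Z)))
      (fun a b η => by ext; simp) (fun c a η => by ext; simp)
      (fun a η ζ => by ext; simp) (fun c a η => by ext; simp)) ‖β‖ (by
    intro a η
    rw [ContinuousMap.norm_le _ (by positivity)]
    intro t
    exact (β.le_opNorm₂ _ _).trans
      (by gcongr; exacts [a.norm_coe_le_norm t, η.norm_coe_le_norm t]))

/-- The superposition operator `γ ↦ f ∘ γ`. -/
def superpose (K : Type*) [TopologicalSpace K] (f : X → Y) (hf : Continuous f) (γ : C(K, X)) :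
    C(K, Y) :=
  (⟨f, hf⟩ : C(X, Y)).comp γ

@[simp] theorem superpose_apply (f : X → Y) (hf : Continuous f) (γ : C(K, X)) (t : K) :
    superpose K f hf γ t = f (γ t) := rfl

theorem continuous_superpose (f : X → Y) (hf : Continuous f) : Continuous (superpose K f hf) :=
  ContinuousMap.continuous_postcomp _

variable {E : Type u} [NormedAddCommGroup E] [NormedSpace ℝ E]

/-- The remainder has to be small uniformly in t. The uniformity comes from the continuity of γ ↦ Df
∘ γ in the sup norm, so no compactness in `E` is needed; the mean value inequality then applies at
each t. -/
theorem hasFDerivAt_superpose {G : Type u} [NormedAddCommGroup G] [NormedSpace ℝ G]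
    (f : E → G) (hf : ContDiff ℝ 1 f) (hc : Continuous (fderiv ℝ f)) (γ : C(K, E)) :
    HasFDerivAt (superpose K f hf.continuous)
      (bilin K (ContinuousLinearMap.id ℝ (E →L[ℝ] G)) (superpose K (fderiv ℝ f) hc γ)) γ := by
  rw [hasFDerivAt_iff_isLittleO_nhds_zero, Asymptotics.isLittleO_iff]
  intro ε hε
  obtain ⟨δ, hδ, h1⟩ := Metric.continuousAt_iff.1
    ((continuous_superpose (K := K) (fderiv ℝ f) hc).continuousAt (x := γ)) ε hε
  filter_upwards [Metric.ball_mem_nhds (0 : C(K, E)) hδ] with η hη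
  rw [ContinuousMap.norm_le _ (by positivity)]
  intro t
  have hηδ : ‖η‖ < δ := by simpa using hη
  have key : ∀ x ∈ Metric.ball (γ t) δ, ‖fderiv ℝ f x - fderiv ℝ f (γ t)‖ ≤ ε := by
    intro x hx
    -- The shift of γ by the constant x - γ t is close to γ and takes the value x at t. Evaluating
    -- the sup-norm estimate `h1` at t therefore bounds Df at x.
    have h2 : dist (γ + ContinuousMap.const K (x - γ t)) γ < δ := by
      rw [dist_eq_norm, add_sub_cancel_left]
      rw [ContinuousMap.norm_lt_iff _ hδ]
      intro s
      simpa [dist_eq_norm] using hx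
    have h3 := (ContinuousMap.dist_apply_le_dist t).trans_lt (h1 h2)
    simp only [superpose_apply, ContinuousMap.add_apply, ContinuousMap.const_apply,
      add_sub_cancel] at h3
    rw [dist_eq_norm] at h3
    exact h3.le
  change ‖f ((γ + η) t) - f (γ t) - fderiv ℝ f (γ t) (η t)‖ ≤ _
  have h4 := (convex_ball (γ t) δ).norm_image_sub_le_of_norm_hasFDerivWithin_le'
    (f := f) (f' := fderiv ℝ f) (φ := fderiv ℝ f (γ t)) (C := ε)
    (fun x _ => ((hf.differentiable (by simp)) x).hasFDerivAt.hasFDerivWithinAt) key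
    (Metric.mem_ball_self hδ) (y := γ t + η t)
    (by simpa [dist_eq_norm] using (η.norm_coe_le_norm t).trans_lt hηδ)
  simp only [add_sub_cancel_left] at h4
  exact h4.trans (by gcongr; exact η.norm_coe_le_norm t)

/-- The derivative is a bounded bilinear pairing composed with the superposition operator of Df,
which has one degree of smoothness less. The induction quantifies over the target because it changes
from `G` to `E →L[ℝ] G`; this is also why both spaces share a universe. -/
theorem contDiff_superpose_nat (n : ℕ) : ∀ {G : Type u} [NormedAddCommGroup G] [NormedSpace ℝ G]
    (f : E → G) (hf : ContDiff ℝ n f), ContDiff ℝ n (superpose K f hf.continuous) := by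
  induction n with
  | zero =>
    intro G _ _ f hf
    exact contDiff_zero.2 (continuous_superpose _ _)
  | succ n ih =>
    intro G _ _ f hf
    have hf' : ContDiff ℝ n (fderiv ℝ f) := hf.fderiv_right (by simp)
    refine contDiff_succ_iff_hasFDerivAt.2 ⟨fun γ => bilin K (ContinuousLinearMap.id ℝ (E →L[ℝ] G)) (superpose K (fderiv ℝ f) hf'.continuous γ), ?_, ?_⟩
    · exact (bilin K (ContinuousLinearMap.id ℝ (E →L[ℝ] G))).contDiff.comp (ih _ hf')
    · intro γ
      exact hasFDerivAt_superpose f (hf.of_le (by simp)) _ γ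

theorem contDiff_superpose {G : Type u} [NormedAddCommGroup G] [NormedSpace ℝ G]
    (f : E → G) (hf : ContDiff ℝ ∞ f) : ContDiff ℝ ∞ (superpose K f hf.continuous) := by
  rw [contDiff_infty]
  intro n
  exact contDiff_superpose_nat n f (hf.of_le (by exact_mod_cast le_top))

end ContinuousMap

end Nemytskii

/-! ### The inverse function theorem on a neighbourhood. -/

section InverseFunction

/-- The inverse function theorem for smooth maps, with a smooth inverse on a neighbourhood. -/
theorem ContDiffOn.exists_openPartialHomeomorph {E G : Type*} [NormedAddCommGroup E]
    [NormedSpace ℝ E] [CompleteSpace E] [NormedAddCommGroup G] [NormedSpace ℝ G] [CompleteSpace G]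
    {f : E → G} {U : Set E} (hU : IsOpen U) {a : E} (ha : a ∈ U) (hf : ContDiffOn ℝ ∞ f U)
    (e : E ≃L[ℝ] G) (he : HasFDerivAt f (e : E →L[ℝ] G) a) :
    ∃ Φ : OpenPartialHomeomorph E G, a ∈ Φ.source ∧ Φ.source ⊆ U ∧ (∀ x, Φ x = f x) ∧
      ContDiffOn ℝ ∞ Φ.symm Φ.target ∧
      ∀ x ∈ Φ.source, ∃ e' : E ≃L[ℝ] G, HasFDerivAt f (e' : E →L[ℝ] G) x := by
  have hfa := hf.contDiffAt (hU.mem_nhds ha)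
  let Φ := hfa.toOpenPartialHomeomorph f he (by simp)
  -- Invertible operators form an open set. Restricting to the points with invertible derivative
  -- makes the inverse smooth on the whole target, and not only at the image of `a`.
  have hopen : IsOpen {x ∈ U | fderiv ℝ f x ∈ Set.range ((↑) : (E ≃L[ℝ] G) → E →L[ℝ] G)} :=
    (hf.continuousOn_fderiv_of_isOpen hU (by simp)).isOpen_inter_preimage hU
      ContinuousLinearEquiv.isOpen
  have hmem : ∀ x ∈ (Φ.restrOpen _ hopen).source,
      x ∈ U ∧ ∃ e' : E ≃L[ℝ] G, HasFDerivAt f (e' : E →L[ℝ] G) x := by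
    rintro x ⟨-, hx, e', he'⟩
    refine ⟨hx, e', ?_⟩
    rw [he']
    exact ((hf.contDiffAt (hU.mem_nhds hx)).differentiableAt (by simp)).hasFDerivAt
  refine ⟨Φ.restrOpen _ hopen, ?_, fun x hx => (hmem x hx).1, fun x => rfl, ?_,
    fun x hx => (hmem x hx).2⟩
  · exact ⟨hfa.mem_toOpenPartialHomeomorph_source he (by simp), ha, e, he.fderiv.symm⟩
  · intro y hy
    obtain ⟨h1, e', he'⟩ := hmem _ ((Φ.restrOpen _ hopen).map_target hy)
    exact ((Φ.restrOpen _ hopen).contDiffAt_symm hy he'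
      (hf.contDiffAt (hU.mem_nhds h1))).contDiffWithinAt

end InverseFunction

/-! ### The equation γ' = B(γ)v as an equation in the space of continuous curves. -/

section RadialFlow

open ContinuousMap unitInterval

universe u
variable {E : Type u} [NormedAddCommGroup E] [NormedSpace ℝ E] [CompleteSpace E]

/-- The primitive, vanishing at `0`, of a continuous function on the unit interval. -/
noncomputable def primitiveCLM (E : Type u) [NormedAddCommGroup E] [NormedSpace ℝ E]
    [CompleteSpace E] : C(I, E) →L[ℝ] C(I, E) :=
  LinearMap.mkContinuous
    { toFun := fun η => ⟨fun t => ∫ s in (0 : ℝ)..t, η (Set.projIcc 0 1 zero_le_one s), by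
        have : Continuous fun t : ℝ => ∫ s in (0 : ℝ)..t, η (Set.projIcc 0 1 zero_le_one s) :=
          intervalIntegral.continuous_primitive
            (fun a b => Continuous.intervalIntegrable (by fun_prop) _ _) 0
        exact this.comp continuous_subtype_val⟩
      map_add' := fun η ζ => by
        ext t
        simp only [ContinuousMap.add_apply, ContinuousMap.coe_mk]
        exact intervalIntegral.integral_add (Continuous.intervalIntegrable (by fun_prop) _ _)
          (Continuous.intervalIntegrable (by fun_prop) _ _)
      map_smul' := fun c η => by
        ext t
        simp } 1 (by
    intro η
    rw [one_mul, ContinuousMap.norm_le _ (by positivity)]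
    intro t
    simp only [LinearMap.coe_mk, AddHom.coe_mk, ContinuousMap.coe_mk]
    refine (intervalIntegral.norm_integral_le_of_norm_le_const
      (fun s _ => η.norm_coe_le_norm _)).trans ?_
    have h0 := t.2.1
    have h1 := t.2.2
    rw [sub_zero, abs_of_nonneg h0]
    exact mul_le_of_le_one_right (norm_nonneg _) h1)

theorem primitiveCLM_apply (η : C(I, E)) (t : I) :
    primitiveCLM E η t = ∫ s in (0 : ℝ)..t, η (Set.projIcc 0 1 zero_le_one s) := rfl

/-- Constant functions on the unit interval. -/
noncomputable def constCLM (E : Type u) [NormedAddCommGroup E] [NormedSpace ℝ E] :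
    E →L[ℝ] C(I, E) :=
  LinearMap.mkContinuous
    { toFun := fun v => ContinuousMap.const I v
      map_add' := fun _ _ => rfl
      map_smul' := fun _ _ => rfl } 1 (by
    intro v
    rw [one_mul]
    exact (ContinuousMap.norm_le _ (norm_nonneg _)).2 fun _ => le_rfl)

set_option synthInstance.maxHeartbeats 400000 in
set_option maxHeartbeats 1000000 in
/-- The solutions of `γ' = B(γ) v`, `γ(0) = Q v` exist on `[0, 1]` and depend smoothly on `v`, for `v`
near zero; moreover, the derivatives with respect to `v` are the unique solutions of the
linearised equation. -/
theorem exists_radial_flow (B : E → E →L[ℝ] E) (hB : ContDiff ℝ ∞ B) (Q : E →L[ℝ] E) :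
    ∃ (U : Set E) (Γ : E → C(I, E)), IsOpen U ∧ 0 ∈ U ∧ ContDiffOn ℝ ∞ Γ U ∧ Γ 0 = 0 ∧
      (∀ v ∈ U, ∀ t : I, Γ v t =
        Q v + ∫ s in (0 : ℝ)..t, B (Γ v (Set.projIcc 0 1 zero_le_one s)) v) ∧
      ∀ v ∈ U, ∀ k : E, ∀ η : C(I, E),
        (∀ t : I, η t = Q k + ∫ s in (0 : ℝ)..t,
          (fderiv ℝ B (Γ v (Set.projIcc 0 1 zero_le_one s)) (η (Set.projIcc 0 1 zero_le_one s)) v +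
            B (Γ v (Set.projIcc 0 1 zero_le_one s)) k)) → fderiv ℝ Γ v k = η := by
  let β := bilin I (ContinuousLinearMap.id ℝ (E →L[ℝ] E))
  let P := primitiveCLM E
  let N := superpose I B hB.continuous
  have hB' : ContDiff ℝ ∞ (fderiv ℝ B) := hB.fderiv_right (by simp)
  let N' := fun γ => bilin I (ContinuousLinearMap.id ℝ (E →L[ℝ] E →L[ℝ] E))
    (superpose I (fderiv ℝ B) hB'.continuous γ)
  have hN : ∀ γ, HasFDerivAt N (N' γ) γ :=
    fun γ => hasFDerivAt_superpose B (hB.of_le (by simp)) hB'.continuous γ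
  -- The integral form of the differential equation reads Φ(v, γ) = (v, 0). Keeping v as the first
  -- component turns the implicit function problem into an inverse function problem.
  let Φ : E × C(I, E) → E × C(I, E) :=
    fun p => (p.1, p.2 - constCLM E (Q p.1) - P (β (N p.2) (constCLM E p.1)))
  have hΦs : ContDiff ℝ ∞ Φ := by
    refine contDiff_fst.prodMk ((contDiff_snd.sub ?_).sub ?_)
    · exact ((constCLM E).comp Q).contDiff.comp contDiff_fst
    · refine P.contDiff.comp ?_
      exact β.isBoundedBilinearMap.contDiff.comp
        (((contDiff_superpose B hB).comp contDiff_snd).prodMk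
          ((constCLM E).contDiff.comp contDiff_fst))
  let Φ' : E × C(I, E) → E × C(I, E) →L[ℝ] E × C(I, E) := fun p =>
    (ContinuousLinearMap.fst ℝ E C(I, E)).prod
      (ContinuousLinearMap.snd ℝ E C(I, E) - (constCLM E ∘L Q) ∘L ContinuousLinearMap.fst ℝ E C(I, E)
        - P ∘L (β.precompR _ (N p.2) (constCLM E ∘L ContinuousLinearMap.fst ℝ E C(I, E)) +
          β.precompL _ (N' p.2 ∘L ContinuousLinearMap.snd ℝ E C(I, E)) (constCLM E p.1)))
  have hΦ : ∀ p, HasFDerivAt Φ (Φ' p) p := by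
    intro p
    refine hasFDerivAt_fst.prodMk ((hasFDerivAt_snd.sub
      ((constCLM E ∘L Q).hasFDerivAt.comp p hasFDerivAt_fst)).sub (P.hasFDerivAt.comp p ?_))
    exact β.hasFDerivAt_of_bilinear ((hN p.2).comp p hasFDerivAt_snd)
      ((constCLM E).hasFDerivAt.comp p hasFDerivAt_fst)
  have hΦ'a : ∀ p q, Φ' p q = (q.1, q.2 - constCLM E (Q q.1) -
      P (β (N p.2) (constCLM E q.1) + β (N' p.2 q.2) (constCLM E p.1))) := fun p q => rfl
  let A : E →L[ℝ] C(I, E) := constCLM E ∘L Q + P ∘L β (N 0) ∘L constCLM E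
  -- The term with the derivative of B carries a factor v, hence vanishes at v = 0. The differential
  -- at the origin is thus the unipotent map (q₁, q₂ - A q₁), invertible without any smallness of B;
  -- small v replaces short time.
  let e : (E × C(I, E)) ≃L[ℝ] (E × C(I, E)) := ContinuousLinearEquiv.equivOfInverse
    ((ContinuousLinearMap.fst ℝ E C(I, E)).prod
      (ContinuousLinearMap.snd ℝ E C(I, E) - A ∘L ContinuousLinearMap.fst ℝ E C(I, E)))
    ((ContinuousLinearMap.fst ℝ E C(I, E)).prod
      (ContinuousLinearMap.snd ℝ E C(I, E) + A ∘L ContinuousLinearMap.fst ℝ E C(I, E)))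
    (fun q => by simp) (fun q => by simp)
  have he : HasFDerivAt Φ (e : E × C(I, E) →L[ℝ] E × C(I, E)) (0, 0) := by
    have : (e : E × C(I, E) →L[ℝ] E × C(I, E)) = Φ' (0, 0) := by
      refine ContinuousLinearMap.ext fun q => ?_
      rw [hΦ'a]
      change (q.1, q.2 - A q.1) = _
      simp only [A, _root_.add_apply, ContinuousLinearMap.comp_apply, map_zero,
        add_zero, sub_sub]
    rw [this]
    exact hΦ _
  obtain ⟨Ψ, h0, -, hΨ, hsymm, hder⟩ := hΦs.contDiffOn.exists_openPartialHomeomorph isOpen_univ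
    (Set.mem_univ ((0 : E), (0 : C(I, E)))) e he
  have hΦ0 : Φ (0, 0) = (0, 0) := by
    simp only [Φ, map_zero, sub_zero]
  have hsymm0 : Ψ.symm (0, 0) = (0, 0) := by
    have := Ψ.left_inv h0
    rwa [hΨ, hΦ0] at this
  let U : Set E := (fun v : E => (v, (0 : C(I, E)))) ⁻¹' Ψ.target
  let Γ : E → C(I, E) := fun v => (Ψ.symm (v, 0)).2
  have hUo : IsOpen U := Ψ.open_target.preimage (by fun_prop)
  have hpair : ∀ v ∈ U, Ψ.symm (v, 0) = (v, Γ v) := by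
    intro v hv
    have h1 : Φ (Ψ.symm (v, 0)) = (v, 0) := (hΨ _).symm.trans (Ψ.right_inv hv)
    have h2 : (Φ (Ψ.symm (v, 0))).1 = v := congrArg Prod.fst h1
    exact Prod.ext h2 rfl
  have hsol : ∀ v ∈ U, Φ (v, Γ v) = (v, 0) := by
    intro v hv
    have h1 : Φ (Ψ.symm (v, 0)) = (v, 0) := (hΨ _).symm.trans (Ψ.right_inv hv)
    rwa [hpair v hv] at h1
  have hΓs : ContDiffOn ℝ ∞ Γ U := by
    refine contDiff_snd.comp_contDiffOn (hsymm.comp ?_ fun v hv => hv)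
    exact (contDiff_id.prodMk contDiff_const).contDiffOn
  refine ⟨U, Γ, hUo, ?_, hΓs, ?_, ?_, ?_⟩
  · change _ ∈ Ψ.target
    have := Ψ.map_source h0
    rwa [hΨ, hΦ0] at this
  · simp only [Γ, hsymm0]
  · intro v hv t
    have h1 := congrArg (fun q => q.2 t) (hsol v hv)
    simp only [Φ, ContinuousMap.sub_apply, ContinuousMap.zero_apply, P, primitiveCLM_apply] at h1
    rw [sub_sub, sub_eq_zero] at h1
    exact h1
  · intro v hv k η hη
    obtain ⟨e', he'⟩ := hder (v, Γ v) (hpair v hv ▸ Ψ.map_target hv)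
    have hee : ∀ q, e' q = Φ' (v, Γ v) q := fun q =>
      DFunLike.congr_fun (he'.unique (hΦ (v, Γ v))) q
    have hd : HasFDerivAt Γ (fderiv ℝ Γ v) v :=
      ((hΓs.contDiffAt (hUo.mem_nhds hv)).differentiableAt (by simp)).hasFDerivAt
    -- Differentiating Φ(x, Γ x) = (x, 0) shows that (k, dΓ(k)) and (k, η) have the same image under
    -- the injective differential of Φ.
    have h1 : e' (k, fderiv ℝ Γ v k) = (k, 0) := by
      have h2 := he'.comp v ((hasFDerivAt_id v).prodMk hd)
      have h3 : HasFDerivAt (Φ ∘ fun x => (id x, Γ x))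
          ((ContinuousLinearMap.id ℝ E).prod (0 : E →L[ℝ] C(I, E))) v := by
        refine ((hasFDerivAt_id v).prodMk (hasFDerivAt_const (0 : C(I, E)) v)).congr_of_eventuallyEq ?_
        filter_upwards [hUo.mem_nhds hv] with x hx
        exact hsol x hx
      exact DFunLike.congr_fun (h2.unique h3) k
    have h2 : e' (k, η) = (k, 0) := by
      rw [hee, hΦ'a]
      refine Prod.ext rfl ?_
      ext t
      simp only [ContinuousMap.sub_apply, ContinuousMap.zero_apply, P, primitiveCLM_apply]
      rw [sub_sub, sub_eq_zero, hη t]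
      simp only [add_comm (fderiv ℝ B _ _ _)]
      rfl
    have h3 := e'.injective (h1.trans h2.symm)
    exact congrArg Prod.snd h3

end RadialFlow

/-! ### The Frobenius theorem for the range of a smooth family of projections. -/

section Frobenius

open unitInterval

universe u
variable {E : Type u} [NormedAddCommGroup E] [NormedSpace ℝ E]

/-- The operator intertwining the projections `P` and `P₀`, which is the identity if `P = P₀`. -/
def intertwiner (P₀ P : E →L[ℝ] E) : E →L[ℝ] E :=
  P₀ ∘L P + (ContinuousLinearMap.id ℝ E - P₀) ∘L (ContinuousLinearMap.id ℝ E - P)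

theorem intertwiner_apply (P₀ P : E →L[ℝ] E) (w : E) :
    intertwiner P₀ P w = P₀ (P w) + (w - P w - P₀ (w - P w)) := rfl

theorem intertwiner_self {P : E →L[ℝ] E} (h : ∀ w, P (P w) = P w) :
    intertwiner P P = ContinuousLinearMap.id ℝ E := by
  ext w
  simp [intertwiner_apply, h]

/-- The section, over the range of `P₀`, of the range of `P`. -/
noncomputable def projLift (P₀ P : E →L[ℝ] E) : E →L[ℝ] E := (intertwiner P₀ P).inverse ∘L P₀

section projLift

variable {P₀ P : E →L[ℝ] E} (h₀ : ∀ w, P₀ (P₀ w) = P₀ w) (h : ∀ w, P (P w) = P w)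
  (hT : (intertwiner P₀ P).IsInvertible)

include hT in
theorem intertwiner_projLift (w : E) : intertwiner P₀ P (projLift P₀ P w) = P₀ w := by
  rw [projLift, ContinuousLinearMap.comp_apply]
  exact hT.self_apply_inverse _

include h₀ h hT

/-- The intertwiner T satisfies T P = P₀ P = P₀ T, so its inverse carries the range of P₀ into the
range of P. On the range of P it coincides with P₀, which makes the lift a section of P₀ in the next
lemma. -/
theorem apply_projLift (w : E) : P (projLift P₀ P w) = projLift P₀ P w := by
  obtain ⟨e, he⟩ := hT
  have h1 := intertwiner_projLift ⟨e, he⟩ w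
  apply e.injective
  have h2 : ∀ u, e u = intertwiner P₀ P u := fun u => DFunLike.congr_fun he u
  have h3 := congrArg P₀ h1
  simp only [intertwiner_apply, map_add, map_sub, h₀, sub_self, add_zero] at h3
  rw [h2, h2, h1, intertwiner_apply, h, sub_self, map_zero, sub_zero, add_zero]
  exact h3

theorem base_projLift (w : E) : P₀ (projLift P₀ P w) = P₀ w := by
  have h1 := intertwiner_projLift hT w
  rwa [intertwiner_apply, apply_projLift h₀ h hT, sub_self, map_zero, sub_zero, add_zero] at h1

theorem projLift_base {w : E} (hw : P w = w) : projLift P₀ P (P₀ w) = w := by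
  have hT' := hT
  obtain ⟨e, he⟩ := hT'
  apply e.injective
  have h2 : ∀ u, e u = intertwiner P₀ P u := fun u => DFunLike.congr_fun he u
  rw [h2, h2, intertwiner_projLift hT, h₀, intertwiner_apply, hw, sub_self, map_zero,
    sub_zero, add_zero]

end projLift

variable {P : E → E →L[ℝ] E} {Ω : Set E}

theorem contDiffOn_projLift [CompleteSpace E] (P₀ : E →L[ℝ] E)
    (hs : ContDiffOn ℝ ∞ P Ω)
    (hT : ∀ z ∈ Ω, (intertwiner P₀ (P z)).IsInvertible) :
    ContDiffOn ℝ ∞ (fun z => projLift P₀ (P z)) Ω := by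
  have h1 : ContDiffOn ℝ ∞ (fun z => intertwiner P₀ (P z)) Ω := by
    unfold intertwiner
    exact (contDiffOn_const.clm_comp hs).add
      (contDiffOn_const.clm_comp (contDiffOn_const.sub hs))
  refine ContDiffOn.clm_comp (fun z hz => ?_) contDiffOn_const
  exact (hT z hz).contDiffAt_map_inverse.comp_contDiffWithinAt z (h1 z hz)

/-- The lifts of constant fields commute. -/
theorem fderiv_projLift_symm [CompleteSpace E] (P₀ : E →L[ℝ] E) (h₀ : ∀ w, P₀ (P₀ w) = P₀ w)
    (hΩ : IsOpen Ω) (hs : ContDiffOn ℝ ∞ P Ω) (h : ∀ z ∈ Ω, ∀ w, P z (P z w) = P z w)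
    (hT : ∀ z ∈ Ω, (intertwiner P₀ (P z)).IsInvertible)
    (hinv : ∀ X Y : E → E, ContDiffOn ℝ ∞ X Ω → ContDiffOn ℝ ∞ Y Ω →
      (∀ z ∈ Ω, P z (X z) = X z) → (∀ z ∈ Ω, P z (Y z) = Y z) →
      ∀ z ∈ Ω, P z (lieBracket ℝ X Y z) = lieBracket ℝ X Y z)
    {z : E} (hz : z ∈ Ω) (v k : E) :
    fderiv ℝ (fun z => projLift P₀ (P z)) z (projLift P₀ (P z) v) k =
      fderiv ℝ (fun z => projLift P₀ (P z)) z (projLift P₀ (P z) k) v := by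
  have hB := contDiffOn_projLift P₀ hs hT
  have hX : ∀ k, ContDiffOn ℝ ∞ (fun z => projLift P₀ (P z) k) Ω :=
    fun k => hB.clm_apply contDiffOn_const
  have hd : DifferentiableAt ℝ (fun z => projLift P₀ (P z)) z :=
    (hB.contDiffAt (hΩ.mem_nhds hz)).differentiableAt (by simp)
  have hf : ∀ k u, fderiv ℝ (fun z => projLift P₀ (P z) k) z u =
      fderiv ℝ (fun z => projLift P₀ (P z)) z u k := by
    intro k u
    rw [fderiv_clm_apply hd (differentiableAt_const k)]
    simp
  have h1 := hinv _ _ (hX v) (hX k) (fun z hz => apply_projLift h₀ (h z hz) (hT z hz) v)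
    (fun z hz => apply_projLift h₀ (h z hz) (hT z hz) k) z hz
  -- The lift of k projects by P₀ to the constant P₀ k, so all its derivatives, and hence the
  -- brackets of lifts, are in the kernel of P₀.
  have h0 : ∀ k u, P₀ (fderiv ℝ (fun z => projLift P₀ (P z) k) z u) = 0 := by
    intro k u
    have h2 : HasFDerivAt (fun z => P₀ (projLift P₀ (P z) k))
        (P₀ ∘L fderiv ℝ (fun z => projLift P₀ (P z) k) z) z :=
      P₀.hasFDerivAt.comp z
        (((hX k).contDiffAt (hΩ.mem_nhds hz)).differentiableAt (by simp)).hasFDerivAt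
    have h3 : HasFDerivAt (fun z => P₀ (projLift P₀ (P z) k)) (0 : E →L[ℝ] E) z := by
      refine (hasFDerivAt_const (P₀ k) z).congr_of_eventuallyEq ?_
      filter_upwards [hΩ.mem_nhds hz] with y hy
      exact base_projLift h₀ (h y hy) (hT y hy) k
    exact DFunLike.congr_fun (h2.unique h3) u
  -- By involutivity the bracket lies in the range of P, where P₀ is injective; being killed by P₀,
  -- it vanishes.
  have h4 := projLift_base h₀ (h z hz) (hT z hz) h1
  rw [lieBracket, map_sub, h0, h0, sub_zero, map_zero] at h4
  rw [← hf, ← hf]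
  exact sub_eq_zero.1 h4.symm

/-- A function which is smooth on a neighbourhood of `0` agrees with a smooth function near `0`. -/
theorem exists_contDiff_eqOn_ball [FiniteDimensional ℝ E] {G : Type*} [NormedAddCommGroup G]
    [NormedSpace ℝ G] {f : E → G} (hΩ : IsOpen Ω) (h0 : 0 ∈ Ω) (hf : ContDiffOn ℝ ∞ f Ω) :
    ∃ (g : E → G) (ε : ℝ), 0 < ε ∧ ContDiff ℝ ∞ g ∧ Metric.ball 0 ε ⊆ Ω ∧
      ∀ z ∈ Metric.ball (0 : E) ε, g z = f z := by
  obtain ⟨ε, hε, hb⟩ := Metric.nhds_basis_closedBall.mem_iff.1 (hΩ.mem_nhds h0)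
  let ρ : ContDiffBump (0 : E) := ⟨ε / 2, ε, by positivity, by linarith⟩
  refine ⟨fun z => ρ z • f z, ε / 2, by positivity, ?_, fun z hz => hb ?_, fun z hz => ?_⟩
  · rw [contDiff_iff_contDiffAt]
    intro z
    by_cases hz : z ∈ Ω
    · exact ρ.contDiff.contDiffAt.smul (hf.contDiffAt (hΩ.mem_nhds hz))
    · have hz' : z ∉ tsupport ρ := fun h => hz (hb (by rwa [ρ.tsupport_eq] at h))
      refine (contDiffAt_const (c := (0 : G))).congr_of_eventuallyEq ?_
      filter_upwards [notMem_tsupport_iff_eventuallyEq.1 hz'] with y hy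
      simp [hy]
  · exact Metric.ball_subset_closedBall (Metric.ball_subset_ball (by linarith) hz)
  · change ρ z • f z = f z
    rw [ρ.one_of_mem_closedBall (Metric.ball_subset_closedBall hz), one_smul]

/-- The Frobenius theorem. -/
theorem exists_flattening [FiniteDimensional ℝ E] (hΩ : IsOpen Ω) {z₀ : E} (hz₀ : z₀ ∈ Ω)
    (hs : ContDiffOn ℝ ∞ P Ω) (h : ∀ z ∈ Ω, ∀ w, P z (P z w) = P z w)
    (hinv : ∀ W ⊆ Ω, IsOpen W → ∀ X Y : E → E, ContDiffOn ℝ ∞ X W → ContDiffOn ℝ ∞ Y W →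
      (∀ z ∈ W, P z (X z) = X z) → (∀ z ∈ W, P z (Y z) = Y z) →
      ∀ z ∈ W, P z (lieBracket ℝ X Y z) = lieBracket ℝ X Y z) :
    ∃ Ψ : OpenPartialHomeomorph E E, 0 ∈ Ψ.source ∧ Ψ 0 = z₀ ∧ Ψ.target ⊆ Ω ∧
      ContDiffOn ℝ ∞ Ψ Ψ.source ∧ ContDiffOn ℝ ∞ Ψ.symm Ψ.target ∧
      ∀ v ∈ Ψ.source, ∀ w, P (Ψ v) w = w ↔ ∃ k, P z₀ k = k ∧ fderiv ℝ Ψ v k = w := by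
  have : CompleteSpace E := FiniteDimensional.complete ℝ E
  have h₀ := h z₀ hz₀
  have hTs : ContDiffOn ℝ ∞ (fun z => intertwiner (P z₀) (P z)) Ω := by
    unfold intertwiner
    exact (contDiffOn_const.clm_comp hs).add
      (contDiffOn_const.clm_comp (contDiffOn_const.sub hs))
  let Ω' : Set E := {z ∈ Ω | (intertwiner (P z₀) (P z)).IsInvertible}
  have hΩ' : IsOpen Ω' := hTs.continuousOn.isOpen_inter_preimage hΩ
    (ContinuousLinearEquiv.isOpen (𝕜 := ℝ) (E := E) (F := E))
  have hz₀' : z₀ ∈ Ω' :=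
    ⟨hz₀, by rw [intertwiner_self h₀]; exact ⟨ContinuousLinearEquiv.refl ℝ E, rfl⟩⟩
  have hΩΩ : Ω' ⊆ Ω := fun z hz => hz.1
  let B₀ : E → E →L[ℝ] E := fun z => projLift (P z₀) (P z)
  have hB₀ : ContDiffOn ℝ ∞ B₀ Ω' := contDiffOn_projLift _ (hs.mono hΩΩ) fun z hz => hz.2
  have hsymm : ∀ z ∈ Ω', ∀ v k, fderiv ℝ B₀ z (B₀ z v) k = fderiv ℝ B₀ z (B₀ z k) v :=
    fun z hz v k => fderiv_projLift_symm (P z₀) h₀ hΩ' (hs.mono hΩΩ)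
      (fun z hz => h z hz.1) (fun z hz => hz.2) (hinv Ω' hΩΩ hΩ') hz v k
  -- The radial flow needs an operator field on the whole space, so the lift is recentred at z₀ and
  -- cut off. The symmetry of its derivative survives only on a ball, and `U'` below collects the v
  -- whose whole curve stays there.
  obtain ⟨B, ε, hε, hB, hball, hBB⟩ := exists_contDiff_eqOn_ball
    (Ω := (fun z => z₀ + z) ⁻¹' Ω') (f := fun z => B₀ (z₀ + z)) (hΩ'.preimage (by fun_prop))
    (by simpa using hz₀') (hB₀.comp (contDiff_const.add contDiff_id).contDiffOn fun z hz => hz)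
  have hBsymm : ∀ z ∈ Metric.ball (0 : E) ε, ∀ v k,
      fderiv ℝ B z (B z v) k = fderiv ℝ B z (B z k) v := by
    intro z hz v k
    have h1 : fderiv ℝ B z = fderiv ℝ B₀ (z₀ + z) := by
      rw [← fderiv_comp_add_left]
      refine Filter.EventuallyEq.fderiv_eq ?_
      filter_upwards [Metric.isOpen_ball.mem_nhds hz] with y hy using hBB y hy
    rw [h1, hBB z hz]
    exact hsymm _ (hball hz) v k
  -- The transverse part Qv of v is the starting point of the curve, while its part P₀ v is lifted
  -- to the velocity. At v = 0 the differential of the endpoint map is Q + P₀, the identity.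
  let Q : E →L[ℝ] E := ContinuousLinearMap.id ℝ E - P z₀
  obtain ⟨U, Γ, hU, h0U, hΓ, hΓ0, hsol, huniq⟩ := exists_radial_flow B hB Q
  let U' : Set E := {v ∈ U | Γ v ∈ Metric.ball 0 ε}
  have hU' : IsOpen U' := hΓ.continuousOn.isOpen_inter_preimage hU Metric.isOpen_ball
  have h0U' : 0 ∈ U' := ⟨h0U, by rw [hΓ0]; exact Metric.mem_ball_self hε⟩
  have hmem : ∀ v ∈ U', ∀ t : I, Γ v t ∈ Metric.ball (0 : E) ε := by
    intro v hv t
    have h1 := hv.2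
    rw [mem_ball_zero_iff] at h1 ⊢
    exact ((Γ v).norm_coe_le_norm t).trans_lt h1
  have hder : ∀ v ∈ U', ∀ k, P z₀ k = k → fderiv ℝ Γ v k 1 = B (Γ v 1) k := by
    intro v hv k hk
    have hQk : Q k = 0 := by simp [Q, hk]
    let c : ℝ → E := fun t => Q v + ∫ s in (0 : ℝ)..t, B (Γ v (Set.projIcc 0 1 zero_le_one s)) v
    have hcc : Continuous fun s : ℝ => B (Γ v (Set.projIcc 0 1 zero_le_one s)) v :=
      (hB.continuous.comp (by fun_prop)).clm_apply continuous_const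
    have hc : ∀ t, HasDerivAt c (B (Γ v (Set.projIcc 0 1 zero_le_one t)) v) t := fun t =>
      (hcc.integral_hasStrictDerivAt 0 t).hasDerivAt.const_add _
    have hcΓ : ∀ t : ℝ, t ∈ Set.Icc (0 : ℝ) 1 → Γ v (Set.projIcc 0 1 zero_le_one t) = c t := by
      intro t ht
      rw [Set.projIcc_of_mem _ ht]
      exact hsol v hv.1 ⟨t, ht⟩
    have hccont : Continuous c := continuous_iff_continuousAt.2 fun t => (hc t).continuousAt
    -- For k in the range of P₀, the derivative of t B(γ)k is B(γ)k + t DB(γ)(B(γ)v)k. Commutation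
    -- of the lifts exchanges v and k in the last term, giving the linearised equation for this
    -- curve. So the endpoint map sends k to B(γ(1))k, which is tangent to the distribution.
    let η : C(I, E) := ⟨fun t => (t : ℝ) • B (Γ v t) k, by
      exact continuous_subtype_val.smul
        ((hB.continuous.comp (Γ v).continuous).clm_apply continuous_const)⟩
    have hη := huniq v hv.1 k η (by
      intro t
      rw [hQk, zero_add]
      have hg : ∀ s : ℝ, HasDerivAt (fun s : ℝ => s • B (c s) k)
          (s • (fderiv ℝ B (c s) (B (Γ v (Set.projIcc 0 1 zero_le_one s)) v)) k +
            (1 : ℝ) • B (c s) k) s := by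
        intro s
        have h1 : HasDerivAt (fun s => B (c s))
            (fderiv ℝ B (c s) (B (Γ v (Set.projIcc 0 1 zero_le_one s)) v)) s :=
          ((hB.differentiable (by simp)) (c s)).hasFDerivAt.comp_hasDerivAt s (hc s)
        have h2 : HasDerivAt (fun s => B (c s) k)
            ((fderiv ℝ B (c s) (B (Γ v (Set.projIcc 0 1 zero_le_one s)) v)) k) s := by
          simpa using h1.clm_apply (hasDerivAt_const s k)
        exact (hasDerivAt_id s).smul h2
      have hB' : Continuous (fderiv ℝ B) := hB.continuous_fderiv (by simp)
      have h3 := intervalIntegral.integral_eq_sub_of_hasDerivAt (a := 0) (b := (t : ℝ))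
        (fun s _ => hg s) (Continuous.intervalIntegrable (by fun_prop) _ _)
      rw [zero_smul, sub_zero] at h3
      have h4 : η t = (t : ℝ) • B (c t) k := by
        rw [← hcΓ t t.2, Set.projIcc_of_mem _ t.2]
        rfl
      rw [h4, ← h3]
      refine intervalIntegral.integral_congr fun s hs => ?_
      rw [Set.uIcc_of_le t.2.1] at hs
      have hs' : s ∈ Set.Icc (0 : ℝ) 1 := ⟨hs.1, hs.2.trans t.2.2⟩
      have h5 := hmem v hv (Set.projIcc 0 1 zero_le_one s)
      have h6 : η (Set.projIcc 0 1 zero_le_one s) =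
          s • B (Γ v (Set.projIcc 0 1 zero_le_one s)) k := by
        rw [Set.projIcc_of_mem _ hs']
        rfl
      simp only [h6, ← hcΓ s hs', one_smul, map_smul, smul_apply]
      rw [hBsymm _ h5])
    rw [hη]
    simp [η]
  let Ψf : E → E := fun v => z₀ + Γ v 1
  have hΨs : ContDiffOn ℝ ∞ Ψf U' := by
    refine contDiffOn_const.add ?_
    exact (ContinuousMap.evalCLM ℝ (1 : I)).contDiff.comp_contDiffOn (hΓ.mono fun v (hv : v ∈ U') => hv.1)
  have hΨd : ∀ v ∈ U', HasFDerivAt Ψf (ContinuousMap.evalCLM ℝ (1 : I) ∘L fderiv ℝ Γ v) v := by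
    intro v hv
    refine HasFDerivAt.const_add _ ?_
    exact (ContinuousMap.evalCLM ℝ (1 : I)).hasFDerivAt.comp v
      ((hΓ.contDiffAt (hU.mem_nhds hv.1)).differentiableAt (by simp)).hasFDerivAt
  have hΨ0 : HasFDerivAt Ψf (ContinuousLinearEquiv.refl ℝ E : E →L[ℝ] E) 0 := by
    convert! hΨd 0 h0U' using 1
    ext k
    let η : C(I, E) := ⟨fun t => Q k + (t : ℝ) • B 0 k, by fun_prop⟩
    have hη := huniq 0 h0U k η (by
      intro t
      simp [hΓ0, η])
    simp only [ContinuousLinearMap.comp_apply, hη, ContinuousMap.evalCLM_apply]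
    have hB0 : B 0 = P z₀ := by
      rw [hBB 0 (Metric.mem_ball_self hε)]
      simp [B₀, projLift, intertwiner_self h₀]
    simp [η, hB0, Q]
  obtain ⟨Ψ, h0, hsub, hΨ, hΨsymm, -⟩ := hΨs.exists_openPartialHomeomorph hU' h0U' _ hΨ0
  have hΨ' : ⇑Ψ = Ψf := funext hΨ
  have htar : ∀ v ∈ U', Ψf v ∈ Ω' := fun v hv => hball (hmem v hv 1)
  refine ⟨Ψ, h0, ?_, ?_, ?_, hΨsymm, ?_⟩
  · rw [hΨ]
    simp [Ψf, hΓ0]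
  · intro y hy
    rw [← Ψ.right_inv hy, hΨ]
    exact (htar _ (hsub (Ψ.map_target hy))).1
  · rw [hΨ']
    exact hΨs.mono hsub
  · intro v hv w
    have hv' := hsub hv
    have hy := htar v hv'
    have hk : ∀ k, P z₀ k = k → fderiv ℝ Ψ v k = B₀ (Ψ v) k := by
      intro k hk
      rw [hΨ', (hΨd v hv').fderiv]
      simp only [ContinuousLinearMap.comp_apply, ContinuousMap.evalCLM_apply]
      rw [hder v hv' k hk, hBB _ (hmem v hv' 1)]
    rw [hΨ] at hk ⊢
    constructor
    · intro hw
      refine ⟨P z₀ w, h₀ w, ?_⟩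
      rw [hk _ (h₀ w)]
      exact projLift_base h₀ (h _ hy.1) hy.2 hw
    · rintro ⟨k, hk0, rfl⟩
      rw [hk k hk0]
      exact apply_projLift h₀ (h _ hy.1) hy.2 k

end Frobenius

namespace FTwistor

/-! ### Complexified `f`-structures and orthogonality of their eigenspaces. -/

section ComplexLinearAlgebra

/-- The polynomial f(f + i) has the simple roots 0 and -i, and the explicit splitting of a vector in
its kernel is z = (z - i f z) + i f z. A single equation is easier to differentiate, transport and
descend than a direct sum. -/
theorem mem_eigenspace_zero_sup_iff {W : Type*} [AddCommGroup W] [Module ℂ W]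
    (f : Module.End ℂ W) (z : W) :
    z ∈ Module.End.eigenspace f 0 ⊔ Module.End.eigenspace f (-Complex.I) ↔
      f (f z + Complex.I • z) = 0 := by
  constructor
  · intro hz
    obtain ⟨a, ha, b, hb, rfl⟩ := Submodule.mem_sup.1 hz
    rw [Module.End.mem_eigenspace_iff] at ha hb
    have h : f (a + b) + Complex.I • (a + b) = Complex.I • a := by
      rw [map_add, ha, hb, zero_smul, neg_smul, smul_add]
      abel
    rw [h, map_smul, ha, zero_smul, smul_zero]
  · intro h
    rw [map_add, map_smul] at h
    have h' : f (f z) = -(Complex.I • f z) := eq_neg_of_add_eq_zero_left h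
    have hI : ∀ w : W, Complex.I • Complex.I • w = -w := by
      intro w
      rw [smul_smul, Complex.I_mul_I, neg_smul, one_smul]
    refine Submodule.mem_sup.2 ⟨z - Complex.I • f z, ?_, Complex.I • f z, ?_, by abel⟩
    · rw [Module.End.mem_eigenspace_iff, map_sub, map_smul, h', smul_neg, hI]
      simp
    · rw [Module.End.mem_eigenspace_iff, map_smul, h', smul_neg, hI, neg_smul, hI]

variable {V : Type*} [AddCommGroup V] [Module ℝ V]

theorem cvec_add (u v u' v' : V) : cvec u v + cvec u' v' = cvec (u + u') (v + v') := by
  simp only [cvec, TensorProduct.tmul_add]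
  abel

theorem cvec_neg (u v : V) : -cvec u v = cvec (-u) (-v) := by
  simp only [cvec, TensorProduct.tmul_neg]
  abel

theorem cvec_sub (u v u' v' : V) : cvec u v - cvec u' v' = cvec (u - u') (v - v') := by
  rw [sub_eq_add_neg, cvec_neg, cvec_add, sub_eq_add_neg, sub_eq_add_neg]

theorem cvec_zero : cvec (0 : V) 0 = 0 := by simp [cvec]

theorem cvec_eq_zero_iff {u v : V} : cvec u v = 0 ↔ u = 0 ∧ v = 0 := by
  rw [← cvec_zero, cvec_inj]

theorem baseChange_cvec' {V' : Type*} [AddCommGroup V'] [Module ℝ V'] (F : V →ₗ[ℝ] V')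
    (u v : V) : F.baseChange ℂ (cvec u v) = cvec (F u) (F v) := by
  simp [cvec]

theorem baseChange_injective {V' : Type*} [AddCommGroup V'] [Module ℝ V'] {F : V →ₗ[ℝ] V'}
    (hF : Function.Injective F) : Function.Injective (F.baseChange ℂ) := by
  rw [← LinearMap.ker_eq_bot, LinearMap.ker_eq_bot']
  intro z
  rw [← cvec_eta z, baseChange_cvec', cvec_eq_zero_iff, cvec_eq_zero_iff]
  exact fun h => ⟨hF (h.1.trans (map_zero F).symm), hF (h.2.trans (map_zero F).symm)⟩

theorem mem_fDistribution_cvec (F : V →ₗ[ℝ] V) (u v : V) :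
    cvec u v ∈ Module.End.eigenspace (F.baseChange ℂ) 0 ⊔
        Module.End.eigenspace (F.baseChange ℂ) (-Complex.I) ↔
      F (F u) = F v ∧ F (F v) = -F u := by
  rw [mem_eigenspace_zero_sup_iff, baseChange_cvec', I_smul_cvec, cvec_add, baseChange_cvec',
    cvec_eq_zero_iff, map_add, map_add, map_neg, ← sub_eq_add_neg, sub_eq_zero,
    add_eq_zero_iff_eq_neg]

theorem eigen_zero_cvec (F : V →ₗ[ℝ] V) (u v : V) :
    cvec u v ∈ Module.End.eigenspace (F.baseChange ℂ) 0 ↔ F u = 0 ∧ F v = 0 := by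
  rw [Module.End.mem_eigenspace_iff, baseChange_cvec', zero_smul, cvec_eq_zero_iff]

theorem eigen_I_cvec (F : V →ₗ[ℝ] V) (u v : V) :
    cvec u v ∈ Module.End.eigenspace (F.baseChange ℂ) Complex.I ↔ F u = -v ∧ F v = u := by
  rw [Module.End.mem_eigenspace_iff, baseChange_cvec', I_smul_cvec, cvec_inj]

theorem mem_baseChange_cvec {S : Submodule ℝ V} {u v : V} (hu : u ∈ S) (hv : v ∈ S) :
    cvec u v ∈ S.baseChange ℂ :=
  Submodule.add_mem _ (Submodule.tmul_mem_baseChange_of_mem _ hu)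
    (Submodule.tmul_mem_baseChange_of_mem _ hv)

section Form

variable {g : LinearMap.BilinForm ℝ V} (hs : ∀ u v, g u v = g v u)
  (hp : ∀ u, u ≠ 0 → 0 < g u u) {F : V →ₗ[ℝ] V} (hF : ∀ u v, g (F u) v = -g u (F v))

include hs in
theorem form_symm (z w : ℂ ⊗[ℝ] V) : g.baseChange ℂ z w = g.baseChange ℂ w z := by
  rw [← cvec_eta z, ← cvec_eta w, form_cvec, form_cvec, hs (cre z), hs (cim z), hs (cre z),
    hs (cim z), add_comm (g (cim w) _)]

include hF in
theorem form_skew (z w : ℂ ⊗[ℝ] V) :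
    g.baseChange ℂ (F.baseChange ℂ z) w = -g.baseChange ℂ z (F.baseChange ℂ w) := by
  rw [← cvec_eta z, ← cvec_eta w, baseChange_cvec', baseChange_cvec', form_cvec, form_cvec,
    hF, hF, hF, hF]
  push_cast
  ring

-- Pairing z with its conjugate gives the sum of the squared lengths of its real and imaginary
-- parts.
include hp in
theorem form_nondegenerate {z : ℂ ⊗[ℝ] V} (h : ∀ w, g.baseChange ℂ z w = 0) : z = 0 := by
  have h1 := h (cvec (cre z) (-cim z))
  rw [← cvec_eta z, form_cvec, cre_cvec, cim_cvec] at h1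
  have h2 := congrArg Complex.re h1
  simp at h2
  have nn : ∀ u, 0 ≤ g u u := by
    intro u
    by_cases hu : u = 0
    · simp [hu]
    · exact (hp u hu).le
  have hz : ∀ u, g u u = 0 → u = 0 := fun u hu => by
    by_contra hne
    exact (hp u hne).ne' hu
  have h3 := nn (cre z)
  have h4 := nn (cim z)
  rw [← cvec_eta z, hz (cre z) (by linarith), hz (cim z) (by linarith), cvec_zero]

-- For a skew endomorphism, eigenspaces are orthogonal unless their eigenvalues add up to zero; -i
-- is paired only with i. The next lemma gives the converse for p: what is orthogonal to T⁰ ⊕ p lies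
-- in p.
include hs hF in
theorem form_eigen_fDistribution {z w : ℂ ⊗[ℝ] V}
    (hz : z ∈ Module.End.eigenspace (F.baseChange ℂ) (-Complex.I))
    (hw : w ∈ Module.End.eigenspace (F.baseChange ℂ) 0 ⊔
        Module.End.eigenspace (F.baseChange ℂ) (-Complex.I)) :
    g.baseChange ℂ z w = 0 := by
  rw [Module.End.mem_eigenspace_iff] at hz
  rw [mem_eigenspace_zero_sup_iff] at hw
  have h1 := form_skew hF z (F.baseChange ℂ w + Complex.I • w)
  have h2 := form_skew hF z w
  rw [hw, hz, map_zero, neg_zero] at h1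
  rw [hz] at h2
  simp only [map_smul, map_add, LinearMap.smul_apply, smul_eq_mul] at h1 h2
  have h3 : g.baseChange ℂ z (F.baseChange ℂ w) = Complex.I * g.baseChange ℂ z w := by
    linear_combination h2
  rw [h3] at h1
  have h4 : (-Complex.I * 2 * Complex.I) * g.baseChange ℂ z w = 0 := by
    linear_combination h1
  have h5 : -Complex.I * 2 * Complex.I = 2 := by
    linear_combination -2 * Complex.I_mul_I
  rw [h5] at h4
  simpa using h4

-- The adjoint of F + i is -F + i, and F³ = -F shows that its values are annihilated by F(F + i),
-- hence lie in T⁰ ⊕ p. Orthogonality to them forces (F + i)z = 0.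
include hp hF in
theorem mem_eigen_of_form_eq_zero (h3 : ∀ u, F (F (F u)) = -F u) {z : ℂ ⊗[ℝ] V}
    (hz : ∀ w ∈ Module.End.eigenspace (F.baseChange ℂ) 0 ⊔
        Module.End.eigenspace (F.baseChange ℂ) (-Complex.I), g.baseChange ℂ z w = 0) :
    z ∈ Module.End.eigenspace (F.baseChange ℂ) (-Complex.I) := by
  rw [Module.End.mem_eigenspace_iff, ← sub_eq_zero]
  refine form_nondegenerate hp fun w => ?_
  have hw : -F.baseChange ℂ w + Complex.I • w ∈ Module.End.eigenspace (F.baseChange ℂ) 0 ⊔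
      Module.End.eigenspace (F.baseChange ℂ) (-Complex.I) := by
    rw [← cvec_eta w, baseChange_cvec', I_smul_cvec, cvec_neg, cvec_add, mem_fDistribution_cvec]
    simp only [map_add, map_neg, h3]
    constructor <;> abel
  have h := hz _ hw
  rw [map_sub, LinearMap.sub_apply, form_skew hF]
  simp only [map_smul, map_add, map_neg, LinearMap.smul_apply, smul_eq_mul] at h ⊢
  linear_combination h

end Form

end ComplexLinearAlgebra

/-! ### Infinitesimal conjugation of skew `f`-structures. -/

section OrthogonalConjugation

variable {E : Type*} [NormedAddCommGroup E] [NormedSpace ℝ E]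

/-- The tangent vectors to the space of skew `f`-structures are of the form `[B, F]`, with
`B` skew. -/
theorem exists_skew_commutator {g : E → E → ℝ} (hneg : ∀ x y, g (-x) y = -g x y)
    (hl : ∀ x x' y, g (x + x') y = g x y + g x' y) (hr : ∀ x y y', g x (y + y') = g x y + g x y')
    (hls : ∀ (a : ℝ) x y, g (a • x) y = a * g x y) (hrs : ∀ (a : ℝ) x y, g x (a • y) = a * g x y)
    {F A : E →L[ℝ] E} (hF : ∀ x y, g (F x) y = -g x (F y)) (hA : ∀ x y, g (A x) y = -g x (A y))
    (hF3 : F * F * F = -F) (hFA : A * F * F + F * A * F + F * F * A + A = 0) :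
    ∃ B : E →L[ℝ] E, (∀ x y, g (B x) y = -g x (B y)) ∧ B * F - F * B = A := by
  have hA' : A = -(A * F * F + F * A * F + F * F * A) := (neg_eq_of_add_eq_zero_right hFA).symm
  have k1 : F * A * F * F = -(F * F * A * F) := by
    have h1 : F * (A * F * F + F * A * F + F * F * A + A) = 0 := by rw [hFA, mul_zero]
    have h2 : F * F * F * A = -F * A := by rw [hF3]
    have h3 : F * (A * F * F + F * A * F + F * F * A + A) =
      F * A * F * F + F * F * A * F + F * F * F * A + F * A := by noncomm_ring
    rw [h3, h2, neg_mul, neg_add_cancel_right] at h1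
    exact eq_neg_of_add_eq_zero_left h1
  have k3 : F * F * F * A * F = -(F * A * F) := by rw [hF3]; noncomm_ring
  have k2 : F * F * A * F * F = F * A * F := by
    have h1 : F * F * A * F * F = F * (F * A * F * F) := by noncomm_ring
    rw [h1, k1]
    have h2 : F * -(F * F * A * F) = -(F * F * F * A * F) := by noncomm_ring
    rw [h2, k3, neg_neg]
  -- Split A into blocks from the μ- to the λ-eigenspace of F. The linearised cubic equation leaves
  -- only the blocks with λ = -μ ≠ 0 and those with exactly one of λ, μ zero. The commutator of FA -
  -- AF with F multiplies a block by -(λ - μ)², that is, by 1 if one eigenvalue is zero and by 4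
  -- otherwise. The cubic term acts only on the latter blocks, where the coefficient 3/2 lowers the
  -- factor 4 to 1.
  refine ⟨F * A - A * F - (3 / 2 : ℝ) • (F * F * A * F), ?_, ?_⟩
  · have k1' : ∀ x, F (A (F (F x))) = -F (F (A (F x))) := fun x => DFunLike.congr_fun k1 x
    have hsl : ∀ x x' y, g (x - x') y = g x y - g x' y := fun x x' y => by
      rw [sub_eq_add_neg, hl, hneg, sub_eq_add_neg]
    have hnegr : ∀ x y, g x (-y) = -g x y := fun x y => by
      rw [← neg_one_smul ℝ y, hrs, neg_one_mul]
    have hsr : ∀ x y y', g x (y - y') = g x y - g x y' := fun x y y' => by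
      rw [sub_eq_add_neg, hr, hnegr, sub_eq_add_neg]
    intro x y
    change g (F (A x) - A (F x) - (3 / 2 : ℝ) • F (F (A (F x)))) y =
      -g x (F (A y) - A (F y) - (3 / 2 : ℝ) • F (F (A (F y))))
    rw [hsl, hsl, hsr, hsr, hls, hrs]
    rw [hF (A x), hA x, hA (F x), hF x, hF, hF, hA, hF, k1', hnegr]
    ring
  · have h1 : (F * A - A * F - (3 / 2 : ℝ) • (F * F * A * F)) * F -
        F * (F * A - A * F - (3 / 2 : ℝ) • (F * F * A * F)) =
        F * A * F + F * A * F - A * F * F - F * F * A -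
          (3 / 2 : ℝ) • (F * F * A * F * F) + (3 / 2 : ℝ) • (F * F * F * A * F) := by
      simp only [sub_mul, mul_sub, smul_mul_assoc, mul_smul_comm, mul_assoc]
      abel
    rw [h1, k2, k3]
    conv_rhs => rw [hA']
    module

/-- Every element of the image of `ad F`, on skew endomorphisms, is the velocity of a curve of
conjugates of `F` by isometries. -/
theorem exists_isometry_curve [CompleteSpace E] (g : E →L[ℝ] E →L[ℝ] ℝ) {F B : E →L[ℝ] E}
    (hB : ∀ x y, g (B x) y = -g x (B y)) :
    ∃ u w : ℝ → E →L[ℝ] E, (∀ t, u t * w t = 1) ∧ (∀ t, w t * u t = 1) ∧ u 0 = 1 ∧ w 0 = 1 ∧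
      (∀ t x y, g (u t x) (u t y) = g x y) ∧
      HasDerivAt (fun t => u t * F * w t) (B * F - F * B) 0 := by
  have hinv : ∀ C : E →L[ℝ] E, NormedSpace.exp C * NormedSpace.exp (-C) = 1 := by
    intro C
    let _ : NormedAlgebra ℚ (E →L[ℝ] E) := NormedAlgebra.restrictScalars ℚ ℝ _
    rw [← NormedSpace.exp_add_of_commute (Commute.neg_right (Commute.refl C)), add_neg_cancel,
      NormedSpace.exp_zero]
  refine ⟨fun t => NormedSpace.exp (t • B), fun t => NormedSpace.exp (t • (-B)), fun t => ?_,
    fun t => ?_, by simp, by simp, fun t x y => ?_, ?_⟩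
  · simpa using hinv (t • B)
  · simpa using hinv (t • (-B))
  · have hd : ∀ x s, HasDerivAt (fun t : ℝ => NormedSpace.exp (t • B) x)
        (B (NormedSpace.exp (s • B) x)) s := by
      intro x s
      have h := (hasDerivAt_exp_smul_const' (𝕂 := ℝ) B s).clm_apply (hasDerivAt_const s x)
      simpa using h
    have h0 : ∀ s, HasDerivAt (fun t : ℝ => g (NormedSpace.exp (t • B) x)
        (NormedSpace.exp (t • B) y)) 0 s := by
      intro s
      have h := (g.hasFDerivAt.comp_hasDerivAt s (hd x s)).clm_apply (hd y s)
      convert! h using 1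
      rw [hB]
      exact (neg_add_cancel _).symm
    have h1 := is_const_of_deriv_eq_zero (fun s => (h0 s).differentiableAt)
      (fun s => (h0 s).deriv) t 0
    simpa using h1
  · have h1 := hasDerivAt_exp_smul_const (𝕂 := ℝ) B 0
    have h2 := hasDerivAt_exp_smul_const (𝕂 := ℝ) (-B) 0
    have h := (h1.mul_const F).mul h2
    convert! h using 1
    simp [sub_eq_add_neg]

end OrthogonalConjugation

/-! ### Covariant derivatives of endomorphism fields. -/

section Sections

variable {E : Type*} [NormedAddCommGroup E] [NormedSpace ℝ E] [FiniteDimensional ℝ E]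
  {H : Type*} [TopologicalSpace H] {I : ModelWithCorners ℝ E H}
  {M : Type*} [TopologicalSpace M] [ChartedSpace H M] [IsManifold I ∞ M]

/-- Near a point, a differentiable section is a combination of smooth sections. -/
theorem exists_frame_expansion {G : Type*} [NormedAddCommGroup G] [NormedSpace ℝ G]
    [FiniteDimensional ℝ G] {V : M → Type*} [TopologicalSpace (TotalSpace G V)]
    [∀ x, AddCommGroup (V x)] [∀ x, Module ℝ (V x)] [∀ x, TopologicalSpace (V x)]
    [FiberBundle G V] [VectorBundle ℝ G V] [ContMDiffVectorBundle ∞ G V I]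
    [ContMDiffVectorBundle 1 G V I]
    {σ : ∀ y, V y} {x : M}
    (hσ : MDifferentiableAt I (I.prod 𝓘(ℝ, G)) (fun y => (⟨y, σ y⟩ : TotalSpace G V)) x)
    (h0 : σ x = 0) :
    ∃ (n : ℕ) (f : Fin n → M → ℝ) (S : Fin n → ∀ y, V y),
      (∀ i, MDifferentiableAt I 𝓘(ℝ, ℝ) (f i) x) ∧ (∀ i, f i x = 0) ∧
      (∀ i, ContMDiffAt I (I.prod 𝓘(ℝ, G)) ∞ (fun y => (⟨y, S i y⟩ : TotalSpace G V)) x) ∧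
      ∀ᶠ y in nhds x, σ y = ∑ i, f i y • S i y := by
  let e := trivializationAt G V x
  let b := Module.finBasis ℝ G
  have hx : x ∈ e.baseSet := FiberBundle.mem_baseSet_trivializationAt' x
  refine ⟨_, fun i y => e.localFrameCoeff I b i y (σ y), e.localFrame b, fun i => ?_, fun i => ?_,
    fun i => ?_, ?_⟩
  · exact mdifferentiableAt_localFrameCoeff b hx hσ i
  · simp only [h0, map_zero]
  · exact contMDiffAt_localFrame_of_mem ∞ e b i hx
  · exact e.eventually_eq_localFrame_sum_coeff_smul b hx

variable (D : CovariantDerivative I E (TangentSpace I : M → Type _))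

/-- A vector field, differentiable at `x`. -/
abbrev DiffField (Y : ∀ y : M, TangentSpace I y) (x : M) : Prop :=
  MDifferentiableAt I I.tangent (fun y => (⟨y, Y y⟩ : TangentBundle I M)) x

/-- A section of the endomorphism bundle, differentiable at `x`. -/
abbrev DiffEnd (s : ∀ y : M, EndFibre I y) (x : M) : Prop :=
  MDifferentiableAt I (endModel I) (fun y => (⟨y, s y⟩ : EndBundle I M)) x

theorem DiffEnd.apply {s : ∀ y : M, EndFibre I y} {x : M} (hs : DiffEnd s x)
    {Y : ∀ y : M, TangentSpace I y} (hY : DiffField Y x) : DiffField (fun y => s y (Y y)) x :=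
  MDifferentiableAt.clm_bundle_apply hs hY

theorem smoothEnd_apply {s : ∀ y : M, EndFibre I y} {U : Set M}
    (hs : ContMDiffOn I (endModel I) ∞ (fun y => (⟨y, s y⟩ : EndBundle I M)) U)
    {Y : ∀ y : M, TangentSpace I y} (hY : SmoothFieldOn Y U) :
    SmoothFieldOn (fun y => s y (Y y)) U :=
  ContMDiffOn.clm_bundle_apply hs hY

theorem cov_congr {Y Z : ∀ y : M, TangentSpace I y} {x : M} (hY : DiffField Y x)
    (h : ∀ᶠ y in nhds x, Y y = Z y) : D Y x = D Z x := by
  have hZ : DiffField Z x := hY.congr_of_eventuallyEq (by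
    filter_upwards [h] with y hy
    rw [hy])
  exact D.isCovariantDerivativeOnUniv.congr_of_eventuallyEq hY hZ Filter.univ_mem h

theorem tensorialAt_nablaEnd {s : ∀ y : M, EndFibre I y} {x : M} (hs : DiffEnd s x)
    (v : TangentSpace I x) :
    TensorialAt I E (fun Y : ∀ y : M, TangentSpace I y =>
      D (fun y => s y (Y y)) x v - s x (D Y x v)) x where
  smul {f Y} hf hY := by
    have h1 : (fun y => s y ((f • Y) y)) = f • fun y => s y (Y y) := by
      ext y; simp
    have h2 := D.isCovariantDerivativeOn.leibniz (hs.apply hY) hf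
    have h3 := D.isCovariantDerivativeOn.leibniz hY hf
    simp only [h1, h2, h3]
    simp
    module
  add {Y Z} hY hZ := by
    have h1 : (fun y => s y ((Y + Z) y)) = (fun y => s y (Y y)) + fun y => s y (Z y) := by
      ext y; simp
    have h2 := D.isCovariantDerivativeOn.add (hs.apply hY) (hs.apply hZ)
    have h3 := D.isCovariantDerivativeOn.add hY hZ
    simp only [h1, h2, h3]
    simp
    abel

/-- The covariant derivative `D_v s` of a section of the endomorphism bundle. -/
noncomputable def nablaEnd {s : ∀ y : M, EndFibre I y} {x : M} (hs : DiffEnd s x) (v : TangentSpace I x) :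
    EndFibre I x :=
  TensorialAt.mkHom _ x (tensorialAt_nablaEnd D hs v)

theorem nablaEnd_apply {s : ∀ y : M, EndFibre I y} {x : M} (hs : DiffEnd s x)
    (v : TangentSpace I x) {Y : ∀ y : M, TangentSpace I y} (hY : DiffField Y x) :
    nablaEnd D hs v (Y x) = D (fun y => s y (Y y)) x v - s x (D Y x v) :=
  TensorialAt.mkHom_apply (tensorialAt_nablaEnd D hs v) hY

/-- Every tangent vector extends to a field smooth at the point, so by tensoriality smooth test
fields suffice. These are the test fields in `IsParallelAt`. -/
theorem nablaEnd_ext {s : ∀ y : M, EndFibre I y} {x : M} (hs : DiffEnd s x)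
    (v : TangentSpace I x) (A : EndFibre I x)
    (h : ∀ Y : ∀ y : M, TangentSpace I y,
      ContMDiffAt I I.tangent ∞ (fun y => (⟨y, Y y⟩ : TangentBundle I M)) x →
      D (fun y => s y (Y y)) x v - s x (D Y x v) = A (Y x)) : nablaEnd D hs v = A := by
  ext w
  have h1 : ContMDiffAt I I.tangent ∞
      (fun y => (⟨y, FiberBundle.extend E w y⟩ : TangentBundle I M)) x :=
    FiberBundle.contMDiffAt_extend I E w
  have h2 := h _ h1
  rw [← nablaEnd_apply D hs v (h1.mdifferentiableAt (by simp))] at h2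
  simpa using h2

/-- When the coefficients vanish at x, the Leibniz rule leaves only their differentials and the
connection disappears. This is what allows covariant derivatives to be compared with derivatives of
components in a trivialization. -/
theorem cov_of_eq_sum {n : ℕ} {f : Fin n → M → ℝ} {S : Fin n → ∀ y : M, TangentSpace I y} {x : M}
    (hf : ∀ i, MDifferentiableAt I 𝓘(ℝ, ℝ) (f i) x) (h0 : ∀ i, f i x = 0)
    (hS : ∀ i, DiffField (S i) x) {Y : ∀ y : M, TangentSpace I y} (hY : DiffField Y x)
    (h : ∀ᶠ y in nhds x, Y y = ∑ i, f i y • S i y) (v : TangentSpace I x) :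
    D Y x v = ∑ i, mvfderiv I (f i) x v • S i x := by
  have key : ∀ t : Finset (Fin n), D (∑ i ∈ t, f i • S i) x v =
      ∑ i ∈ t, mvfderiv I (f i) x v • S i x ∧ DiffField (∑ i ∈ t, f i • S i) x := by
    classical
    intro t
    induction t using Finset.induction_on with
    | empty =>
      simp only [Finset.sum_empty]
      refine ⟨?_, mdifferentiableAt_zeroSection ..⟩
      rw [D.isCovariantDerivativeOn.zero]
      rfl
    | insert a t ha ih =>
      have h1 : DiffField (f a • S a) x := (hf a).smul_section (hS a)
      rw [Finset.sum_insert ha, Finset.sum_insert ha]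
      refine ⟨?_, mdifferentiableAt_add_section h1 ih.2⟩
      rw [D.isCovariantDerivativeOn.add h1 ih.2, D.isCovariantDerivativeOn.leibniz (hS a) (hf a),
        h0, add_apply, ih.1]
      simp
  rw [cov_congr D hY (Z := ∑ i, f i • S i) (by
    filter_upwards [h] with y hy
    rw [hy, Finset.sum_apply]
    rfl)]
  exact (key Finset.univ).1

end Sections

/-! ### Tangent vectors of the endomorphism bundle. -/

section TotalSpace

variable {E : Type*} [NormedAddCommGroup E] [NormedSpace ℝ E] [FiniteDimensional ℝ E]
  {H : Type*} [TopologicalSpace H] {I : ModelWithCorners ℝ E H}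
  {M : Type*} [TopologicalSpace M] [ChartedSpace H M] [IsManifold I ∞ M]

variable (I M) in
/-- The fibre component in the preferred trivialization of `End(TM)` at `x`. -/
noncomputable def endCoord (x : M) (p : EndBundle I M) : E →L[ℝ] E :=
  (trivializationAt (E →L[ℝ] E) (fun x : M => EndFibre I x) x p).2

theorem mem_endBaseSet (x : M) :
    x ∈ (trivializationAt (E →L[ℝ] E) (fun x : M => EndFibre I x) x).baseSet :=
  FiberBundle.mem_baseSet_trivializationAt' x

theorem mdifferentiableAt_trivialization {x : M} (F : EndFibre I x) :
    MDifferentiableAt (endModel I) (endModel I)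
      (trivializationAt (E →L[ℝ] E) (fun x : M => EndFibre I x) x)
      (⟨x, F⟩ : EndBundle I M) := by
  have h := (trivializationAt (E →L[ℝ] E) (fun x : M => EndFibre I x) x).contMDiffOn
    (IB := I) (n := 1)
  refine (h.contMDiffAt ?_).mdifferentiableAt (by simp)
  refine (trivializationAt (E →L[ℝ] E) (fun x : M => EndFibre I x) x).open_source.mem_nhds ?_
  rw [Trivialization.mem_source]
  exact mem_endBaseSet x

theorem mdifferentiableAt_endCoord {x : M} (F : EndFibre I x) :
    MDifferentiableAt (endModel I) 𝓘(ℝ, E →L[ℝ] E) (endCoord I M x) (⟨x, F⟩ : EndBundle I M) :=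
  mdifferentiableAt_snd.comp _ (mdifferentiableAt_trivialization F)

/-- The differential of the fibre component in the preferred trivialization. -/
noncomputable def dEndCoord {x : M} (F : EndFibre I x) :
    TangentSpace (endModel I) (⟨x, F⟩ : EndBundle I M) →L[ℝ] (E →L[ℝ] E) :=
  mfderiv (endModel I) 𝓘(ℝ, E →L[ℝ] E) (endCoord I M x) (⟨x, F⟩ : EndBundle I M)

theorem mdifferentiableAt_proj (p : EndBundle I M) :
    MDifferentiableAt (endModel I) I (TotalSpace.proj : EndBundle I M → M) p :=
  (contMDiffAt_proj (n := 1) _).mdifferentiableAt (by simp)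

/-- A local trivialization is a diffeomorphism onto its image, and its differential consists of
these two components. -/
theorem tangent_endBundle_ext {x : M} {F : EndFibre I x}
    {ξ : TangentSpace (endModel I) (⟨x, F⟩ : EndBundle I M)}
    (h1 : dproj I M ⟨x, F⟩ ξ = 0) (h2 : dEndCoord F ξ = 0) : ξ = 0 := by
  let e := trivializationAt (E →L[ℝ] E) (fun x : M => EndFibre I x) x
  have hsrc : (⟨x, F⟩ : EndBundle I M) ∈ e.source := e.mem_source.2 (mem_endBaseSet x)
  have he := mdifferentiableAt_trivialization F
  have hes : MDifferentiableAt (endModel I) (endModel I) e.toOpenPartialHomeomorph.symm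
      (e ⟨x, F⟩) := by
    have h := e.contMDiffOn_symm (IB := I) (n := 1)
    exact (h.contMDiffAt (e.open_target.mem_nhds (e.map_source hsrc))).mdifferentiableAt (by simp)
  have h3 : mfderiv (endModel I) (endModel I) e ⟨x, F⟩ ξ = 0 := by
    have h4 : (e : EndBundle I M → M × (E →L[ℝ] E)) =ᶠ[nhds ⟨x, F⟩]
        fun p => (p.proj, endCoord I M x p) := by
      filter_upwards [e.open_source.mem_nhds hsrc] with p hp
      exact Prod.ext (e.coe_fst hp) rfl
    rw [h4.mfderiv_eq, mfderiv_prodMk (mdifferentiableAt_proj _) (mdifferentiableAt_endCoord F)]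
    exact Prod.ext h1 h2
  have h5 : mfderiv (endModel I) (endModel I) (e.toOpenPartialHomeomorph.symm ∘ e)
      ⟨x, F⟩ = ContinuousLinearMap.id ℝ _ := by
    have h6 : (e.toOpenPartialHomeomorph.symm ∘ e : EndBundle I M → EndBundle I M)
        =ᶠ[nhds ⟨x, F⟩] id := by
      filter_upwards [e.open_source.mem_nhds hsrc] with p hp
      exact e.left_inv hp
    rw [h6.mfderiv_eq, mfderiv_id]
  rw [mfderiv_comp _ hes he] at h5
  have h7 := DFunLike.congr_fun h5 ξ
  exact h7.symm.trans ((congrArg (mfderiv (endModel I) (endModel I) e.toOpenPartialHomeomorph.symm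
    (e ⟨x, F⟩)) h3).trans (ContinuousLinearMap.map_zero _))

theorem tangent_endBundle_ext' {x : M} {F : EndFibre I x}
    {ξ η : TangentSpace (endModel I) (⟨x, F⟩ : EndBundle I M)}
    (h1 : dproj I M ⟨x, F⟩ ξ = dproj I M ⟨x, F⟩ η) (h2 : dEndCoord F ξ = dEndCoord F η) : ξ = η := by
  rw [← sub_eq_zero]
  apply tangent_endBundle_ext
  · rw [ContinuousLinearMap.map_sub, h1]
    exact sub_self _
  · rw [ContinuousLinearMap.map_sub, h2]
    exact sub_self _

/-- The fibre component as a linear isomorphism on the fibre. -/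
noncomputable def endCoordEquiv (x : M) : EndFibre I x ≃L[ℝ] (E →L[ℝ] E) :=
  (trivializationAt (E →L[ℝ] E) (fun x : M => EndFibre I x) x).continuousLinearEquivAt ℝ x
    (mem_endBaseSet x)

theorem endCoord_section_mdifferentiableAt {s : ∀ y : M, EndFibre I y} {x : M} (hs : DiffEnd s x) :
    MDifferentiableAt I 𝓘(ℝ, E →L[ℝ] E) (fun y => endCoord I M x ⟨y, s y⟩) x :=
  MDifferentiableAt.comp (I' := endModel I) (g := endCoord I M x)
    (f := fun y => (⟨y, s y⟩ : EndBundle I M)) x (mdifferentiableAt_endCoord (s x)) hs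

/-- The differential of a section through a given point of `End(TM)`. -/
noncomputable def sectionDiff {s : ∀ y : M, EndFibre I y} {x : M} (_hs : DiffEnd s x)
    {F : EndFibre I x} (hF : s x = F) :
    TangentSpace I x →L[ℝ] TangentSpace (endModel I) (⟨x, F⟩ : EndBundle I M) :=
  hF ▸ mfderiv I (endModel I) (fun y => (⟨y, s y⟩ : EndBundle I M)) x

theorem dproj_sectionDiff {s : ∀ y : M, EndFibre I y} {x : M} (hs : DiffEnd s x) {F : EndFibre I x}
    (hF : s x = F) (v : TangentSpace I x) :
    dproj I M (⟨x, F⟩ : EndBundle I M) (sectionDiff hs hF v) = v := by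
  subst hF
  have h := mfderiv_comp x (mdifferentiableAt_proj (⟨x, s x⟩ : EndBundle I M)) hs
  have h2 : (TotalSpace.proj : EndBundle I M → M) ∘ (fun y => (⟨y, s y⟩ : EndBundle I M)) = id :=
    rfl
  rw [h2, mfderiv_id] at h
  exact (DFunLike.congr_fun h v).symm

theorem dEndCoord_sectionDiff {s : ∀ y : M, EndFibre I y} {x : M} (hs : DiffEnd s x)
    {F : EndFibre I x} (hF : s x = F) (v : TangentSpace I x) :
    dEndCoord F (sectionDiff hs hF v) = mvfderiv I (fun y => endCoord I M x ⟨y, s y⟩) x v := by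
  subst hF
  have h := mfderiv_comp x (mdifferentiableAt_endCoord (s x)) hs
  exact (DFunLike.congr_fun h v).symm

theorem mdifferentiableAt_line {x : M} (F A : EndFibre I x) :
    MDifferentiableAt 𝓘(ℝ, ℝ) (endModel I) (fun t : ℝ => (⟨x, F + t • A⟩ : EndBundle I M)) 0 := by
  let e := trivializationAt (E →L[ℝ] E) (fun x : M => EndFibre I x) x
  have h : ContMDiffAt 𝓘(ℝ, ℝ) (endModel I) 1 (fun t : ℝ => (⟨x, F + t • A⟩ : EndBundle I M)) 0 := by
    rw [e.contMDiffAt_iff (e.mem_source.2 (mem_endBaseSet x))]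
    refine ⟨contMDiffAt_const, ?_⟩
    have h1 : (fun t : ℝ => (e (⟨x, F + t • A⟩ : EndBundle I M)).2) =
        fun t : ℝ => endCoordEquiv x F + t • endCoordEquiv x A := by
      ext1 t
      rw [← map_smul, ← map_add]
      rfl
    rw [h1, contMDiffAt_iff_contDiffAt]
    fun_prop
  exact h.mdifferentiableAt (by simp)

theorem dproj_verticalLift {x : M} (F A : EndFibre I x) :
    dproj I M (⟨x, F⟩ : EndBundle I M) (verticalLift F A) = 0 := by
  have hF : (⟨x, F + (0 : ℝ) • A⟩ : EndBundle I M) = ⟨x, F⟩ := by simp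
  have h := mfderiv_comp (0 : ℝ) (mdifferentiableAt_proj (⟨x, F + (0 : ℝ) • A⟩ : EndBundle I M))
    (mdifferentiableAt_line F A)
  have h2 : (TotalSpace.proj : EndBundle I M → M) ∘
      (fun t : ℝ => (⟨x, F + t • A⟩ : EndBundle I M)) = fun _ => x := rfl
  rw [h2, mfderiv_const, hF] at h
  exact (DFunLike.congr_fun h (1 : ℝ)).symm

theorem dEndCoord_verticalLift {x : M} (F A : EndFibre I x) :
    dEndCoord F (verticalLift F A) = endCoordEquiv x A := by
  have hF : (⟨x, F + (0 : ℝ) • A⟩ : EndBundle I M) = ⟨x, F⟩ := by simp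
  have h := mfderiv_comp (0 : ℝ) (mdifferentiableAt_endCoord (F + (0 : ℝ) • A))
    (mdifferentiableAt_line F A)
  have h2 : endCoord I M x ∘ (fun t : ℝ => (⟨x, F + t • A⟩ : EndBundle I M)) =
      fun t => endCoordEquiv x F + t • endCoordEquiv x A := by
    ext1 t
    rw [← map_smul, ← map_add]
    rfl
  have h3 : HasDerivAt (fun t : ℝ => endCoordEquiv x F + t • endCoordEquiv x A)
      (endCoordEquiv x A) 0 := by
    simpa using ((hasDerivAt_id (0 : ℝ)).smul_const (endCoordEquiv x A)).const_add
      (endCoordEquiv x F)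
  rw [h2, mfderiv_eq_fderiv, h3.hasFDerivAt.fderiv, hF] at h
  have h4 := DFunLike.congr_fun h (1 : ℝ)
  exact h4.symm.trans (one_smul ℝ (endCoordEquiv x A))

/-- The vertical lift as a linear map. -/
noncomputable def verticalLiftₗ {x : M} (F : EndFibre I x) :
    EndFibre I x →ₗ[ℝ] TangentSpace (endModel I) (⟨x, F⟩ : EndBundle I M) where
  toFun A := verticalLift F A
  map_add' A B := by
    apply tangent_endBundle_ext'
    · rw [ContinuousLinearMap.map_add, dproj_verticalLift, dproj_verticalLift, dproj_verticalLift]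
      exact (add_zero _).symm
    · rw [ContinuousLinearMap.map_add, dEndCoord_verticalLift, dEndCoord_verticalLift,
        dEndCoord_verticalLift]
      exact ContinuousLinearEquiv.map_add _ _ _
  map_smul' c A := by
    apply tangent_endBundle_ext'
    · rw [ContinuousLinearMap.map_smul, dproj_verticalLift, RingHom.id_apply, dproj_verticalLift]
      exact (smul_zero _).symm
    · rw [ContinuousLinearMap.map_smul, dEndCoord_verticalLift, RingHom.id_apply,
        dEndCoord_verticalLift]
      exact ContinuousLinearEquiv.map_smul _ _ _

theorem verticalLiftₗ_apply {x : M} (F A : EndFibre I x) :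
    verticalLiftₗ F A = verticalLift F A := rfl

theorem verticalLiftₗ_injective {x : M} (F : EndFibre I x) :
    Function.Injective (verticalLiftₗ F) := by
  rw [← LinearMap.ker_eq_bot, LinearMap.ker_eq_bot']
  intro A hA
  have h := dEndCoord_verticalLift F A
  rw [← verticalLiftₗ_apply, hA, ContinuousLinearMap.map_zero] at h
  exact (endCoordEquiv x).map_eq_zero_iff.1 h.symm

variable (D : CovariantDerivative I E (TangentSpace I : M → Type _))

theorem DiffEnd.sub {s s' : ∀ y : M, EndFibre I y} {x : M} (hs : DiffEnd s x)
    (hs' : DiffEnd s' x) : DiffEnd (s - s') x :=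
  mdifferentiableAt_sub_section hs hs'

theorem nablaEnd_sub {s s' : ∀ y : M, EndFibre I y} {x : M} (hs : DiffEnd s x)
    (hs' : DiffEnd s' x) (v : TangentSpace I x) :
    nablaEnd D (hs.sub hs') v = nablaEnd D hs v - nablaEnd D hs' v := by
  apply nablaEnd_ext
  intro Y hY
  have hY' : DiffField Y x := hY.mdifferentiableAt (by simp)
  rw [sub_apply, nablaEnd_apply D hs v hY', nablaEnd_apply D hs' v hY']
  have h1 : (fun y => s y (Y y)) = (fun y => (s - s') y (Y y)) + fun y => s' y (Y y) := by
    ext y; simp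
  have h2 := D.isCovariantDerivativeOn.add ((hs.sub hs').apply hY') (hs'.apply hY')
  rw [h1, h2]
  simp
  abel

theorem nablaEnd_of_eq_sum {n : ℕ} {f : Fin n → M → ℝ} {S : Fin n → ∀ y : M, EndFibre I y} {x : M}
    (hf : ∀ i, MDifferentiableAt I 𝓘(ℝ, ℝ) (f i) x) (h0 : ∀ i, f i x = 0)
    (hS : ∀ i, DiffEnd (S i) x) {s : ∀ y : M, EndFibre I y} (hs : DiffEnd s x)
    (h : ∀ᶠ y in nhds x, s y = ∑ i, f i y • S i y) (v : TangentSpace I x) :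
    nablaEnd D hs v = ∑ i, mvfderiv I (f i) x v • S i x := by
  apply nablaEnd_ext
  intro Y hY
  have hY' : DiffField Y x := hY.mdifferentiableAt (by simp)
  have hsx : s x = 0 := by
    rw [h.self_of_nhds]
    simp [h0]
  rw [hsx, cov_of_eq_sum D hf h0 (fun i => (hS i).apply hY') (hs.apply hY') (by
    filter_upwards [h] with y hy
    rw [hy]
    simp) v]
  simp

set_option synthInstance.maxHeartbeats 200000 in
/-- Two sections with the same value have differentials which differ by the vertical lift of the
difference of the covariant derivatives. -/
theorem mfderiv_section_sub {s s' : ∀ y : M, EndFibre I y} {x : M} (hs : DiffEnd s x)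
    (hs' : DiffEnd s' x) {F : EndFibre I x} (hF : s x = F) (hF' : s' x = F)
    (v : TangentSpace I x) :
    sectionDiff hs hF v =
      sectionDiff hs' hF' v + verticalLift F (nablaEnd D hs v - nablaEnd D hs' v) := by
  apply tangent_endBundle_ext'
  · rw [ContinuousLinearMap.map_add, dproj_verticalLift, dproj_sectionDiff, dproj_sectionDiff]
    exact (add_zero _).symm
  · rw [ContinuousLinearMap.map_add, dEndCoord_verticalLift, dEndCoord_sectionDiff,
      dEndCoord_sectionDiff, ← nablaEnd_sub D hs hs']
    have h0 : (s - s') x = 0 := by simp [hF, hF']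
    -- The difference of the sections vanishes at x, so its coefficients in a frame do too. Both its
    -- covariant derivative and the derivative of its fibre component then reduce to ∑ df_i(v)
    -- S_i(x).
    obtain ⟨n, f, S, hf, hf0, hS, heq⟩ := exists_frame_expansion (I := I) (hs.sub hs') h0
    have hS' : ∀ i, DiffEnd (S i) x := fun i => (hS i).mdifferentiableAt (by simp)
    rw [nablaEnd_of_eq_sum D hf hf0 hS' (hs.sub hs') heq, map_sum]
    let e := trivializationAt (E →L[ℝ] E) (fun x : M => EndFibre I x) x
    have hc : (fun y => endCoord I M x ⟨y, s y⟩) =ᶠ[nhds x]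
        fun y => endCoord I M x ⟨y, s' y⟩ + ∑ i, f i y • endCoord I M x ⟨y, S i y⟩ := by
      filter_upwards [heq, e.open_baseSet.mem_nhds (mem_endBaseSet x)] with y hy hyb
      have hlin : ∀ A : EndFibre I y, endCoord I M x ⟨y, A⟩ =
        e.continuousLinearEquivAt ℝ y hyb A := fun A => rfl
      simp only [hlin]
      have : s y = s' y + ∑ i, f i y • S i y := by
        rw [← hy]
        simp
      rw [this, map_add, map_sum]
      simp only [map_smul]
    have hd : ∀ i, MDifferentiableAt I 𝓘(ℝ, E →L[ℝ] E)
        (fun y => f i y • endCoord I M x ⟨y, S i y⟩) x := fun i =>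
      (hf i).smul (endCoord_section_mdifferentiableAt (hS' i))
    have hsum : ∀ t : Finset (Fin n), mvfderiv I
        (fun y => ∑ i ∈ t, f i y • endCoord I M x ⟨y, S i y⟩) x v =
        ∑ i ∈ t, mvfderiv I (f i) x v • endCoordEquiv x (S i x) ∧
        MDifferentiableAt I 𝓘(ℝ, E →L[ℝ] E)
          (fun y => ∑ i ∈ t, f i y • endCoord I M x ⟨y, S i y⟩) x := by
      classical
      intro t
      induction t using Finset.induction_on with
      | empty =>
        simp only [Finset.sum_empty]
        exact ⟨by rw [mvfderiv_const]; rfl, mdifferentiableAt_const⟩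
      | insert a t ha ih =>
        simp only [Finset.sum_insert ha]
        refine ⟨?_, (hd a).add ih.2⟩
        have h1 := mvfderiv_add (hd a) ih.2
        have h2 := mvfderiv_smul (hf a) (endCoord_section_mdifferentiableAt (hS' a))
        have h3 := DFunLike.congr_fun h1 v
        have h4 := DFunLike.congr_fun h2 v
        refine h3.trans ?_
        refine (congrArg (fun w => mvfderiv I (fun y => f a y • endCoord I M x ⟨y, S a y⟩) x v + w)
          ih.1).trans ?_
        refine congrArg (fun w => w + ∑ i ∈ t, mvfderiv I (f i) x v • endCoordEquiv x (S i x)) ?_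
        refine h4.trans ?_
        change f a x • _ + mvfderiv I (f a) x v • endCoord I M x ⟨x, S a x⟩ = _
        rw [hf0, zero_smul, zero_add]
        rfl
    have hmv : mvfderiv I (fun y => endCoord I M x ⟨y, s y⟩) x v =
        mvfderiv I (fun y => endCoord I M x ⟨y, s' y⟩ +
          ∑ i, f i y • endCoord I M x ⟨y, S i y⟩) x v := by
      exact DFunLike.congr_fun (hc.mfderiv_eq (I := I) (I' := 𝓘(ℝ, E →L[ℝ] E))) v
    have h5 := DFunLike.congr_fun (mvfderiv_add (endCoord_section_mdifferentiableAt hs')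
      (hsum Finset.univ).2) v
    rw [hmv]
    simp only [map_smul]
    exact h5.trans (congrArg
      (fun w => mvfderiv I (fun y => endCoord I M x ⟨y, s' y⟩) x v + w) (hsum Finset.univ).1)

end TotalSpace

/-! ### Operators with f³ = -f: which combinations detect the -i-eigenspace. -/

section Algebra

variable {V : Type*} [AddCommGroup V] [Module ℝ V]

/-- The value of a complex endomorphism on a complex vector. -/
noncomputable def evalC {S : Type*} [AddCommGroup S] [Module ℝ S] (ι : S →ₗ[ℝ] V →ₗ[ℝ] V)
    (Y : ℂ ⊗[ℝ] V) : ℂ ⊗[ℝ] S →ₗ[ℂ] ℂ ⊗[ℝ] V :=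
  (ι.flip (cre Y)).baseChange ℂ + Complex.I • (ι.flip (cim Y)).baseChange ℂ

theorem evalC_cvec {S : Type*} [AddCommGroup S] [Module ℝ S] (ι : S →ₗ[ℝ] V →ₗ[ℝ] V)
    (Y : ℂ ⊗[ℝ] V) (A B : S) : evalC ι Y (cvec A B) =
      (ι A).baseChange ℂ Y + Complex.I • (ι B).baseChange ℂ Y := by
  conv_rhs => rw [← cvec_eta Y]
  rw [evalC]
  simp only [LinearMap.add_apply, LinearMap.smul_apply, baseChange_cvec', I_smul_cvec, cvec_add,
    LinearMap.flip_apply]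
  congr 1
  abel

/-- The eigenvalues of f are among 0, i and -i, so 2i - f is invertible; it commutes with f, so it
can be cancelled. The operator 2i - f appears in the velocity in the Grassmannian. -/
theorem eigen_of_sub_mem {W : Type*} [AddCommGroup W] [Module ℂ W] {f : Module.End ℂ W}
    (h3 : ∀ z, f (f (f z)) = -f z) {z : W}
    (h : (2 * Complex.I) • z - f z ∈ Module.End.eigenspace f (-Complex.I)) :
    z ∈ Module.End.eigenspace f (-Complex.I) := by
  rw [Module.End.mem_eigenspace_iff] at h ⊢
  have e1 : f (f z) = Complex.I • f z - (2 : ℂ) • z := by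
    have h' : (2 * Complex.I) • f z - f (f z) = -Complex.I • ((2 * Complex.I) • z - f z) := by
      rw [← h, map_sub, map_smul]
    have h2 : f (f z) = (2 * Complex.I) • f z + Complex.I • ((2 * Complex.I) • z - f z) := by
      rw [neg_smul] at h'
      rw [sub_eq_iff_eq_add] at h'
      rw [h']
      abel
    rw [h2, smul_sub, smul_smul, show Complex.I * (2 * Complex.I) = -2 by
      linear_combination 2 * Complex.I_mul_I]
    module
  have e2 := h3 z
  rw [e1, map_sub, map_smul, map_smul, e1, smul_sub, smul_smul, Complex.I_mul_I, smul_smul] at e2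
  have e3 : (2 : ℂ) • f z = (2 : ℂ) • (-Complex.I • z) := by
    rw [eq_neg_iff_add_eq_zero] at e2
    have : -((2 : ℂ) • f z - (2 : ℂ) • (-Complex.I • z)) = 0 := by
      rw [← e2]
      module
    exact sub_eq_zero.1 (neg_eq_zero.1 this)
  exact smul_right_injective _ (two_ne_zero (α := ℂ)) e3

/-- Since f is diagonalizable, the image of f + i meets the -i-eigenspace only in zero. -/
theorem eigen_of_add_mem {W : Type*} [AddCommGroup W] [Module ℂ W] {f : Module.End ℂ W}
    (h3 : ∀ z, f (f (f z)) = -f z) {z : W}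
    (h : f z + Complex.I • z ∈ Module.End.eigenspace f (-Complex.I)) :
    f z + Complex.I • z = 0 := by
  set w := f z + Complex.I • z with hw
  have h1 : f (f w) - Complex.I • f w = 0 := by
    rw [hw, map_add, map_add, map_smul, map_smul, h3, smul_add, smul_smul, Complex.I_mul_I]
    module
  rw [Module.End.mem_eigenspace_iff] at h
  rw [h, map_smul, h, smul_smul, smul_smul, ← sub_smul] at h1
  have h2 : -Complex.I * -Complex.I - Complex.I * -Complex.I = -2 := by
    linear_combination 2 * Complex.I_mul_I
  rw [h2] at h1
  exact (smul_eq_zero.1 h1).resolve_left (by norm_num)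

end Algebra

/-! ### Horizontal spaces as images of parallel sections. -/

section Horizontal

variable {E : Type*} [NormedAddCommGroup E] [NormedSpace ℝ E] [FiniteDimensional ℝ E]
  {H : Type*} [TopologicalSpace H] {I : ModelWithCorners ℝ E H}
  {M : Type*} [TopologicalSpace M] [ChartedSpace H M] [IsManifold I ∞ M]
  (D : CovariantDerivative I E (TangentSpace I : M → Type _))

/-- A section of the endomorphism bundle, smooth at `x`. -/
abbrev SmoothEndAt (s : ∀ y : M, EndFibre I y) (x : M) : Prop :=
  ContMDiffAt I (endModel I) ∞ (fun y => (⟨y, s y⟩ : EndBundle I M)) x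

/-- A vector field, smooth at `x`. -/
abbrev SmoothFieldAt (Y : ∀ y : M, TangentSpace I y) (x : M) : Prop :=
  ContMDiffAt I I.tangent ∞ (fun y => (⟨y, Y y⟩ : TangentBundle I M)) x

omit [FiniteDimensional ℝ E] in
theorem SmoothEndAt.diffEnd {s : ∀ y : M, EndFibre I y} {x : M} (hs : SmoothEndAt s x) :
    DiffEnd s x := hs.mdifferentiableAt (by simp)

omit [FiniteDimensional ℝ E] in
theorem SmoothFieldAt.diffField {Y : ∀ y : M, TangentSpace I y} {x : M} (hs : SmoothFieldAt Y x) :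
    DiffField Y x := hs.mdifferentiableAt (by simp)

omit [FiniteDimensional ℝ E] in
theorem SmoothEndAt.apply {s : ∀ y : M, EndFibre I y} {x : M} (hs : SmoothEndAt s x)
    {Y : ∀ y : M, TangentSpace I y} (hY : SmoothFieldAt Y x) :
    SmoothFieldAt (fun y => s y (Y y)) x :=
  ContMDiffAt.clm_bundle_apply hs hY

theorem isParallelAt_iff {s : ∀ y : M, EndFibre I y} {x : M} (hs : SmoothEndAt s x)
    (v : TangentSpace I x) : IsParallelAt D s x v ↔ nablaEnd D hs.diffEnd v = 0 := by
  constructor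
  · intro h
    exact nablaEnd_ext D _ v 0 fun Y hY => by rw [h Y hY]; rfl
  · intro h Y hY
    rw [← nablaEnd_apply D hs.diffEnd v (SmoothFieldAt.diffField hY), h]
    rfl

/-- The covariant derivative of a section of the endomorphism bundle as a linear map. -/
noncomputable def nablaEndₗ {s : ∀ y : M, EndFibre I y} {x : M} (hs : DiffEnd s x) :
    TangentSpace I x →ₗ[ℝ] EndFibre I x where
  toFun v := nablaEnd D hs v
  map_add' v w := by
    refine nablaEnd_ext D hs _ _ fun Y hY => ?_
    rw [add_apply, nablaEnd_apply D hs v (SmoothFieldAt.diffField hY),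
      nablaEnd_apply D hs w (SmoothFieldAt.diffField hY), map_add, map_add, map_add]
    abel
  map_smul' a v := by
    refine nablaEnd_ext D hs _ _ fun Y hY => ?_
    rw [RingHom.id_apply, smul_apply, nablaEnd_apply D hs v (SmoothFieldAt.diffField hY),
      map_smul, map_smul, map_smul, smul_sub]

/-- Subtract from s the sum of f_i S_i, where the f_i are chart coordinates vanishing at x and the
S_i extend the covariant derivatives of s along a basis. The value at x is unchanged and all the
first covariant derivatives are cancelled. -/
theorem exists_parallel_section {s : ∀ y : M, EndFibre I y} {x : M} (hs : SmoothEndAt s x) :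
    ∃ (s₀ : ∀ y : M, EndFibre I y) (h₀ : SmoothEndAt s₀ x), s₀ x = s x ∧
      ∀ v, nablaEnd D h₀.diffEnd v = 0 := by
  let b := Module.finBasis ℝ E
  let A : TangentSpace I x →L[ℝ] E := mfderiv I 𝓘(ℝ, E) (extChartAt I x) x
  have hA : A.IsInvertible := isInvertible_mfderiv_extChartAt (mem_extChartAt_source x)
  let N : E →ₗ[ℝ] EndFibre I x := nablaEndₗ D hs.diffEnd ∘ₗ A.inverse.toLinearMap
  let f : Fin (Module.finrank ℝ E) → M → ℝ := fun i y =>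
    b.coord i (extChartAt I x y - extChartAt I x x)
  let S : Fin (Module.finrank ℝ E) → ∀ y : M, EndFibre I y := fun i y =>
    FiberBundle.extend (E →L[ℝ] E) (E := fun x : M => EndFibre I x) (N (b i)) y
  have hfs : ∀ i, ContMDiffAt I 𝓘(ℝ, ℝ) ∞ (f i) x := by
    intro i
    have h1 : ContMDiffAt I 𝓘(ℝ, E) ∞ (extChartAt I x) x := contMDiffAt_extChartAt
    have h2 : ContDiff ℝ ∞ fun w : E => b.coord i (w - extChartAt I x x) :=
      (LinearMap.toContinuousLinearMap (b.coord i)).contDiff.comp (contDiff_id.sub contDiff_const)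
    exact h2.contMDiff.contMDiffAt.comp x h1
  have hf0 : ∀ i, f i x = 0 := fun i => by simp [f]
  have hf : ∀ i, MDifferentiableAt I 𝓘(ℝ, ℝ) (f i) x := fun i => (hfs i).mdifferentiableAt (by simp)
  have hdf : ∀ i v, mvfderiv I (f i) x v = b.coord i (A v) := by
    intro i v
    have h1 : HasFDerivAt (fun w : E => b.coord i (w - extChartAt I x x))
        (LinearMap.toContinuousLinearMap (b.coord i)) (extChartAt I x x) := by
      have := (LinearMap.toContinuousLinearMap (b.coord i)).hasFDerivAt (x := extChartAt I x x)
      have h2 := this.sub_const (b.coord i (extChartAt I x x))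
      refine h2.congr_of_eventuallyEq (Filter.Eventually.of_forall fun w => ?_)
      simp
    have h3 := h1.hasMFDerivAt.comp x
      ((contMDiffAt_extChartAt (I := I) (x := x) (n := 1)).mdifferentiableAt (by simp)).hasMFDerivAt
    exact DFunLike.congr_fun h3.mfderiv v
  have hS : ∀ i, SmoothEndAt (S i) x := fun i => FiberBundle.contMDiffAt_extend I (E →L[ℝ] E) (N (b i))
  have hSx : ∀ i, S i x = N (b i) := fun i => FiberBundle.extend_apply_self _ _
  have hsum : SmoothEndAt (fun y => ∑ i, f i y • S i y) x :=
    ContMDiffAt.sum_section fun i _ => (hfs i).smul_section (hS i)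
  have h₀ : SmoothEndAt (s - fun y => ∑ i, f i y • S i y) x := hs.sub_section hsum
  refine ⟨s - fun y => ∑ i, f i y • S i y, h₀, by simp [hf0], fun v => ?_⟩
  have h1 := nablaEnd_sub D hs.diffEnd hsum.diffEnd v
  refine h1.trans ?_
  rw [nablaEnd_of_eq_sum D hf hf0 (fun i => (hS i).diffEnd) hsum.diffEnd
    (Filter.Eventually.of_forall fun y => rfl) v]
  simp only [hdf, hSx]
  have h2 : ∑ i, b.coord i (A v) • N (b i) = N (A v) := by
    conv_rhs => rw [← b.sum_repr (A v), map_sum]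
    simp
  rw [h2, sub_eq_zero]
  have h3 : A.inverse (A v) = v := hA.inverse_apply_self v
  change _ = nablaEnd D hs.diffEnd (A.inverse (A v))
  rw [h3]

/-- Sections with the same value that are parallel along v differ in their differentials by the
vertical lift of zero. The span over all such sections is therefore the image of one section which
is parallel in every direction. -/
theorem horizontalSpace_eq_range {s : ∀ y : M, EndFibre I y} {x : M} (hs : SmoothEndAt s x)
    {F : EndFibre I x} (hF : s x = F) (hN : ∀ v, nablaEnd D hs.diffEnd v = 0) :
    horizontalSpace D F = LinearMap.range (sectionDiff hs.diffEnd hF).toLinearMap := by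
  apply le_antisymm
  · refine Submodule.span_le.2 ?_
    rintro ξ ⟨t, v, ht, rfl, hpar, rfl⟩
    refine ⟨v, ?_⟩
    have ht' : SmoothEndAt t x := ht
    have h := mfderiv_section_sub D hs.diffEnd ht'.diffEnd hF rfl v
    rw [hN, (isParallelAt_iff D ht' v).1 hpar, sub_zero, ← verticalLiftₗ_apply,
      LinearMap.map_zero] at h
    exact h.trans (add_zero _)
  · rintro _ ⟨v, rfl⟩
    subst hF
    exact Submodule.subset_span ⟨s, v, hs, rfl, (isParallelAt_iff D hs v).2 (hN v), rfl⟩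

end Horizontal

/-! ### Tangent vectors to the fibres of the bundle of isotropic spaces. -/

section Fibre

variable {E : Type*} [NormedAddCommGroup E] [NormedSpace ℝ E] [FiniteDimensional ℝ E]
  {H : Type*} [TopologicalSpace H] {I : ModelWithCorners ℝ E H}
  {M : Type*} [TopologicalSpace M] [ChartedSpace H M] [IsManifold I 1 M]
  {c : ConformalStructure I M} {r : ℕ} {x : M}

namespace ConformalStructure.IsotropicSpace

theorem fStructure_skew (q : c.IsotropicSpace r x) : c.IsSkew q.fStructure :=
  q.existsUnique.choose_spec.1.1

theorem fStructure_cube (q : c.IsotropicSpace r x) (v : TangentSpace I x) :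
    q.fStructure (q.fStructure (q.fStructure v)) = -q.fStructure v := by
  have h := DFunLike.congr_fun q.existsUnique.choose_spec.1.2.1 v
  exact eq_neg_of_add_eq_zero_left h

theorem eigen_fStructure (q : c.IsotropicSpace r x) : eigen q.fStructure (-Complex.I) = q.space :=
  q.existsUnique.choose_spec.1.2.2

theorem fStructure_unique (q : c.IsotropicSpace r x) {F : EndFibre I x} (h1 : c.IsSkew F)
    (h2 : F ∘L F ∘L F + F = 0) (h3 : eigen F (-Complex.I) = q.space) : q.fStructure = F :=
  q.existsUnique.unique q.existsUnique.choose_spec.1 ⟨h1, h2, h3⟩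

theorem ext_space {q q' : c.IsotropicSpace r x} (h : q.space = q'.space) : q = q' := by
  cases q; cases q'; cases h; rfl

theorem fStructure_cube_complex (q : c.IsotropicSpace r x) (z : CTangent I x) :
    q.fStructure.toLinearMap.baseChange ℂ (q.fStructure.toLinearMap.baseChange ℂ
      (q.fStructure.toLinearMap.baseChange ℂ z)) = -q.fStructure.toLinearMap.baseChange ℂ z := by
  rw [← cvec_eta z]
  simp only [baseChange_cvec', cvec_neg]
  congr 1 <;> exact q.fStructure_cube _

theorem mem_space_iff (q : c.IsotropicSpace r x) (z : CTangent I x) :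
    z ∈ q.space ↔ q.fStructure.toLinearMap.baseChange ℂ z = -Complex.I • z := by
  rw [← q.eigen_fStructure, eigen, Module.End.mem_eigenspace_iff]

theorem cvec_mem_space_iff (q : c.IsotropicSpace r x) (a b : TangentSpace I x) :
    cvec a b ∈ q.space ↔ q.fStructure a = b ∧ q.fStructure b = -a := by
  rw [← q.eigen_fStructure]
  exact eigen_cvec _ _ _

/-- Such an A is a commutator [B, F] with B skew, hence the velocity of F conjugated by the
isometries exp(tB). Moving the space q by the same isometries gives a curve of isotropic spaces,
whose `f`-structures are these conjugates by uniqueness. -/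
theorem isTangentToFibre_of_skew (q : c.IsotropicSpace r x) {A : EndFibre I x} (hA : c.IsSkew A)
    (h : A ∘L q.fStructure ∘L q.fStructure + q.fStructure ∘L A ∘L q.fStructure +
      q.fStructure ∘L q.fStructure ∘L A + A = 0) : q.IsTangentToFibre A := by
  obtain ⟨g, hg⟩ := c.nonempty
  obtain ⟨u, w, hw', hu', hu0, hiso, hder⟩ : ∃ u w : ℝ → EndFibre I x, (∀ t v, u t (w t v) = v) ∧
      (∀ t v, w t (u t v) = v) ∧ (∀ v, u 0 v = v) ∧
      (∀ t a b, g.inner x (u t a) (u t b) = g.inner x a b) ∧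
      HasDerivAt (fun t => u t ∘L q.fStructure ∘L w t) A 0 := by
    let G : E →L[ℝ] E →L[ℝ] ℝ := g.inner x
    let F : E →L[ℝ] E := q.fStructure
    have hF3 : F * F * F = -F := by
      ext v
      exact q.fStructure_cube v
    obtain ⟨B, hB, hBA⟩ := exists_skew_commutator (g := fun x y => G x y) (F := F) (A := A)
      (by simp) (by simp) (by simp) (by simp) (by simp) (q.fStructure_skew g hg) (hA g hg) hF3 h
    obtain ⟨u, w, huw, hwu, hu0, -, hiso, hder⟩ := exists_isometry_curve G (F := F) hB
    rw [hBA] at hder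
    exact ⟨u, w, fun t v => DFunLike.congr_fun (huw t) v, fun t v => DFunLike.congr_fun (hwu t) v,
      fun v => DFunLike.congr_fun hu0 v, hiso, hder⟩
  have hiso' : ∀ t, ∀ g' ∈ c.metrics, ∀ a b : TangentSpace I x,
      g'.inner x (u t a) (u t b) = g'.inner x a b := by
    intro t g' hg' a b
    obtain ⟨f, -, -, hf⟩ := (c.mem_iff g hg g').1 hg'
    rw [hf, hf, hiso]
  let U : ℝ → TangentSpace I x →ₗ[ℝ] TangentSpace I x := fun t => (u t).toLinearMap
  have hinj : ∀ t, Function.Injective ((U t).baseChange ℂ) := fun t =>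
    baseChange_injective (Function.LeftInverse.injective (hu' t))
  let γ : ℝ → c.IsotropicSpace r x := fun t =>
    { space := q.space.map ((U t).baseChange ℂ)
      isotropic := by
        rintro _ ⟨z, hz, rfl⟩ _ ⟨z', hz', rfl⟩ g' hg'
        have h1 := q.isotropic z hz z' hz' g' hg'
        rw [← cvec_eta z, ← cvec_eta z', form_cvec] at h1
        rw [← cvec_eta z, ← cvec_eta z', baseChange_cvec', baseChange_cvec', form_cvec, ← h1]
        have e : ∀ a b, (g'.inner x).toBilinForm (U t a) (U t b) =
          (g'.inner x).toBilinForm a b := hiso' t g' hg'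
        rw [e, e, e, e]
      finrank_eq :=
        (LinearEquiv.finrank_eq (Submodule.equivMapOfInjective _ (hinj t) q.space)).symm.trans
          q.finrank_eq }
  have hγ : ∀ t, (γ t).fStructure = u t ∘L q.fStructure ∘L w t := by
    intro t
    refine fStructure_unique _ ?_ ?_ ?_
    · intro g' hg' v v'
      have h1 := q.fStructure_skew g' hg' (w t v) (w t v')
      rw [← hiso' t g' hg', ← hiso' t g' hg' (w t v), hw', hw'] at h1
      exact h1
    · ext v
      change u t (q.fStructure (w t (u t (q.fStructure (w t (u t (q.fStructure (w t v)))))))) +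
        u t (q.fStructure (w t v)) = 0
      rw [hu', hu', q.fStructure_cube, map_neg, neg_add_cancel]
    · ext z
      obtain ⟨a, b, rfl⟩ : ∃ a b, z = cvec a b := ⟨_, _, (cvec_eta z).symm⟩
      constructor
      · intro hz
        obtain ⟨h1, h2⟩ := (eigen_cvec _ _ _).1 hz
        change u t (q.fStructure (w t a)) = b at h1
        change u t (q.fStructure (w t b)) = -a at h2
        refine ⟨cvec (w t a) (w t b), ?_, ?_⟩
        · refine (q.cvec_mem_space_iff _ _).2 ⟨?_, ?_⟩
          · rw [← h1, hu']
          · rw [← map_neg, ← h2, hu']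
        · rw [baseChange_cvec']
          exact congrArg₂ _ (hw' t a) (hw' t b)
      · rintro ⟨y, hy, hyz⟩
        rw [← hyz]
        obtain ⟨a', b', rfl⟩ : ∃ a b, y = cvec a b := ⟨_, _, (cvec_eta y).symm⟩
        obtain ⟨h1, h2⟩ := (q.cvec_mem_space_iff _ _).1 hy
        rw [baseChange_cvec']
        refine (eigen_cvec _ _ _).2 ⟨?_, ?_⟩
        · change u t (q.fStructure (w t (u t a'))) = u t b'
          rw [hu', h1]
        · change u t (q.fStructure (w t (u t b'))) = -u t a'
          rw [hu', ← map_neg, h2]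
  refine ⟨γ, ext_space ?_, ?_⟩
  · change q.space.map ((U 0).baseChange ℂ) = q.space
    have : U 0 = LinearMap.id := LinearMap.ext hu0
    rw [this, LinearMap.baseChange_id]
    exact Submodule.map_id _
  · rw [funext hγ]
    exact hder

end ConformalStructure.IsotropicSpace

end Fibre

/-! ### Separating horizontal and vertical components. -/

section Splitting

variable {T T' S : Type*} [AddCommGroup T] [Module ℝ T] [AddCommGroup T'] [Module ℝ T']
  [AddCommGroup S] [Module ℝ S] {σ : T →ₗ[ℝ] T'} {ρ : T' →ₗ[ℝ] T} {V : S →ₗ[ℝ] T'}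
  {K : Submodule ℝ T} {q : Submodule ℂ (ℂ ⊗[ℝ] T)} {vert : Submodule ℂ (ℂ ⊗[ℝ] T')}
  {C : Submodule ℂ (ℂ ⊗[ℝ] S)}

theorem range_baseChange_le : (LinearMap.range σ).baseChange ℂ ≤ LinearMap.range (σ.baseChange ℂ) := by
  rw [Submodule.baseChange_eq_span]
  refine Submodule.span_le.2 ?_
  rintro _ ⟨_, ⟨v, rfl⟩, rfl⟩
  exact ⟨1 ⊗ₜ v, by simp⟩

theorem baseChange_section (hσ : ∀ v, ρ (σ v) = v) (z : ℂ ⊗[ℝ] T) :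
    ρ.baseChange ℂ (σ.baseChange ℂ z) = z := by
  rw [← cvec_eta z, baseChange_cvec', baseChange_cvec', hσ, hσ]

/-- Projecting by ρ identifies the horizontal components; cancelling them leaves the vertical ones,
and V is injective. Only an upper bound for the vertical space is required in this direction. -/
theorem mem_of_add_mem_sup (hσ : ∀ v, ρ (σ v) = v) (hV : ∀ A, ρ (V A) = 0)
    (hVi : Function.Injective V) (hvert : vert ≤ C.map (V.baseChange ℂ)) {z : ℂ ⊗[ℝ] T}
    {a : ℂ ⊗[ℝ] S}
    (h : σ.baseChange ℂ z + V.baseChange ℂ a ∈ (LinearMap.range σ ⊓ K.comap ρ).baseChange ℂ ⊔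
      ((LinearMap.range σ).baseChange ℂ ⊓ q.comap (ρ.baseChange ℂ) ⊔ vert)) : a ∈ C := by
  have hle : (LinearMap.range σ ⊓ K.comap ρ).baseChange ℂ ⊔
      ((LinearMap.range σ).baseChange ℂ ⊓ q.comap (ρ.baseChange ℂ) ⊔ vert) ≤
      LinearMap.range (σ.baseChange ℂ) ⊔ C.map (V.baseChange ℂ) := by
    refine sup_le ?_ (sup_le ?_ (hvert.trans le_sup_right))
    · exact ((Submodule.baseChange_mono ℂ inf_le_left).trans range_baseChange_le).trans le_sup_left
    · exact (inf_le_left.trans range_baseChange_le).trans le_sup_left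
  obtain ⟨_, ⟨z', rfl⟩, _, ⟨a', ha', rfl⟩, heq⟩ := Submodule.mem_sup.1 (hle h)
  have hV' : ∀ a, ρ.baseChange ℂ (V.baseChange ℂ a) = 0 := fun a => by
    rw [← cvec_eta a, baseChange_cvec', baseChange_cvec', hV, hV, cvec_zero]
  have h1 := congrArg (ρ.baseChange ℂ) heq
  rw [map_add, map_add, baseChange_section hσ, baseChange_section hσ, hV', hV', add_zero,
    add_zero] at h1
  rw [h1] at heq
  rwa [← baseChange_injective hVi (add_left_cancel heq)]

theorem add_mem_sup_of_mem (hσ : ∀ v, ρ (σ v) = v) {z : ℂ ⊗[ℝ] T}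
    (hz : z ∈ K.baseChange ℂ ⊔ q) {ζ : ℂ ⊗[ℝ] T'} (hζ : ζ ∈ vert) :
    σ.baseChange ℂ z + ζ ∈ (LinearMap.range σ ⊓ K.comap ρ).baseChange ℂ ⊔
      ((LinearMap.range σ).baseChange ℂ ⊓ q.comap (ρ.baseChange ℂ) ⊔ vert) := by
  obtain ⟨z₀, h₀, z₁, h₁, rfl⟩ := Submodule.mem_sup.1 hz
  rw [map_add, add_assoc]
  refine Submodule.add_mem_sup ?_ (Submodule.add_mem_sup ⟨?_, ?_⟩ hζ)
  · rw [Submodule.baseChange_eq_span] at h₀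
    refine (Submodule.span_le (p := Submodule.comap (σ.baseChange ℂ)
      ((LinearMap.range σ ⊓ K.comap ρ).baseChange ℂ))).2 ?_ h₀
    rintro _ ⟨v, hv, rfl⟩
    change σ.baseChange ℂ (1 ⊗ₜ v) ∈ (LinearMap.range σ ⊓ K.comap ρ).baseChange ℂ
    rw [LinearMap.baseChange_tmul]
    refine Submodule.tmul_mem_baseChange_of_mem _ ⟨⟨v, rfl⟩, ?_⟩
    change ρ (σ v) ∈ K
    rw [hσ]
    exact hv
  · rw [← cvec_eta z₁, baseChange_cvec']
    exact mem_baseChange_cvec ⟨_, rfl⟩ ⟨_, rfl⟩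
  · change ρ.baseChange ℂ (σ.baseChange ℂ z₁) ∈ q
    rwa [baseChange_section hσ]

end Splitting

/-! ### Holomorphy of the section as a condition on the covariant derivative of its `f`-structure.
-/

section Holomorphy

variable {E : Type*} [NormedAddCommGroup E] [NormedSpace ℝ E] [FiniteDimensional ℝ E]
  {H : Type*} [TopologicalSpace H] {I : ModelWithCorners ℝ E H}
  {M : Type*} [TopologicalSpace M] [ChartedSpace H M] [IsManifold I ∞ M]
  {D : CovariantDerivative I E (TangentSpace I : M → Type _)}
  {c : ConformalStructure I M} {r : ℕ}

/-- The one-form α multiplies the whole sum, which is zero at x, so it drops out. Two products are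
allowed in order to cover both g(FX, Y) + g(X, FY) = 0 and the components of a complex orthogonality
relation. -/
theorem ConformalStructure.IsWeylConnection.cov_orthogonal (hD : c.IsWeylConnection D)
    {g : ContMDiffRiemannianMetric I ∞ E (fun x : M => TangentSpace I x)} (hg : g ∈ c.metrics)
    {x : M} {X Y X' Y' : ∀ y : M, TangentSpace I y} (hX : SmoothFieldAt X x)
    (hY : SmoothFieldAt Y x) (hX' : SmoothFieldAt X' x) (hY' : SmoothFieldAt Y' x)
    (h : ∀ᶠ y in nhds x, g.inner y (X y) (Y y) + g.inner y (X' y) (Y' y) = 0)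
    (v : TangentSpace I x) :
    g.inner x (D X x v) (Y x) + g.inner x (X x) (D Y x v) +
      (g.inner x (D X' x v) (Y' x) + g.inner x (X' x) (D Y' x v)) = 0 := by
  obtain ⟨α, hα⟩ := hD.conformal g hg x
  have h1 := hα X Y hX hY v
  have h2 := hα X' Y' hX' hY' v
  have h0 := h.self_of_nhds
  have hd : ∀ {X Y : ∀ y : M, TangentSpace I y}, SmoothFieldAt X x → SmoothFieldAt Y x →
      MDifferentiableAt I 𝓘(ℝ, ℝ) (fun y => g.inner y (X y) (Y y)) x := by
    intro X Y hX hY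
    have h3 : MDifferentiableAt I (I.prod 𝓘(ℝ, ℝ)) (fun y =>
        TotalSpace.mk' ℝ (E := Bundle.Trivial M ℝ) y (g.inner y (X y) (Y y))) x := by
      apply MDifferentiableAt.clm_bundle_apply₂ (F₁ := E) (F₂ := E)
      · exact (g.contMDiff x).mdifferentiableAt (by simp)
      · exact hX.diffField
      · exact hY.diffField
    exact ((mdifferentiableAt_totalSpace _ _).1 h3).2
  have h3 : mvfderiv I (fun y => g.inner y (X y) (Y y)) x v +
      mvfderiv I (fun y => g.inner y (X' y) (Y' y)) x v = 0 := by
    have h4 := DFunLike.congr_fun (mvfderiv_add (hd hX hY) (hd hX' hY')) v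
    refine h4.symm.trans ?_
    have h5 : ((fun y => g.inner y (X y) (Y y)) + fun y => g.inner y (X' y) (Y' y)) =ᶠ[nhds x]
        fun _ => (0 : ℝ) := h
    refine (DFunLike.congr_fun (h5.mfderiv_eq (I := I) (I' := 𝓘(ℝ, ℝ))) v).trans ?_
    rw [mfderiv_const]
    rfl
  have h6 : α v * (g.inner x (X x) (Y x) + g.inner x (X' x) (Y' x)) = 0 := by rw [h0, mul_zero]
  linarith

theorem nablaEnd_skew (hD : c.IsWeylConnection D) {s : ∀ y : M, EndFibre I y}
    (hs : ∀ y, c.IsSkew (s y)) {x : M} (h : SmoothEndAt s x) (v : TangentSpace I x) :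
    c.IsSkew (nablaEnd D h.diffEnd v) := by
  intro g hg a b
  let X := FiberBundle.extend E (E := fun y : M => TangentSpace I y) a
  let Y := FiberBundle.extend E (E := fun y : M => TangentSpace I y) b
  have hX : SmoothFieldAt X x := FiberBundle.contMDiffAt_extend I E a
  have hY : SmoothFieldAt Y x := FiberBundle.contMDiffAt_extend I E b
  have hXx : X x = a := FiberBundle.extend_apply_self _ _
  have hYx : Y x = b := FiberBundle.extend_apply_self _ _
  have h1 := hD.cov_orthogonal hg (h.apply hX) hY hX (h.apply hY)
    (Filter.Eventually.of_forall fun y => by rw [hs y g hg, neg_add_cancel]) v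
  have h2 := nablaEnd_apply D h.diffEnd v hX.diffField
  have h3 := nablaEnd_apply D h.diffEnd v hY.diffField
  rw [hXx] at h2
  rw [hYx] at h3
  rw [h2, h3, map_sub, map_sub, sub_apply, hs x g hg (D X x v) b]
  rw [hXx, hYx, hs x g hg a] at h1
  linarith

/-- This is the derivative of F³ = -F. Together with skewness it places each D_v F in the tangent
space of the fibre. -/
theorem nablaEnd_cube {s : ∀ y : M, EndFibre I y} (hs : ∀ y v, s y (s y (s y v)) = -s y v) {x : M}
    (h : SmoothEndAt s x) (v : TangentSpace I x) :
    nablaEnd D h.diffEnd v ∘L s x ∘L s x + s x ∘L nablaEnd D h.diffEnd v ∘L s x +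
      s x ∘L s x ∘L nablaEnd D h.diffEnd v + nablaEnd D h.diffEnd v = 0 := by
  ext a
  let X := FiberBundle.extend E (E := fun y : M => TangentSpace I y) a
  have hX : SmoothFieldAt X x := FiberBundle.contMDiffAt_extend I E a
  have hXx : X x = a := FiberBundle.extend_apply_self _ _
  have h0 := nablaEnd_apply D h.diffEnd v hX.diffField
  have h1 := nablaEnd_apply D h.diffEnd v (h.apply hX).diffField
  have h2 := nablaEnd_apply D h.diffEnd v (h.apply (h.apply hX)).diffField
  simp only [hs] at h2
  have h3 : D (fun y => -s y (X y)) x v = -D (fun y => s y (X y)) x v := by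
    have h4 := D.isCovariantDerivativeOn.smul_const (-1 : ℝ) (h.apply hX).diffField
    have h5 : ((-1 : ℝ) • fun y => s y (X y)) = fun y => -s y (X y) := by
      ext y
      simp
    rw [h5] at h4
    rw [h4]
    simp
  rw [h3] at h2
  rw [hXx] at h0 h1 h2
  change nablaEnd D h.diffEnd v (s x (s x a)) + s x (nablaEnd D h.diffEnd v (s x a)) +
    s x (s x (nablaEnd D h.diffEnd v a)) + nablaEnd D h.diffEnd v a = 0
  rw [h2, h1, h0]
  simp only [map_sub, hs]
  abel

/-- The condition that `D_z F`, for `z` in the complex distribution of `F`, preserves the eigenspace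
of `F` corresponding to `-i`. -/
def PreservesType (D : CovariantDerivative I E (TangentSpace I : M → Type _))
    {s : ∀ y : M, EndFibre I y} {x : M} (hs : DiffEnd s x) : Prop :=
  ∀ z ∈ fDistribution s x, ∀ Y ∈ eigen (s x) (-Complex.I),
    evalC (ContinuousLinearMap.coeLM ℝ) Y ((nablaEndₗ D hs).baseChange ℂ z) ∈
      eigen (s x) (-Complex.I)

/-- The differential of the section is the horizontal lift, along a parallel section with the same
value, plus the vertical lift of the covariant derivative. The horizontal component of a vector of
T⁰ ⊕ p always lies in the distribution. The vertical one does exactly when, as a complex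
endomorphism, it maps p into itself. -/
theorem distribution_mem_iff (hD : c.IsWeylConnection D) (p : ∀ x : M, c.IsotropicSpace r x) {x : M}
    (hs : SmoothEndAt (fun y => (p y).fStructure) x) :
    (fDistribution (fun x => (p x).fStructure) x).map
        (cdiff I (endModel I) (fun x => (p x).point) x) ≤ (p x).distribution D ↔
      PreservesType D hs.diffEnd := by
  obtain ⟨s₀, h₀, hs₀, hN₀⟩ := exists_parallel_section D hs
  let σ : TangentSpace I x →ₗ[ℝ] TangentSpace (endModel I) (p x).point :=
    (sectionDiff h₀.diffEnd hs₀).toLinearMap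
  let V : EndFibre I x →ₗ[ℝ] TangentSpace (endModel I) (p x).point :=
    verticalLiftₗ (p x).fStructure
  let ρ : TangentSpace (endModel I) (p x).point →ₗ[ℝ] TangentSpace I x :=
    (dproj I M (p x).point).toLinearMap
  let N := nablaEndₗ D hs.diffEnd
  have hσ : ∀ v, ρ (σ v) = v := fun v => dproj_sectionDiff h₀.diffEnd hs₀ v
  have hV : ∀ A, ρ (V A) = 0 := fun A => dproj_verticalLift _ A
  have hVi : Function.Injective V := verticalLiftₗ_injective _
  have hH : horizontalSpace D (p x).fStructure = LinearMap.range σ :=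
    horizontalSpace_eq_range D h₀ hs₀ hN₀
  have hd : ∀ z, cdiff I (endModel I) (fun x => (p x).point) x z =
      σ.baseChange ℂ z + V.baseChange ℂ (N.baseChange ℂ z) := by
    have h1 : (mfderiv I (endModel I) (fun x => (p x).point) x).toLinearMap = σ + V ∘ₗ N := by
      ext v
      have h2 := mfderiv_section_sub D hs.diffEnd h₀.diffEnd rfl hs₀ v
      rw [hN₀, sub_zero] at h2
      exact h2
    intro z
    rw [cdiff, h1, LinearMap.baseChange_add, LinearMap.baseChange_comp]
    rfl
  have hq : eigen (p x).fStructure (-Complex.I) = (p x).space := (p x).eigen_fStructure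
  have hvel : ∀ A B : EndFibre I x,
      (p x).grassmannVelocity B = Complex.I • (p x).grassmannVelocity A ↔
      ∀ Y ∈ (p x).space, evalC (ContinuousLinearMap.coeLM ℝ) Y (cvec A B) ∈ (p x).space := by
    intro A B
    set f := (p x).fStructure.toLinearMap.baseChange ℂ with hf
    -- On p one has FY = -iY, so iA - AF - FA becomes 2iA - FA there.
    have e1 : ∀ (A : EndFibre I x) (Y : (p x).space), (p x).grassmannVelocity A Y =
        (p x).space.mkQ ((1 / 2 : ℂ) • ((2 * Complex.I) • A.toLinearMap.baseChange ℂ Y.1 -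
          f (A.toLinearMap.baseChange ℂ Y.1))) := by
      intro A Y
      have hY := ((p x).mem_space_iff _).1 Y.2
      have e2 : (A ∘L (p x).fStructure + (p x).fStructure ∘L A).toLinearMap.baseChange ℂ Y.1 =
          A.toLinearMap.baseChange ℂ (f Y.1) + f (A.toLinearMap.baseChange ℂ Y.1) := by
        have : (A ∘L (p x).fStructure + (p x).fStructure ∘L A).toLinearMap =
          A.toLinearMap ∘ₗ (p x).fStructure.toLinearMap +
            (p x).fStructure.toLinearMap ∘ₗ A.toLinearMap := rfl
        rw [this, LinearMap.baseChange_add, LinearMap.baseChange_comp, LinearMap.baseChange_comp]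
        rfl
      rw [ConformalStructure.IsotropicSpace.grassmannVelocity]
      simp only [LinearMap.comp_apply, LinearMap.smul_apply, LinearMap.sub_apply,
        Submodule.subtype_apply]
      rw [e2, hf, hY, LinearMap.map_smul (A.toLinearMap.baseChange ℂ)]
      refine congrArg _ (congrArg _ ?_)
      module
    have e3 : ∀ Y : (p x).space, (p x).grassmannVelocity B Y = Complex.I • (p x).grassmannVelocity A Y ↔
        evalC (ContinuousLinearMap.coeLM ℝ) Y.1 (cvec A B) ∈ (p x).space := by
      intro Y
      rw [e1, e1, evalC_cvec, ← LinearMap.map_smul (p x).space.mkQ, ← sub_eq_zero,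
        ← LinearMap.map_sub (p x).space.mkQ, Submodule.mkQ_apply,
        Submodule.Quotient.mk_eq_zero]
      change _ ↔ A.toLinearMap.baseChange ℂ Y.1 + Complex.I • B.toLinearMap.baseChange ℂ Y.1 ∈ _
      generalize A.toLinearMap.baseChange ℂ Y.1 = a
      generalize B.toLinearMap.baseChange ℂ Y.1 = b
      have e4 : (1 / 2 : ℂ) • ((2 * Complex.I) • b - f b) -
          Complex.I • (1 / 2 : ℂ) • ((2 * Complex.I) • a - f a) =
          (1 / 2 : ℂ) • ((2 * Complex.I) • (b - Complex.I • a) - f (b - Complex.I • a)) := by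
        rw [map_sub, map_smul]
        module
      have e5 : a + Complex.I • b = Complex.I • (b - Complex.I • a) := by
        rw [smul_sub, smul_smul, Complex.I_mul_I]
        module
      rw [e4, e5, Submodule.smul_mem_iff _ (by norm_num), Submodule.smul_mem_iff _ Complex.I_ne_zero]
      constructor
      · intro h
        rw [← hq] at h ⊢
        exact eigen_of_sub_mem (p x).fStructure_cube_complex h
      · intro h
        exact Submodule.sub_mem _ (Submodule.smul_mem _ _ h) (by
          rw [((p x).mem_space_iff _).1 h]
          exact Submodule.smul_mem _ _ h)
    rw [LinearMap.ext_iff]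
    constructor
    · intro h Y hY
      exact (e3 ⟨Y, hY⟩).1 (h ⟨Y, hY⟩)
    · intro h Y
      exact (e3 Y).2 (h Y.1 Y.2)
  -- The complex endomorphisms which map p into p. They need not all be tangent to the fibre; the
  -- inclusion `hvert` is enough for one implication, and in the other the tangency of the covariant
  -- derivatives is checked separately.
  let C : Submodule ℂ (ℂ ⊗[ℝ] EndFibre I x) :=
    ⨅ Y : (p x).space, (p x).space.comap (evalC (ContinuousLinearMap.coeLM ℝ) Y.1)
  have hC : ∀ a, a ∈ C ↔ ∀ Y ∈ (p x).space,
      evalC (ContinuousLinearMap.coeLM ℝ) Y a ∈ (p x).space := by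
    intro a
    simp [C, Submodule.mem_iInf]
  have hvert : (p x).vertical01 ≤ C.map (V.baseChange ℂ) := by
    refine Submodule.span_le.2 ?_
    rintro ζ ⟨A, B, -, -, hAB, rfl⟩
    refine ⟨cvec A B, (hC _).2 ((hvel A B).1 hAB), ?_⟩
    rw [baseChange_cvec']
    rfl
  constructor
  · intro h z hz Y hY
    have h1 := h ⟨z, hz, rfl⟩
    rw [hd, ConformalStructure.IsotropicSpace.distribution,
      ConformalStructure.IsotropicSpace.horizontal0,
      ConformalStructure.IsotropicSpace.horizontal01, hH] at h1
    have h2 := mem_of_add_mem_sup hσ hV hVi hvert h1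
    rw [hq] at hY ⊢
    exact (hC _).1 h2 Y hY
  · rintro h _ ⟨z, hz, rfl⟩
    rw [hd, ConformalStructure.IsotropicSpace.distribution,
      ConformalStructure.IsotropicSpace.horizontal0,
      ConformalStructure.IsotropicSpace.horizontal01, hH]
    refine add_mem_sup_of_mem hσ ?_ ?_
    · have h1 : fDistribution (fun x => (p x).fStructure) x ≤
          (LinearMap.ker (p x).fStructure.toLinearMap).baseChange ℂ ⊔ (p x).space := by
        rw [fDistribution, hq]
        refine sup_le_sup_right ?_ _
        intro y hy
        rw [← cvec_eta y] at hy ⊢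
        obtain ⟨e1, e2⟩ := (eigen_zero_cvec _ _ _).1 hy
        exact mem_baseChange_cvec e1 e2
      exact h1 hz
    · have h1 := h z hz
      rw [← cvec_eta z, baseChange_cvec', hq] at h1
      have htan : ∀ v, (p x).IsTangentToFibre (N v) := fun v =>
        (p x).isTangentToFibre_of_skew
          (nablaEnd_skew hD (s := fun y => (p y).fStructure) (fun y => (p y).fStructure_skew) hs v)
          (nablaEnd_cube (s := fun y => (p y).fStructure) (fun y => (p y).fStructure_cube) hs v)
      refine Submodule.subset_span ⟨N (cre z), N (cim z), htan _, htan _, (hvel _ _).2 h1, ?_⟩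
      conv_lhs => rw [← cvec_eta z]
      rw [baseChange_cvec', baseChange_cvec']
      rfl

end Holomorphy

section Form

variable {V : Type*} [AddCommGroup V] [Module ℝ V] {g : LinearMap.BilinForm ℝ V}
  (hs : ∀ u v, g u v = g v u)
  (hp : ∀ u, u ≠ 0 → 0 < g u u) {F : V →ₗ[ℝ] V} (hF : ∀ u v, g (F u) v = -g u (F v))

include hp hF in
/-- The vectors orthogonal to the eigenspace of `F` corresponding to `-i` are in the complex
distribution of `F`. -/
theorem mem_fDistribution_of_form_eq_zero (h3 : ∀ u, F (F (F u)) = -F u) {z : ℂ ⊗[ℝ] V}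
    (hz : ∀ w ∈ Module.End.eigenspace (F.baseChange ℂ) (-Complex.I), g.baseChange ℂ z w = 0) :
    z ∈ Module.End.eigenspace (F.baseChange ℂ) 0 ⊔
        Module.End.eigenspace (F.baseChange ℂ) (-Complex.I) := by
  rw [mem_eigenspace_zero_sup_iff]
  refine form_nondegenerate hp fun w => ?_
  have h3' : ∀ w, F.baseChange ℂ (F.baseChange ℂ (F.baseChange ℂ w)) = -F.baseChange ℂ w := by
    intro w
    rw [← cvec_eta w, baseChange_cvec', baseChange_cvec', baseChange_cvec', cvec_neg, h3, h3]
  -- F(F - i) takes its values in the -i-eigenspace and is the adjoint of F(F + i), the operator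
  -- whose kernel is T⁰ ⊕ p.
  have hw : F.baseChange ℂ (F.baseChange ℂ w - Complex.I • w) ∈
      Module.End.eigenspace (F.baseChange ℂ) (-Complex.I) := by
    rw [Module.End.mem_eigenspace_iff, map_sub, map_sub, map_smul, map_smul, h3', smul_sub,
      smul_smul, neg_mul, Complex.I_mul_I]
    module
  have h := hz _ hw
  rw [map_sub, map_sub, map_smul, map_smul, smul_eq_mul] at h
  rw [form_skew hF, map_add, LinearMap.add_apply, form_skew hF, map_smul, LinearMap.smul_apply,
    smul_eq_mul]
  linear_combination h

end Form

/-! ### Complex vector fields, their covariant derivatives and local sections of the eigenbundles.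
-/

section Calculus

variable {E : Type*} [NormedAddCommGroup E] [NormedSpace ℝ E] [FiniteDimensional ℝ E]
  {H : Type*} [TopologicalSpace H] {I : ModelWithCorners ℝ E H}
  {M : Type*} [TopologicalSpace M] [ChartedSpace H M] [IsManifold I ∞ M]
  {D : CovariantDerivative I E (TangentSpace I : M → Type _)}
  {c : ConformalStructure I M}

/-- The complex bilinear extension of the covariant derivative of vector fields. -/
noncomputable def CVectorField.cov (D : CovariantDerivative I E (TangentSpace I : M → Type _))
    (Y : CVectorField I M) (x : M) : CTangent I x →ₗ[ℂ] CTangent I x :=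
  (D Y.re x).toLinearMap.baseChange ℂ + Complex.I • (D Y.im x).toLinearMap.baseChange ℂ

theorem CVectorField.cov_cvec (Y : CVectorField I M) (x : M) (u w : TangentSpace I x) :
    Y.cov D x (cvec u w) =
      cvec (D Y.re x u - D Y.im x w) (D Y.re x w + D Y.im x u) := by
  rw [CVectorField.cov, LinearMap.add_apply, LinearMap.smul_apply, baseChange_cvec',
    baseChange_cvec', I_smul_cvec, cvec_add, ← sub_eq_add_neg]
  rfl

/-- A smooth section, over an open set, of a complex distribution. -/
structure CVectorField.IsSectionOn (Y : CVectorField I M) (P : ∀ x : M, Submodule ℂ (CTangent I x))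
    (W : Set M) : Prop where
  smooth : Y.SmoothOn W
  mem : ∀ x ∈ W, Y.val x ∈ P x

omit [FiniteDimensional ℝ E] in
theorem CVectorField.IsSectionOn.mono {Y : CVectorField I M}
    {P P' : ∀ x : M, Submodule ℂ (CTangent I x)} {W : Set M} (hY : Y.IsSectionOn P W)
    (h : ∀ x, P x ≤ P' x) : Y.IsSectionOn P' W :=
  ⟨hY.smooth, fun x hx => h x (hY.mem x hx)⟩

omit [FiniteDimensional ℝ E] in
theorem CVectorField.IsSectionOn.subset {Y : CVectorField I M}
    {P : ∀ x : M, Submodule ℂ (CTangent I x)} {W W' : Set M} (hY : Y.IsSectionOn P W)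
    (h : W' ⊆ W) : Y.IsSectionOn P W' :=
  ⟨⟨hY.smooth.1.mono h, hY.smooth.2.mono h⟩, fun x hx => hY.mem x (h hx)⟩

omit [FiniteDimensional ℝ E] in
theorem CVectorField.IsSectionOn.re_at {Y : CVectorField I M}
    {P : ∀ x : M, Submodule ℂ (CTangent I x)} {W : Set M} (hY : Y.IsSectionOn P W) (hW : IsOpen W)
    {x : M} (hx : x ∈ W) : SmoothFieldAt Y.re x :=
  hY.smooth.1.contMDiffAt (hW.mem_nhds hx)

omit [FiniteDimensional ℝ E] in
theorem CVectorField.IsSectionOn.im_at {Y : CVectorField I M}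
    {P : ∀ x : M, Submodule ℂ (CTangent I x)} {W : Set M} (hY : Y.IsSectionOn P W) (hW : IsOpen W)
    {x : M} (hx : x ∈ W) : SmoothFieldAt Y.im x :=
  hY.smooth.2.contMDiffAt (hW.mem_nhds hx)

theorem ConformalStructure.IsWeylConnection.cov_orthogonal_sub (hD : c.IsWeylConnection D)
    {g : ContMDiffRiemannianMetric I ∞ E (fun x : M => TangentSpace I x)} (hg : g ∈ c.metrics)
    {x : M} {X Y X' Y' : ∀ y : M, TangentSpace I y} (hX : SmoothFieldAt X x)
    (hY : SmoothFieldAt Y x) (hX' : SmoothFieldAt X' x) (hY' : SmoothFieldAt Y' x)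
    (h : ∀ᶠ y in nhds x, g.inner y (X y) (Y y) - g.inner y (X' y) (Y' y) = 0)
    (v : TangentSpace I x) :
    g.inner x (D X x v) (Y x) + g.inner x (X x) (D Y x v) -
      (g.inner x (D X' x v) (Y' x) + g.inner x (X' x) (D Y' x v)) = 0 := by
  have h1 : SmoothFieldAt ((-1 : ℝ) • X') x := hX'.const_smul_section
  have h2 := hD.cov_orthogonal hg hX hY h1 hY' (by
    filter_upwards [h] with y hy
    simpa [sub_eq_add_neg] using hy) v
  rw [D.isCovariantDerivativeOn.smul_const (-1 : ℝ) hX'.diffField] at h2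
  simp only [Pi.smul_apply, smul_apply, map_smul, smul_eq_mul] at h2
  linarith

theorem form_cov_add (hD : c.IsWeylConnection D)
    {g : ContMDiffRiemannianMetric I ∞ E (fun x : M => TangentSpace I x)} (hg : g ∈ c.metrics)
    {Y Z : CVectorField I M} {P Q : ∀ x : M, Submodule ℂ (CTangent I x)} {W : Set M}
    (hW : IsOpen W) (hY : Y.IsSectionOn P W) (hZ : Z.IsSectionOn Q W)
    (h : ∀ y ∈ W, LinearMap.BilinForm.baseChange ℂ (g.inner y).toBilinForm (Y.val y) (Z.val y) = 0)
    {x : M} (hx : x ∈ W) (z : CTangent I x) :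
    LinearMap.BilinForm.baseChange ℂ (g.inner x).toBilinForm (Y.cov D x z) (Z.val x) +
      LinearMap.BilinForm.baseChange ℂ (g.inner x).toBilinForm (Y.val x) (Z.cov D x z) = 0 := by
  have hre : ∀ᶠ y in nhds x, g.inner y (Y.re y) (Z.re y) - g.inner y (Y.im y) (Z.im y) = 0 := by
    filter_upwards [hW.mem_nhds hx] with y hy
    have h1 := congrArg Complex.re (h y hy)
    rw [CVectorField.val, CVectorField.val, form_cvec] at h1
    simpa using h1
  have him : ∀ᶠ y in nhds x, g.inner y (Y.re y) (Z.im y) + g.inner y (Y.im y) (Z.re y) = 0 := by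
    filter_upwards [hW.mem_nhds hx] with y hy
    have h1 := congrArg Complex.im (h y hy)
    rw [CVectorField.val, CVectorField.val, form_cvec] at h1
    simpa using h1
  have hR := hD.cov_orthogonal_sub hg (hY.re_at hW hx) (hZ.re_at hW hx) (hY.im_at hW hx)
    (hZ.im_at hW hx) hre
  have hI := hD.cov_orthogonal hg (hY.re_at hW hx) (hZ.im_at hW hx) (hY.im_at hW hx)
    (hZ.re_at hW hx) him
  obtain ⟨u, w, rfl⟩ : ∃ u w, z = cvec u w := ⟨_, _, (cvec_eta z).symm⟩
  have e : ∀ a b, (g.inner x).toBilinForm a b = g.inner x a b := fun _ _ => rfl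
  rw [CVectorField.cov_cvec, CVectorField.cov_cvec, CVectorField.val, CVectorField.val, form_cvec,
    form_cvec]
  simp only [e, map_add, map_sub, add_apply, sub_apply]
  have hRu := hR u
  have hRw := hR w
  have hIu := hI u
  have hIw := hI w
  apply Complex.ext
  · simp
    linarith
  · simp
    linarith

/-- Vanishing torsion in each of the four real brackets, extended complex bilinearly. -/
theorem bracket_val (hD : c.IsWeylConnection D) {X Y : CVectorField I M}
    {P Q : ∀ x : M, Submodule ℂ (CTangent I x)} {W : Set M}
    (hW : IsOpen W) (hX : X.IsSectionOn P W) (hY : Y.IsSectionOn Q W) {x : M} (hx : x ∈ W) :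
    (X.bracket Y).val x = Y.cov D x (X.val x) - X.cov D x (Y.val x) := by
  have hb : ∀ {X Y : ∀ y : M, TangentSpace I y}, SmoothFieldAt X x → SmoothFieldAt Y x →
      mlieBracket I X Y x = D Y x (X x) - D X x (Y x) := by
    intro X Y hX hY
    have h1 := (CovariantDerivative.torsion_eq_zero_iff D).1 hD.torsion_eq_zero hX.diffField
      hY.diffField
    exact h1.symm
  rw [CVectorField.val, CVectorField.val, CVectorField.val, CVectorField.cov_cvec,
    CVectorField.cov_cvec, cvec_sub, CVectorField.bracket]
  simp only [hb (hX.re_at hW hx) (hY.re_at hW hx), hb (hX.re_at hW hx) (hY.im_at hW hx),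
    hb (hX.im_at hW hx) (hY.re_at hW hx), hb (hX.im_at hW hx) (hY.im_at hW hx)]
  congr 1 <;> abel

theorem smoothFieldOn_extend {x : M} (a : TangentSpace I x) :
    SmoothFieldOn (FiberBundle.extend E (E := fun y : M => TangentSpace I y) a)
      (trivializationAt E (fun y : M => TangentSpace I y) x).baseSet := by
  set t := trivializationAt E (fun y : M => TangentSpace I y) x
  intro y hy
  rw [t.contMDiffWithinAt_section _ hy]
  have : ContMDiffOn I 𝓘(ℝ, E) ∞ (fun _ : M => (t ⟨x, a⟩).2) t.baseSet := contMDiffOn_const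
  exact this.congr (fun z hz => by
    have h := congrArg Prod.snd (t.apply_mk_symm hz (t ⟨x, a⟩).2)
    exact h) y hy

section Structure

variable {s : ∀ y : M, EndFibre I y}

/-- Differentiate FY = -iY: (D_z F)Y = D_z(FY) - F D_z Y = -(F + i) D_z Y. This converts statements
about DF into statements about derivatives of sections. -/
theorem evalC_nablaEnd {x : M} (hs : SmoothEndAt s x) {Y : CVectorField I M} {W : Set M}
    (hW : IsOpen W) (hY : Y.IsSectionOn (fun y => eigen (s y) (-Complex.I)) W) (hx : x ∈ W)
    (z : CTangent I x) :
    evalC (ContinuousLinearMap.coeLM ℝ) (Y.val x) ((nablaEndₗ D hs.diffEnd).baseChange ℂ z) =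
      -((s x).toLinearMap.baseChange ℂ (Y.cov D x z) + Complex.I • Y.cov D x z) := by
  have hre := (hY.re_at hW hx).diffField
  have him := (hY.im_at hW hx).diffField
  have hsm : ∀ y ∈ W, s y (Y.re y) = Y.im y ∧ s y (Y.im y) = -Y.re y := fun y hy =>
    (eigen_cvec _ _ _).1 (hY.mem y hy)
  have h1 : D (fun y => s y (Y.re y)) x = D Y.im x := by
    refine cov_congr D (hs.diffEnd.apply hre) ?_
    filter_upwards [hW.mem_nhds hx] with y hy using (hsm y hy).1
  have h2 : D (fun y => s y (Y.im y)) x = -D Y.re x := by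
    have h3 : D (fun y => s y (Y.im y)) x = D ((-1 : ℝ) • Y.re) x := by
      refine cov_congr D (hs.diffEnd.apply him) ?_
      filter_upwards [hW.mem_nhds hx] with y hy
      rw [(hsm y hy).2]
      simp
    rw [h3, D.isCovariantDerivativeOn.smul_const (-1 : ℝ) hre]
    simp
  have hNre : ∀ v, nablaEnd D hs.diffEnd v (Y.re x) = D Y.im x v - s x (D Y.re x v) := fun v => by
    rw [nablaEnd_apply D hs.diffEnd v hre, h1]
  have hNim : ∀ v, nablaEnd D hs.diffEnd v (Y.im x) = -D Y.re x v - s x (D Y.im x v) := fun v => by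
    rw [nablaEnd_apply D hs.diffEnd v him, h2]
    rfl
  obtain ⟨u, w, rfl⟩ : ∃ u w, z = cvec u w := ⟨_, _, (cvec_eta z).symm⟩
  rw [baseChange_cvec', evalC_cvec, CVectorField.cov_cvec, CVectorField.val, baseChange_cvec',
    baseChange_cvec', baseChange_cvec', I_smul_cvec, I_smul_cvec, cvec_add, cvec_add, cvec_neg]
  change cvec (nablaEnd D hs.diffEnd u (Y.re x) + -nablaEnd D hs.diffEnd w (Y.im x))
    (nablaEnd D hs.diffEnd u (Y.im x) + nablaEnd D hs.diffEnd w (Y.re x)) =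
    cvec (-(s x _ + _)) (-(s x _ + _))
  rw [hNre, hNre, hNim, hNim, map_sub, map_add]
  congr 1 <;> abel

/-- Every vector in the eigenspace of an `f`-structure corresponding to `-i` is the value of a
section. -/
theorem exists_section_eigen (hs : ContMDiff I (endModel I) ∞ (fun y => (⟨y, s y⟩ : EndBundle I M)))
    (h3 : ∀ y v, s y (s y (s y v)) = -s y v) (x : M) :
    ∃ W : Set M, IsOpen W ∧ x ∈ W ∧ ∀ z ∈ eigen (s x) (-Complex.I), ∃ Y : CVectorField I M,
      Y.IsSectionOn (fun y => eigen (s y) (-Complex.I)) W ∧ Y.val x = z := by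
  let e := trivializationAt E (fun y : M => TangentSpace I y) x
  refine ⟨e.baseSet, e.open_baseSet, FiberBundle.mem_baseSet_trivializationAt' x, fun z hz => ?_⟩
  obtain ⟨a, b, rfl⟩ : ∃ u w, z = cvec u w := ⟨_, _, (cvec_eta z).symm⟩
  let A := FiberBundle.extend E (E := fun y : M => TangentSpace I y) a
  let B := FiberBundle.extend E (E := fun y : M => TangentSpace I y) b
  have hA : SmoothFieldOn A e.baseSet := smoothFieldOn_extend a
  have hB : SmoothFieldOn B e.baseSet := smoothFieldOn_extend b
  have hAx : A x = a := FiberBundle.extend_apply_self _ _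
  have hBx : B x = b := FiberBundle.extend_apply_self _ _
  have hs' := hs.contMDiffOn (s := e.baseSet)
  have hsA := smoothEnd_apply hs' hA
  have hsB := smoothEnd_apply hs' hB
  have hssA := smoothEnd_apply hs' hsA
  have hssB := smoothEnd_apply hs' hsB
  -- These are the real and imaginary parts of (iF - F²)/2 applied to A + iB, that is, of the
  -- projection onto the -i-eigenspace.
  refine ⟨⟨fun y => (-(1 / 2) : ℝ) • (s y (s y (A y)) + s y (B y)),
    fun y => (1 / 2 : ℝ) • (s y (A y) - s y (s y (B y)))⟩, ⟨⟨?_, ?_⟩, fun y _ => ?_⟩, ?_⟩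
  · exact (hssA.add_section hsB).const_smul_section
  · exact (hsA.sub_section hssB).const_smul_section
  · refine (eigen_cvec _ _ _).2 ⟨?_, ?_⟩
    · change s y ((-(1 / 2) : ℝ) • (s y (s y (A y)) + s y (B y))) =
        (1 / 2 : ℝ) • (s y (A y) - s y (s y (B y)))
      rw [map_smul, map_add, h3]
      module
    · change s y ((1 / 2 : ℝ) • (s y (A y) - s y (s y (B y)))) =
        -((-(1 / 2) : ℝ) • (s y (s y (A y)) + s y (B y)))
      rw [map_smul, map_sub, h3]
      module
  · obtain ⟨e1, e2⟩ := (eigen_cvec _ _ _).1 hz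
    change s x a = b at e1
    change s x b = -a at e2
    change cvec ((-(1 / 2) : ℝ) • (s x (s x (A x)) + s x (B x)))
      ((1 / 2 : ℝ) • (s x (A x) - s x (s x (B x)))) = _
    rw [hAx, hBx, e1, e2, map_neg, e1]
    congr 1 <;> module

theorem exists_section_kernel (hs : ContMDiff I (endModel I) ∞ (fun y => (⟨y, s y⟩ : EndBundle I M)))
    (h3 : ∀ y v, s y (s y (s y v)) = -s y v) (x : M) :
    ∃ W : Set M, IsOpen W ∧ x ∈ W ∧ ∀ z ∈ eigen (s x) 0, ∃ Y : CVectorField I M,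
      Y.IsSectionOn (fun y => eigen (s y) 0) W ∧ Y.val x = z := by
  let e := trivializationAt E (fun y : M => TangentSpace I y) x
  refine ⟨e.baseSet, e.open_baseSet, FiberBundle.mem_baseSet_trivializationAt' x, fun z hz => ?_⟩
  obtain ⟨a, b, rfl⟩ : ∃ u w, z = cvec u w := ⟨_, _, (cvec_eta z).symm⟩
  let A := FiberBundle.extend E (E := fun y : M => TangentSpace I y) a
  let B := FiberBundle.extend E (E := fun y : M => TangentSpace I y) b
  have hA : SmoothFieldOn A e.baseSet := smoothFieldOn_extend a
  have hB : SmoothFieldOn B e.baseSet := smoothFieldOn_extend b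
  have hAx : A x = a := FiberBundle.extend_apply_self _ _
  have hBx : B x = b := FiberBundle.extend_apply_self _ _
  have hs' := hs.contMDiffOn (s := e.baseSet)
  have hssA := smoothEnd_apply hs' (smoothEnd_apply hs' hA)
  have hssB := smoothEnd_apply hs' (smoothEnd_apply hs' hB)
  -- The operator 1 + F² is the projection onto the kernel of F.
  refine ⟨⟨fun y => A y + s y (s y (A y)), fun y => B y + s y (s y (B y))⟩,
    ⟨⟨hA.add_section hssA, hB.add_section hssB⟩, fun y _ => (eigen_zero_cvec _ _ _).2 ⟨?_, ?_⟩⟩, ?_⟩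
  · change s y (A y + s y (s y (A y))) = 0
    rw [map_add, h3, add_neg_cancel]
  · change s y (B y + s y (s y (B y))) = 0
    rw [map_add, h3, add_neg_cancel]
  · obtain ⟨e1, e2⟩ := (eigen_zero_cvec _ _ _).1 hz
    change s x a = 0 at e1
    change s x b = 0 at e2
    change cvec (A x + s x (s x (A x))) (B x + s x (s x (B x))) = _
    rw [hAx, hBx, e1, e2, map_zero, add_zero, add_zero]

/-- The vector (F + i) D_z Y lies both in p and in the image of F + i, hence vanishes. -/
theorem PreservesType.cov_mem {x : M} (hs : SmoothEndAt s x) (h : PreservesType D hs.diffEnd)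
    (h3 : ∀ y v, s y (s y (s y v)) = -s y v) {Y : CVectorField I M} {W : Set M}
    (hW : IsOpen W) (hY : Y.IsSectionOn (fun y => eigen (s y) (-Complex.I)) W) (hx : x ∈ W)
    {z : CTangent I x} (hz : z ∈ fDistribution s x) : Y.cov D x z ∈ eigen (s x) (-Complex.I) := by
  have h1 := h z hz _ (hY.mem x hx)
  rw [evalC_nablaEnd hs hW hY hx, Submodule.neg_mem_iff] at h1
  have h2 := eigen_of_add_mem (f := (s x).toLinearMap.baseChange ℂ) (fun z => by
    rw [← cvec_eta z, baseChange_cvec', baseChange_cvec', baseChange_cvec', cvec_neg]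
    exact congrArg₂ cvec (h3 x _) (h3 x _)) h1
  rw [eigen, Module.End.mem_eigenspace_iff, neg_smul]
  exact eq_neg_of_add_eq_zero_left h2

theorem preservesType_of_cov_mem {x : M} (hs : SmoothEndAt s x) {W : Set M}
    (hW : IsOpen W) (hx : x ∈ W)
    (hsec : ∀ z ∈ eigen (s x) (-Complex.I), ∃ Y : CVectorField I M,
      Y.IsSectionOn (fun y => eigen (s y) (-Complex.I)) W ∧ Y.val x = z)
    (h : ∀ Y : CVectorField I M, Y.IsSectionOn (fun y => eigen (s y) (-Complex.I)) W →
      ∀ z ∈ fDistribution s x, Y.cov D x z ∈ eigen (s x) (-Complex.I)) :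
    PreservesType D hs.diffEnd := by
  rintro z hz y hy
  obtain ⟨Y, hY, rfl⟩ := hsec y hy
  rw [evalC_nablaEnd hs hW hY hx, Submodule.neg_mem_iff]
  have h1 := h Y hY z hz
  refine Submodule.add_mem _ ?_ (Submodule.smul_mem _ _ h1)
  rw [Module.End.mem_eigenspace_iff.1 h1]
  exact Submodule.smul_mem _ _ h1

end Structure

end Calculus

/-! ### Consequences of the holomorphy condition: integrability and the properties of the
submersion. -/

section Integrability

variable {E : Type*} [NormedAddCommGroup E] [NormedSpace ℝ E] [FiniteDimensional ℝ E]
  {H : Type*} [TopologicalSpace H] {I : ModelWithCorners ℝ E H}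
  {M : Type*} [TopologicalSpace M] [ChartedSpace H M] [IsManifold I ∞ M]
  {D : CovariantDerivative I E (TangentSpace I : M → Type _)}
  {c : ConformalStructure I M} {s : ∀ y : M, EndFibre I y}

/-- The complex bilinear extension of a Riemannian metric. -/
noncomputable abbrev cform (g : ContMDiffRiemannianMetric I ∞ E (fun x : M => TangentSpace I x))
    (x : M) : LinearMap.BilinForm ℂ (CTangent I x) :=
  LinearMap.BilinForm.baseChange ℂ (g.inner x).toBilinForm

theorem cube_complex (h3 : ∀ y v, s y (s y (s y v)) = -s y v) (x : M) (z : CTangent I x) :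
    (s x).toLinearMap.baseChange ℂ ((s x).toLinearMap.baseChange ℂ
      ((s x).toLinearMap.baseChange ℂ z)) = -(s x).toLinearMap.baseChange ℂ z := by
  rw [← cvec_eta z, baseChange_cvec', baseChange_cvec', baseChange_cvec', cvec_neg]
  exact congrArg₂ cvec (h3 x _) (h3 x _)

theorem cform_eigen (hsk : ∀ y, c.IsSkew (s y))
    {g : ContMDiffRiemannianMetric I ∞ E (fun x : M => TangentSpace I x)} (hg : g ∈ c.metrics)
    {x : M} {z w : CTangent I x} (hz : z ∈ eigen (s x) (-Complex.I)) (hw : w ∈ fDistribution s x) :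
    cform g x z w = 0 :=
  form_eigen_fDistribution (g := (g.inner x).toBilinForm) (F := (s x).toLinearMap)
    (g.symm x) (hsk x g hg) hz hw

theorem mem_eigen_of_cform (hsk : ∀ y, c.IsSkew (s y)) (h3 : ∀ y v, s y (s y (s y v)) = -s y v)
    {g : ContMDiffRiemannianMetric I ∞ E (fun x : M => TangentSpace I x)} (hg : g ∈ c.metrics)
    {x : M} {z : CTangent I x} (hz : ∀ w ∈ fDistribution s x, cform g x z w = 0) :
    z ∈ eigen (s x) (-Complex.I) :=
  mem_eigen_of_form_eq_zero (g := (g.inner x).toBilinForm) (F := (s x).toLinearMap)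
    (g.pos x) (hsk x g hg) (h3 x) hz

theorem mem_fDistribution_of_cform (hsk : ∀ y, c.IsSkew (s y))
    (h3 : ∀ y v, s y (s y (s y v)) = -s y v)
    {g : ContMDiffRiemannianMetric I ∞ E (fun x : M => TangentSpace I x)} (hg : g ∈ c.metrics)
    {x : M} {z : CTangent I x} (hz : ∀ w ∈ eigen (s x) (-Complex.I), cform g x z w = 0) :
    z ∈ fDistribution s x :=
  mem_fDistribution_of_form_eq_zero (g := (g.inner x).toBilinForm) (F := (s x).toLinearMap)
    (g.pos x) (hsk x g hg) (h3 x) hz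

theorem cform_symm (g : ContMDiffRiemannianMetric I ∞ E (fun x : M => TangentSpace I x))
    {x : M} (z w : CTangent I x) : cform g x z w = cform g x w z :=
  form_symm (g.symm x) z w

/-- The dual of the preservation of p: differentiate the orthogonality of Z to sections of p, and
use that the complement of p is T⁰ ⊕ p. -/
theorem PreservesType.cov_mem_fDistribution (hD : c.IsWeylConnection D)
    (hs : ContMDiff I (endModel I) ∞ (fun y => (⟨y, s y⟩ : EndBundle I M)))
    (hsk : ∀ y, c.IsSkew (s y)) (h3 : ∀ y v, s y (s y (s y v)) = -s y v)
    (h : ∀ x, PreservesType D (SmoothEndAt.diffEnd (hs x)))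
    {Z : CVectorField I M} {W : Set M} (hW : IsOpen W) (hZ : Z.IsSectionOn (fDistribution s) W)
    {x : M} (hx : x ∈ W) {z : CTangent I x} (hz : z ∈ fDistribution s x) :
    Z.cov D x z ∈ fDistribution s x := by
  obtain ⟨g, hg⟩ := c.nonempty
  refine mem_fDistribution_of_cform hsk h3 hg fun w hw => ?_
  obtain ⟨W', hW', hxW', hsec⟩ := exists_section_eigen hs h3 x
  obtain ⟨Y, hY, rfl⟩ := hsec w hw
  have h1 := form_cov_add hD hg (hW.inter hW') (hZ.subset Set.inter_subset_left)
    (hY.subset Set.inter_subset_right) (fun y hy => by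
      rw [form_symm (g.symm y)]
      exact cform_eigen hsk hg (hY.mem y hy.2) (hZ.mem y hy.1)) ⟨hx, hxW'⟩ z
  have h2 : cform g x (Z.val x) (Y.cov D x z) = 0 := by
    rw [cform_symm]
    exact cform_eigen hsk hg ((h x).cov_mem (hs x) h3 hW' hY hxW' hz) (hZ.mem x hx)
  rw [h2, add_zero] at h1
  exact h1

theorem isIntegrable_of_preservesType (hD : c.IsWeylConnection D)
    (hs : ContMDiff I (endModel I) ∞ (fun y => (⟨y, s y⟩ : EndBundle I M)))
    (hsk : ∀ y, c.IsSkew (s y)) (h3 : ∀ y v, s y (s y (s y v)) = -s y v)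
    (h : ∀ x, PreservesType D (SmoothEndAt.diffEnd (hs x))) : IsIntegrable (fDistribution s) := by
  intro U hU X Y hX hY hXm hYm x hx
  have hX' : X.IsSectionOn (fDistribution s) U := ⟨hX, hXm⟩
  have hY' : Y.IsSectionOn (fDistribution s) U := ⟨hY, hYm⟩
  rw [bracket_val hD hU hX' hY' hx]
  exact Submodule.sub_mem _
    (PreservesType.cov_mem_fDistribution hD hs hsk h3 h hU hY' hx (hXm x hx))
    (PreservesType.cov_mem_fDistribution hD hs hsk h3 h hU hX' hx (hYm x hx))

section Submersion

variable {EN : Type*} [NormedAddCommGroup EN] [NormedSpace ℝ EN]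
  {HN : Type*} [TopologicalSpace HN] {IN : ModelWithCorners ℝ EN HN}
  {N : Type*} [TopologicalSpace N] [ChartedSpace HN N] [IsManifold IN ∞ N]
  {φ : M → N} {U : Set M} {J : ∀ y : N, EndFibre IN y}

theorem eigen_le_fDistribution (x : M) : eigen (s x) (-Complex.I) ≤ fDistribution s x := le_sup_right

theorem kernel_le_fDistribution (x : M) : eigen (s x) 0 ≤ fDistribution s x := le_sup_left

omit [IsManifold IN ∞ N] in
theorem fDistribution_of_sq (hJ : ∀ x v, J x (J x v) = -v) (y : N) :
    fDistribution J y = eigen (J y) (-Complex.I) := by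
  rw [fDistribution, sup_eq_right]
  intro z hz
  obtain ⟨a, b, rfl⟩ : ∃ u w, z = cvec u w := ⟨_, _, (cvec_eta z).symm⟩
  obtain ⟨e1, e2⟩ := (eigen_zero_cvec _ _ _).1 hz
  have : ∀ v : TangentSpace IN y, J y v = 0 → v = 0 := by
    intro v hv
    have := hJ y v
    rw [hv, map_zero] at this
    exact neg_eq_zero.1 this.symm
  rw [this a e1, this b e2, cvec_zero]
  exact Submodule.zero_mem _

/-- Holomorphy applied to Fv + iF²v, which is of type (0,1), gives the relation on the range of F.
An arbitrary u differs from -F²u by an element of ker F, which dφ kills. -/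
theorem IsDefinedBy.mfderiv_comm (h : IsDefinedBy s φ U J) (hJ : ∀ x v, J x (J x v) = -v)
    (h3 : ∀ y v, s y (s y (s y v)) = -s y v) {x : M} (hx : x ∈ U) (u : TangentSpace I x) :
    mfderiv I IN φ x (s x u) = J (φ x) (mfderiv I IN φ x u) := by
  obtain ⟨-, -, hhol, hker⟩ := h
  have h1 : ∀ v : TangentSpace I x, s x v = 0 → mfderiv I IN φ x v = 0 := fun v hv => by
    have : v ∈ LinearMap.ker (mfderiv I IN φ x).toLinearMap := by
      rw [hker x hx]
      exact hv
    exact this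
  have h2 : ∀ v, J (φ x) (mfderiv I IN φ x (s x v)) = mfderiv I IN φ x (s x (s x v)) := by
    intro v
    have h4 : cvec (s x v) (s x (s x v)) ∈ eigen (s x) (-Complex.I) :=
      (eigen_cvec _ _ _).2 ⟨rfl, h3 x v⟩
    have h5 := hhol x hx ⟨_, eigen_le_fDistribution x h4, rfl⟩
    change _ ∈ fDistribution J (φ x) at h5
    rw [fDistribution_of_sq hJ, cdiff, baseChange_cvec'] at h5
    exact ((eigen_cvec _ _ _).1 h5).1
  have h6 : mfderiv I IN φ x u = -mfderiv I IN φ x (s x (s x u)) := by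
    rw [eq_neg_iff_add_eq_zero, ← map_add]
    apply h1
    rw [map_add, h3, add_neg_cancel]
  rw [h6, map_neg, h2, h3, map_neg, neg_neg]

theorem IsDefinedBy.cdiff_comm (h : IsDefinedBy s φ U J) (hJ : ∀ x v, J x (J x v) = -v)
    (h3 : ∀ y v, s y (s y (s y v)) = -s y v) {x : M} (hx : x ∈ U) (z : CTangent I x) :
    cdiff I IN φ x ((s x).toLinearMap.baseChange ℂ z) =
      (J (φ x)).toLinearMap.baseChange ℂ (cdiff I IN φ x z) := by
  obtain ⟨a, b, rfl⟩ : ∃ u w, z = cvec u w := ⟨_, _, (cvec_eta z).symm⟩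
  simp only [cdiff, baseChange_cvec']
  exact congrArg₂ cvec (h.mfderiv_comm hJ h3 hx a) (h.mfderiv_comm hJ h3 hx b)

theorem IsDefinedBy.cdiff_eq_zero_iff (h : IsDefinedBy s φ U J) {x : M} (hx : x ∈ U)
    (z : CTangent I x) : cdiff I IN φ x z = 0 ↔ z ∈ eigen (s x) 0 := by
  obtain ⟨-, -, -, hker⟩ := h
  have h1 : ∀ v : TangentSpace I x, mfderiv I IN φ x v = 0 ↔ s x v = 0 := fun v => by
    have : v ∈ LinearMap.ker (mfderiv I IN φ x).toLinearMap ↔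
      v ∈ LinearMap.ker (s x).toLinearMap := by rw [hker x hx]
    exact this
  obtain ⟨a, b, rfl⟩ : ∃ u w, z = cvec u w := ⟨_, _, (cvec_eta z).symm⟩
  rw [cdiff, baseChange_cvec', cvec_eq_zero_iff]
  exact (and_congr (h1 a) (h1 b)).trans (eigen_zero_cvec _ _ _).symm

/-- Horizontality gives F²z = -z, because 1 + F² is the orthogonal projection onto the kernel; there
the type of dφ(z) determines that of z. It is stated for both square roots of -1, so that the two
types are treated together. -/
theorem IsDefinedBy.horizontal_iff (h : IsDefinedBy s φ U J) (hJ : ∀ x v, J x (J x v) = -v)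
    (hsk : ∀ y, c.IsSkew (s y)) (h3 : ∀ y v, s y (s y (s y v)) = -s y v) {x : M} (hx : x ∈ U)
    {a : ℂ} (ha : a * a = -1) (z : CTangent I x) :
    (IsHorizontal IN c φ z ∧ cdiff I IN φ x z ∈ eigen (J (φ x)) a) ↔ z ∈ eigen (s x) a := by
  have hne : a ≠ 0 := by
    rintro rfl
    norm_num at ha
  set f := (s x).toLinearMap.baseChange ℂ with hf
  constructor
  · rintro ⟨hh, ht⟩
    obtain ⟨g, hg⟩ := c.nonempty
    have hff : f (f z) = -z := by
      rw [eq_neg_iff_add_eq_zero]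
      refine form_nondegenerate (g := (g.inner x).toBilinForm) (g.pos x) fun w => ?_
      have h1 := hh (f (f w) + w) (by
        rw [h.cdiff_eq_zero_iff hx, eigen, Module.End.mem_eigenspace_iff, zero_smul, map_add,
          cube_complex h3, neg_add_cancel]) g hg
      rw [form_symm (g.symm x)] at h1
      rw [map_add, LinearMap.add_apply, form_skew (hsk x g hg), form_skew (hsk x g hg), neg_neg,
        ← map_add]
      exact h1
    have h1 : f z - a • z ∈ eigen (s x) 0 := by
      rw [← h.cdiff_eq_zero_iff hx, map_sub, h.cdiff_comm hJ h3 hx, map_smul, sub_eq_zero]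
      exact Module.End.mem_eigenspace_iff.1 ht
    rw [eigen, Module.End.mem_eigenspace_iff, zero_smul, map_sub, map_smul, ← hf, hff] at h1
    rw [eigen, Module.End.mem_eigenspace_iff, ← hf]
    have h2 : a • (f z - a • z) = 0 := by
      rw [smul_sub, smul_smul, ha, ← neg_eq_zero, ← h1]
      module
    exact sub_eq_zero.1 ((smul_eq_zero.1 h2).resolve_left hne)
  · intro hz
    have hz' : f z = a • z := Module.End.mem_eigenspace_iff.1 hz
    refine ⟨fun w hw g hg => ?_, ?_⟩
    · rw [h.cdiff_eq_zero_iff hx, eigen, Module.End.mem_eigenspace_iff, zero_smul] at hw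
      have h1 := form_skew (g := (g.inner x).toBilinForm) (F := (s x).toLinearMap) (hsk x g hg) w z
      rw [hw, ← hf, hz', map_smul, map_zero, LinearMap.zero_apply, smul_eq_mul, eq_comm,
        neg_eq_zero] at h1
      exact (mul_eq_zero.1 h1).resolve_left hne
    · rw [eigen, Module.End.mem_eigenspace_iff, ← h.cdiff_comm hJ h3 hx, ← hf, hz', map_smul]

/-- A pulled back (1,0)-form annihilates T⁰ ⊕ p, so its dual vector is orthogonal to this space and
lies in the isotropic space p. -/
theorem IsDefinedBy.pseudoHorizontallyConformal (h : IsDefinedBy s φ U J)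
    (hJ : ∀ x v, J x (J x v) = -v) (hsk : ∀ y, c.IsSkew (s y))
    (h3 : ∀ y v, s y (s y (s y v)) = -s y v) : IsPseudoHorizontallyConformalOn c φ U J := by
  refine ⟨h.1, fun x hx θ hθ g hg z hz => ?_⟩
  have h1 : z ∈ eigen (s x) (-Complex.I) := by
    refine mem_eigen_of_cform hsk h3 hg fun w hw => ?_
    refine (hz w).trans ?_
    have h2 := h.2.2.1 x hx ⟨w, hw, rfl⟩
    change _ ∈ fDistribution J (φ x) at h2
    rw [fDistribution_of_sq hJ] at h2
    have h4 := LinearMap.congr_fun hθ (cdiff I IN φ x w)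
    rw [LinearMap.comp_apply, Module.End.mem_eigenspace_iff.1 h2, map_smul, LinearMap.smul_apply,
      smul_eq_mul, smul_eq_mul] at h4
    have h5 : (2 * Complex.I) * θ (cdiff I IN φ x w) = 0 := by linear_combination -h4
    exact (mul_eq_zero.1 h5).resolve_left (by simp)
  exact cform_eigen hsk hg h1 (eigen_le_fDistribution x h1)

/-- For vertical fields the derivative D_X Y is a real vector of T⁰ ⊕ p; applying F(F + i) and
taking the real part gives F² D_X Y = 0, hence F D_X Y = 0. -/
theorem IsDefinedBy.hasGeodesicFibres (h : IsDefinedBy s φ U J) (hD : c.IsWeylConnection D)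
    (hs : ContMDiff I (endModel I) ∞ (fun y => (⟨y, s y⟩ : EndBundle I M)))
    (hsk : ∀ y, c.IsSkew (s y)) (h3 : ∀ y v, s y (s y (s y v)) = -s y v)
    (hp : ∀ x, PreservesType D (SmoothEndAt.diffEnd (hs x))) : HasGeodesicFibresOn IN D φ U := by
  intro W hWU hW X Y hX hY hXm hYm x hx
  have hz : ∀ y ∈ W, ∀ v : TangentSpace I y, mfderiv I IN φ y v = 0 →
      cvec v 0 ∈ eigen (s y) 0 := fun y hy v hv => by
    rw [← h.cdiff_eq_zero_iff (hWU hy), cdiff, baseChange_cvec', map_zero]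
    exact cvec_eq_zero_iff.2 ⟨hv, rfl⟩
  have h0 : SmoothFieldOn (0 : ∀ y : M, TangentSpace I y) W :=
    ContMDiff.contMDiffOn (Bundle.contMDiff_zeroSection ℝ (fun y : M => TangentSpace I y))
  have hY' : CVectorField.IsSectionOn (⟨Y, 0⟩ : CVectorField I M) (fDistribution s) W :=
    ⟨⟨hY, h0⟩,
      fun y hy => kernel_le_fDistribution y (hz y hy _ (hYm y hy))⟩
  have h1 := PreservesType.cov_mem_fDistribution hD hs hsk h3 hp hW hY' hx
    (kernel_le_fDistribution x (hz x hx _ (hXm x hx)))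
  rw [CVectorField.cov_cvec] at h1
  have h2 : D (0 : ∀ y : M, TangentSpace I y) x = 0 := D.isCovariantDerivativeOn.zero
  rw [show D (⟨Y, 0⟩ : CVectorField I M).im x = 0 from h2, map_zero] at h1
  have h4 := ((mem_fDistribution_cvec _ _ _).1 h1).1
  have h5 : s x (s x (D Y x (X x))) = 0 := by
    have h8 : s x (s x (D Y x (X x) - 0)) = s x (D Y x 0 + 0) := h4
    simpa using h8
  have h6 : s x (D Y x (X x)) = 0 := by
    have := h3 x (D Y x (X x))
    rw [h5, map_zero] at this
    exact neg_eq_zero.1 this.symm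
  have h7 : D Y x (X x) ∈ LinearMap.ker (mfderiv I IN φ x).toLinearMap := by
    rw [h.2.2.2 x (hWU hx)]
    exact h6
  exact h7

/-- Complex conjugation carries the i-eigenspace to the -i-eigenspace and commutes with the real
connection. -/
theorem cov_mem_eigen_I {x : M} (hs : SmoothEndAt s x) (h : PreservesType D hs.diffEnd)
    (h3 : ∀ y v, s y (s y (s y v)) = -s y v) {Y : CVectorField I M} {W : Set M}
    (hW : IsOpen W) (hY : Y.IsSectionOn (fun y => eigen (s y) Complex.I) W) (hx : x ∈ W)
    {z : CTangent I x} (hz : z ∈ eigen (s x) Complex.I) : Y.cov D x z ∈ eigen (s x) Complex.I := by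
  have hconj : ∀ (y : M) (u v : TangentSpace I y), cvec u v ∈ eigen (s y) Complex.I ↔
      cvec u (-v) ∈ eigen (s y) (-Complex.I) := by
    intro y u v
    refine (eigen_I_cvec _ _ _).trans (Iff.trans ?_ (eigen_cvec _ _ _).symm)
    rw [map_neg, neg_inj]
  have hY' : CVectorField.IsSectionOn (⟨Y.re, (-1 : ℝ) • Y.im⟩ : CVectorField I M)
      (fun y => eigen (s y) (-Complex.I)) W :=
    ⟨⟨hY.smooth.1, hY.smooth.2.const_smul_section⟩, fun y hy => by
      have := (hconj y _ _).1 (hY.mem y hy)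
      simpa [CVectorField.val] using this⟩
  obtain ⟨u, v, rfl⟩ : ∃ u w, z = cvec u w := ⟨_, _, (cvec_eta z).symm⟩
  have h1 := h.cov_mem hs h3 hW hY' hx (eigen_le_fDistribution x ((hconj x u v).1 hz))
  rw [CVectorField.cov_cvec] at h1 ⊢
  rw [hconj]
  have h2 := D.isCovariantDerivativeOn.smul_const (-1 : ℝ) (hY.im_at hW hx).diffField
  change cvec (D Y.re x u - D ((-1 : ℝ) • Y.im) x (-v))
    (D Y.re x (-v) + D ((-1 : ℝ) • Y.im) x u) ∈ _ at h1
  rw [h2] at h1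
  convert h1 using 2
  · simp
  · simp
    abel

theorem IsDefinedBy.hasOneOneIntegrabilityTensor (h : IsDefinedBy s φ U J)
    (hJ : ∀ x v, J x (J x v) = -v) (hD : c.IsWeylConnection D)
    (hs : ContMDiff I (endModel I) ∞ (fun y => (⟨y, s y⟩ : EndBundle I M)))
    (hsk : ∀ y, c.IsSkew (s y)) (h3 : ∀ y v, s y (s y (s y v)) = -s y v)
    (hp : ∀ x, PreservesType D (SmoothEndAt.diffEnd (hs x))) :
    HasOneOneIntegrabilityTensorOn c φ U J := by
  intro a ha W hWU hW X Y hX hY hXm hYm x hx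
  have haa : a * a = -1 := by
    rcases ha with rfl | rfl
    · exact Complex.I_mul_I
    · rw [neg_mul_neg, Complex.I_mul_I]
  have hX' : X.IsSectionOn (fun y => eigen (s y) a) W :=
    ⟨hX, fun y hy => (h.horizontal_iff hJ hsk h3 (hWU hy) haa _).1 (hXm y hy)⟩
  have hY' : Y.IsSectionOn (fun y => eigen (s y) a) W :=
    ⟨hY, fun y hy => (h.horizontal_iff hJ hsk h3 (hWU hy) haa _).1 (hYm y hy)⟩
  suffices hb : (X.bracket Y).val x ∈ eigen (s x) a from
    ((h.horizontal_iff hJ hsk h3 (hWU hx) haa _).2 hb).1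
  rw [bracket_val hD hW hX' hY' hx]
  rcases ha with rfl | rfl
  · exact Submodule.sub_mem _ (cov_mem_eigen_I (hs x) (hp x) h3 hW hY' hx (hX'.mem x hx))
      (cov_mem_eigen_I (hs x) (hp x) h3 hW hX' hx (hY'.mem x hx))
  · exact Submodule.sub_mem _
      ((hp x).cov_mem (hs x) h3 hW hY' hx (eigen_le_fDistribution x (hX'.mem x hx)))
      ((hp x).cov_mem (hs x) h3 hW hX' hx (eigen_le_fDistribution x (hY'.mem x hx)))

end Submersion

end Integrability

/-! ### From the submersion back to the covariant derivative. -/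

section Converse

variable {E : Type*} [NormedAddCommGroup E] [NormedSpace ℝ E] [FiniteDimensional ℝ E]
  {H : Type*} [TopologicalSpace H] {I : ModelWithCorners ℝ E H}
  {M : Type*} [TopologicalSpace M] [ChartedSpace H M] [IsManifold I ∞ M]
  {D : CovariantDerivative I E (TangentSpace I : M → Type _)}
  {c : ConformalStructure I M} {s : ∀ y : M, EndFibre I y}
  {EN : Type*} [NormedAddCommGroup EN] [NormedSpace ℝ EN]
  {HN : Type*} [TopologicalSpace HN] {IN : ModelWithCorners ℝ EN HN}
  {N : Type*} [TopologicalSpace N] [ChartedSpace HN N] [IsManifold IN ∞ N]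
  {φ : M → N} {U : Set M} {J : ∀ y : N, EndFibre IN y}

theorem cov_kernel_mem (h : IsDefinedBy s φ U J) (hgeo : HasGeodesicFibresOn IN D φ U)
    {W : Set M} (hW : IsOpen W) (hWU : W ⊆ U) {V V' : CVectorField I M}
    (hV : V.IsSectionOn (fun y => eigen (s y) 0) W)
    (hV' : V'.IsSectionOn (fun y => eigen (s y) 0) W) {x : M} (hx : x ∈ W) :
    V.cov D x (V'.val x) ∈ eigen (s x) 0 := by
  have hm : ∀ {Z : CVectorField I M}, Z.IsSectionOn (fun y => eigen (s y) 0) W → ∀ y ∈ W,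
      mfderiv I IN φ y (Z.re y) = 0 ∧ mfderiv I IN φ y (Z.im y) = 0 := by
    intro Z hZ y hy
    have h1 := (h.cdiff_eq_zero_iff (hWU hy) _).2 (hZ.mem y hy)
    rw [CVectorField.val, cdiff, baseChange_cvec'] at h1
    exact cvec_eq_zero_iff.1 h1
  have hg : ∀ {X Y : ∀ y : M, TangentSpace I y}, SmoothFieldOn X W → SmoothFieldOn Y W →
      (∀ y ∈ W, mfderiv I IN φ y (X y) = 0) → (∀ y ∈ W, mfderiv I IN φ y (Y y) = 0) →
      mfderiv I IN φ x (D Y x (X x)) = 0 := fun hX hY hXm hYm =>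
    hgeo W hWU hW _ _ hX hY hXm hYm x hx
  rw [← h.cdiff_eq_zero_iff (hWU hx), CVectorField.val, CVectorField.cov_cvec, cdiff,
    baseChange_cvec', cvec_eq_zero_iff]
  have h1 := hg hV'.smooth.1 hV.smooth.1 (fun y hy => (hm hV' y hy).1) fun y hy => (hm hV y hy).1
  have h2 := hg hV'.smooth.2 hV.smooth.2 (fun y hy => (hm hV' y hy).2) fun y hy => (hm hV y hy).2
  have h3 := hg hV'.smooth.2 hV.smooth.1 (fun y hy => (hm hV' y hy).2) fun y hy => (hm hV y hy).1
  have h4 := hg hV'.smooth.1 hV.smooth.2 (fun y hy => (hm hV' y hy).1) fun y hy => (hm hV y hy).2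
  constructor
  · exact (map_sub (mfderiv I IN φ x) _ _).trans (by rw [h1, h2, sub_zero])
  · exact (map_add (mfderiv I IN φ x) _ _).trans (by rw [h3, h4, add_zero])

/-- An integrable `f`-structure which is locally defined by a pseudo horizontally conformal
submersion with geodesic fibres and integrability tensor of degree `(1,1)` is parallel, up to type,
along its complex distribution. -/
theorem preservesType_of_submersion (hD : c.IsWeylConnection D)
    (hs : ContMDiff I (endModel I) ∞ (fun y => (⟨y, s y⟩ : EndBundle I M)))
    (hsk : ∀ y, c.IsSkew (s y)) (h3 : ∀ y v, s y (s y (s y v)) = -s y v)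
    (hint : IsIntegrable (fDistribution s)) (hU : IsOpen U) (hJ : ∀ x v, J x (J x v) = -v)
    (h : IsDefinedBy s φ U J) (hgeo : HasGeodesicFibresOn IN D φ U)
    (hone : HasOneOneIntegrabilityTensorOn c φ U J) {x : M} (hx : x ∈ U) :
    PreservesType D (SmoothEndAt.diffEnd (hs x)) := by
  obtain ⟨g, hg⟩ := c.nonempty
  obtain ⟨W₁, hW₁, hxW₁, hsecP⟩ := exists_section_eigen hs h3 x
  obtain ⟨W₂, hW₂, hxW₂, hsecK⟩ := exists_section_kernel hs h3 x
  let W := U ∩ (W₁ ∩ W₂)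
  have hW : IsOpen W := hU.inter (hW₁.inter hW₂)
  have hxW : x ∈ W := ⟨hx, hxW₁, hxW₂⟩
  have hWU : W ⊆ U := Set.inter_subset_left
  have secP : ∀ z ∈ eigen (s x) (-Complex.I), ∃ Y : CVectorField I M,
      Y.IsSectionOn (fun y => eigen (s y) (-Complex.I)) W ∧ Y.val x = z := fun z hz => by
    obtain ⟨Y, hY, h1⟩ := hsecP z hz
    exact ⟨Y, hY.subset fun y hy => hy.2.1, h1⟩
  have secK : ∀ z ∈ eigen (s x) 0, ∃ Y : CVectorField I M,
      Y.IsSectionOn (fun y => eigen (s y) 0) W ∧ Y.val x = z := fun z hz => by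
    obtain ⟨Y, hY, h1⟩ := hsecK z hz
    exact ⟨Y, hY.subset fun y hy => hy.2.2, h1⟩
  let ΓP : CVectorField I M → Prop := fun Y => Y.IsSectionOn (fun y => eigen (s y) (-Complex.I)) W
  let ΓK : CVectorField I M → Prop := fun Y => Y.IsSectionOn (fun y => eigen (s y) 0) W
  let ΓF : CVectorField I M → Prop := fun Y => Y.IsSectionOn (fDistribution s) W
  have PF : ∀ {Y}, ΓP Y → ΓF Y := fun hY => hY.mono eigen_le_fDistribution
  have KF : ∀ {Y}, ΓK Y → ΓF Y := fun hY => hY.mono kernel_le_fDistribution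
  let G : CTangent I x → CTangent I x → ℂ := fun z w => cform g x z w
  let dv : CVectorField I M → CVectorField I M → CTangent I x := fun X Y => Y.cov D x (X.val x)
  have G_symm : ∀ z w, G z w = G w z := cform_symm g
  have G_sub : ∀ z w w', G z (w - w') = G z w - G z w' := fun z w w' => map_sub _ _ _
  have skew : ∀ {Y Z X : CVectorField I M}, ΓP Y → ΓF Z →
      G (dv X Y) (Z.val x) = -G (Y.val x) (dv X Z) := by
    intro Y Z X hY hZ
    exact eq_neg_of_add_eq_zero_left (form_cov_add hD hg hW hY hZ (fun y hy =>
      cform_eigen hsk hg (hY.mem y hy) (hZ.mem y hy)) hxW _)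
  -- By integrability the bracket D_X Y - D_Y X is in T⁰ ⊕ p, which is orthogonal to Z.
  have invol : ∀ {X Y Z : CVectorField I M}, ΓF X → ΓF Y → ΓP Z →
      G (Z.val x) (dv X Y) = G (Z.val x) (dv Y X) := by
    intro X Y Z hX hY hZ
    have h1 := hint W hW X Y hX.smooth hY.smooth hX.mem hY.mem x hxW
    rw [bracket_val hD hW hX hY hxW] at h1
    rw [← sub_eq_zero, ← G_sub]
    exact cform_eigen hsk hg (hZ.mem x hxW) h1
  -- For X and Y of type (0,1) the condition on the integrability tensor makes the bracket
  -- horizontal, hence orthogonal to V.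
  have horiz : ∀ {X Y V : CVectorField I M}, ΓP X → ΓP Y → ΓK V →
      G (V.val x) (dv X Y) = G (V.val x) (dv Y X) := by
    intro X Y V hX hY hV
    have hI : -Complex.I * -Complex.I = -1 := by rw [neg_mul_neg, Complex.I_mul_I]
    have h1 := hone (-Complex.I) (Or.inr rfl) W hWU hW X Y hX.smooth hY.smooth
      (fun y hy => (h.horizontal_iff hJ hsk h3 (hWU hy) hI _).2 (hX.mem y hy))
      (fun y hy => (h.horizontal_iff hJ hsk h3 (hWU hy) hI _).2 (hY.mem y hy)) x hxW
      (V.val x) ((h.cdiff_eq_zero_iff hx _).2 (hV.mem x hxW)) g hg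
    rw [bracket_val hD hW hX hY hxW] at h1
    rw [← sub_eq_zero, ← G_sub]
    exact h1
  -- A trilinear expression which is symmetric in its first two arguments and skew in its last two
  -- is zero.
  have ppp : ∀ {X Y Z : CVectorField I M}, ΓP X → ΓP Y → ΓP Z → G (dv X Y) (Z.val x) = 0 := by
    have sym : ∀ {X Y Z : CVectorField I M}, ΓP X → ΓP Y → ΓP Z →
        G (dv X Y) (Z.val x) = G (dv Y X) (Z.val x) := fun hX hY hZ => by
      rw [G_symm, invol (PF hX) (PF hY) hZ, G_symm]
    have alt : ∀ {X Y Z : CVectorField I M}, ΓP X → ΓP Y → ΓP Z →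
        G (dv X Y) (Z.val x) = -G (dv X Z) (Y.val x) := fun hX hY hZ => by
      rw [skew hY (PF hZ), G_symm]
    intro X Y Z hX hY hZ
    have e1 := alt hX hY hZ
    rw [sym hX hZ hY, alt hZ hX hY, sym hZ hY hX, alt hY hZ hX, sym hY hX hZ] at e1
    simp only [neg_neg] at e1
    exact self_eq_neg.1 e1
  -- As a function of X and Y, g(V, D_X Y) is symmetric by `horiz`. It is skew too: it equals -g(Y,
  -- D_X V) = -g(Y, D_V X), and g(Y, D_V X) changes sign when X and Y are exchanged.
  have ppk : ∀ {X Y V : CVectorField I M}, ΓP X → ΓP Y → ΓK V → G (dv X Y) (V.val x) = 0 := by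
    intro X Y V hX hY hV
    have e1 := skew (X := V) hX (PF hY)
    have e2 : G (X.val x) (dv Y V) = -G (Y.val x) (dv X V) := by
      rw [invol (PF hY) (KF hV) hX, invol (PF hX) (KF hV) hY, G_symm (Y.val x), e1, neg_neg]
    have e4 := horiz hX hY hV
    rw [G_symm, G_symm (V.val x), skew hY (KF hV), skew hX (KF hV), e2, neg_neg] at e4
    rw [skew hY (KF hV), neg_eq_zero]
    exact self_eq_neg.1 e4.symm
  have kpp : ∀ {X Y V : CVectorField I M}, ΓP X → ΓP Y → ΓK V → G (dv V X) (Y.val x) = 0 := by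
    intro X Y V hX hY hV
    rw [G_symm, invol (KF hV) (PF hX) hY, ← neg_eq_zero, ← skew hY (KF hV), ppk hX hY hV]
  -- Moving the derivative to V' gives a vertical vector, as the fibres are geodesic, and vertical
  -- vectors are orthogonal to p.
  have kpk : ∀ {X V V' : CVectorField I M}, ΓP X → ΓK V → ΓK V' → G (dv V X) (V'.val x) = 0 := by
    intro X V V' hX hV hV'
    rw [skew hX (KF hV'), neg_eq_zero]
    exact cform_eigen hsk hg (hX.mem x hxW)
      (kernel_le_fDistribution x (cov_kernel_mem h hgeo hW hWU hV' hV hxW))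
  refine preservesType_of_cov_mem (hs x) hW hxW secP fun Y hY z hz => ?_
  refine mem_eigen_of_cform hsk h3 hg fun w hw => ?_
  obtain ⟨z₀, hz₀, z₁, hz₁, rfl⟩ := Submodule.mem_sup.1 hz
  obtain ⟨w₀, hw₀, w₁, hw₁, rfl⟩ := Submodule.mem_sup.1 hw
  obtain ⟨V, hV, rfl⟩ := secK z₀ hz₀
  obtain ⟨X, hX, rfl⟩ := secP z₁ hz₁
  obtain ⟨V', hV', rfl⟩ := secK w₀ hw₀
  obtain ⟨Z, hZ, rfl⟩ := secP w₁ hw₁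
  rw [map_add, map_add, map_add, LinearMap.add_apply, LinearMap.add_apply]
  have a1 : cform g x (Y.cov D x (V.val x)) (V'.val x) = 0 := kpk hY hV hV'
  have a2 : cform g x (Y.cov D x (X.val x)) (V'.val x) = 0 := ppk hX hY hV'
  have a3 : cform g x (Y.cov D x (V.val x)) (Z.val x) = 0 := kpp hY hZ hV
  have a4 : cform g x (Y.cov D x (X.val x)) (Z.val x) = 0 := ppp hX hY hZ
  rw [a1, a2, a3, a4, add_zero, add_zero]

end Converse

/-! ### Fields of endomorphisms and brackets in local parametrizations. -/

section Param

variable {E : Type*} [NormedAddCommGroup E] [NormedSpace ℝ E] [FiniteDimensional ℝ E]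
  {H : Type*} [TopologicalSpace H] {I : ModelWithCorners ℝ E H}
  {M : Type*} [TopologicalSpace M] [ChartedSpace H M] [IsManifold I ∞ M]
  {E' : Type*} [NormedAddCommGroup E'] [NormedSpace ℝ E'] [FiniteDimensional ℝ E']

omit [FiniteDimensional ℝ E'] in
theorem bracket_vectorSpace (X Y : ∀ y : E', TangentSpace 𝓘(ℝ, E') y) :
    mlieBracket 𝓘(ℝ, E') X Y = lieBracket (E := E') ℝ X Y := by
  rw [← mlieBracketWithin_univ, mlieBracketWithin_eq_lieBracketWithin]
  exact lieBracketWithin_univ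

variable (I) in
/-- A smooth parametrization of an open subset of `M` by an open subset of a vector space. -/
structure IsSmoothParam (Φ : OpenPartialHomeomorph E' M) : Prop where
  smooth : ContMDiffOn 𝓘(ℝ, E') I ∞ Φ Φ.source
  smooth_symm : ContMDiffOn I 𝓘(ℝ, E') ∞ Φ.symm Φ.target

namespace IsSmoothParam

variable {Φ : OpenPartialHomeomorph E' M} (hΦ : IsSmoothParam I Φ)

include hΦ

theorem mdifferentiable : Φ.MDifferentiable 𝓘(ℝ, E') I :=
  ⟨hΦ.smooth.mdifferentiableOn (by simp), hΦ.smooth_symm.mdifferentiableOn (by simp)⟩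

theorem contMDiffAt {y : E'} (hy : y ∈ Φ.source) : ContMDiffAt 𝓘(ℝ, E') I ∞ Φ y :=
  hΦ.smooth.contMDiffAt (Φ.open_source.mem_nhds hy)

theorem contMDiffAt_symm {m : M} (hm : m ∈ Φ.target) : ContMDiffAt I 𝓘(ℝ, E') ∞ Φ.symm m :=
  hΦ.smooth_symm.contMDiffAt (Φ.open_target.mem_nhds hm)

theorem symm_deriv_apply {y : E'} (hy : y ∈ Φ.source) (w : E') :
    mfderiv I 𝓘(ℝ, E') Φ.symm (Φ y) (mfderiv 𝓘(ℝ, E') I Φ y w) = w :=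
  DFunLike.congr_fun (hΦ.mdifferentiable.symm_comp_deriv hy) w

theorem deriv_symm_apply {y : E'} (hy : y ∈ Φ.source) (v : TangentSpace I (Φ y)) :
    mfderiv 𝓘(ℝ, E') I Φ y (mfderiv I 𝓘(ℝ, E') Φ.symm (Φ y) v) = v := by
  have h := DFunLike.congr_fun (hΦ.mdifferentiable.comp_symm_deriv (Φ.map_source hy)) v
  rw [Φ.left_inv hy] at h
  exact h

theorem isInvertible_mfderiv {y : E'} (hy : y ∈ Φ.source) :
    (mfderiv 𝓘(ℝ, E') I Φ y).IsInvertible := ⟨hΦ.mdifferentiable.mfderiv hy, rfl⟩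

theorem isInvertible_mfderiv_symm {m : M} (hm : m ∈ Φ.target) :
    (mfderiv I 𝓘(ℝ, E') Φ.symm m).IsInvertible := ⟨hΦ.mdifferentiable.symm.mfderiv hm, rfl⟩

theorem inverse_symm_deriv {y : E'} (hy : y ∈ Φ.source) (w : E') :
    (mfderiv I 𝓘(ℝ, E') Φ.symm (Φ y)).inverse w = mfderiv 𝓘(ℝ, E') I Φ y w := by
  conv_lhs => rw [← hΦ.symm_deriv_apply hy w]
  exact (hΦ.isInvertible_mfderiv_symm (Φ.map_source hy)).inverse_apply_self _

theorem inverse_deriv {y : E'} (hy : y ∈ Φ.source) (v : TangentSpace I (Φ y)) :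
    (mfderiv 𝓘(ℝ, E') I Φ y).inverse v = mfderiv I 𝓘(ℝ, E') Φ.symm (Φ y) v := by
  conv_lhs => rw [← hΦ.deriv_symm_apply hy v]
  exact (hΦ.isInvertible_mfderiv hy).inverse_apply_self _

theorem deriv_injective {y : E'} (hy : y ∈ Φ.source) :
    Function.Injective (mfderiv 𝓘(ℝ, E') I Φ y) :=
  Function.LeftInverse.injective (hΦ.symm_deriv_apply hy)

omit hΦ in
variable (Φ) in
/-- The field of endomorphisms of the tangent bundle read in a parametrization. -/
noncomputable def _root_.FTwistor.endInParam (s : ∀ x : M, EndFibre I x) (y : E') : E' →L[ℝ] E' :=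
  (mfderiv 𝓘(ℝ, E') I Φ y).inverse ∘L s (Φ y) ∘L mfderiv 𝓘(ℝ, E') I Φ y

theorem deriv_endInParam (s : ∀ x : M, EndFibre I x) {y : E'} (hy : y ∈ Φ.source) (w : E') :
    mfderiv 𝓘(ℝ, E') I Φ y (endInParam Φ s y w) = s (Φ y) (mfderiv 𝓘(ℝ, E') I Φ y w) := by
  change mfderiv 𝓘(ℝ, E') I Φ y ((mfderiv 𝓘(ℝ, E') I Φ y).inverse (s (Φ y)
    (mfderiv 𝓘(ℝ, E') I Φ y w))) = _
  rw [hΦ.inverse_deriv hy, hΦ.deriv_symm_apply hy]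

theorem endInParam_cube {s : ∀ x : M, EndFibre I x} (h3 : ∀ y v, s y (s y (s y v)) = -s y v)
    {y : E'} (hy : y ∈ Φ.source) (w : E') :
    endInParam Φ s y (endInParam Φ s y (endInParam Φ s y w)) = -endInParam Φ s y w := by
  apply hΦ.deriv_injective hy
  rw [hΦ.deriv_endInParam s hy, hΦ.deriv_endInParam s hy, hΦ.deriv_endInParam s hy, h3]
  exact (congrArg Neg.neg (hΦ.deriv_endInParam s hy w)).symm.trans
    (map_neg (mfderiv 𝓘(ℝ, E') I Φ y) _).symm

/-- Smoothness is tested on constant vectors w: push w forward to M, apply s and pull back. Each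
step preserves smooth vector fields. -/
theorem contDiffOn_endInParam {s : ∀ x : M, EndFibre I x}
    (hs : ContMDiff I (endModel I) ∞ (fun y => (⟨y, s y⟩ : EndBundle I M))) :
    ContDiffOn ℝ ∞ (endInParam Φ s) Φ.source := by
  have : CompleteSpace E := FiniteDimensional.complete ℝ E
  have : CompleteSpace E' := FiniteDimensional.complete ℝ E'
  rw [contDiffOn_clm_apply]
  intro w y hy
  have h1 : ContMDiffAt 𝓘(ℝ, E') 𝓘(ℝ, E').tangent ∞
      (fun y => (⟨y, w⟩ : TangentBundle 𝓘(ℝ, E') E')) (Φ.symm (Φ y)) :=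
    contMDiffWithinAt_univ.1
      (contMDiffWithinAt_vectorSpace_iff_contDiffWithinAt.2 contDiffWithinAt_const)
  have h2 := h1.mpullback_vectorField_preimage (hΦ.contMDiffAt_symm (Φ.map_source hy))
    (hΦ.isInvertible_mfderiv_symm (Φ.map_source hy)) (m := ∞) (n := ∞) (by simp)
  have h4 := SmoothEndAt.apply (hs (Φ y)) h2
  have h5 := ContMDiffAt.mpullback_vectorField_preimage h4 (hΦ.contMDiffAt hy)
    (hΦ.isInvertible_mfderiv hy) (m := ∞) (n := ∞) (by simp)
  have h6 := contMDiffWithinAt_vectorSpace_iff_contDiffWithinAt.1 (contMDiffWithinAt_univ.2 h5)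
  refine (h6.mono (Set.subset_univ _)).congr_of_eventuallyEq_of_mem ?_ hy
  filter_upwards [self_mem_nhdsWithin] with z hz
  change (mfderiv 𝓘(ℝ, E') I Φ z).inverse (s (Φ z) (mfderiv 𝓘(ℝ, E') I Φ z w)) =
    (mfderiv 𝓘(ℝ, E') I Φ z).inverse (s (Φ z) ((mfderiv I 𝓘(ℝ, E') Φ.symm (Φ z)).inverse w))
  rw [hΦ.inverse_symm_deriv hz]

/-- Integrability of the complex distribution of an `f`-structure, in a parametrization. -/
theorem lieBracket_mem {s : ∀ x : M, EndFibre I x} (hint : IsIntegrable (fDistribution s))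
    {O : Set E'} (hO : IsOpen O) (hOs : O ⊆ Φ.source) {X X' Y Y' : E' → E'}
    (hX : ContDiffOn ℝ ∞ X O) (hX' : ContDiffOn ℝ ∞ X' O) (hY : ContDiffOn ℝ ∞ Y O)
    (hY' : ContDiffOn ℝ ∞ Y' O)
    (hXm : ∀ y ∈ O, endInParam Φ s y (endInParam Φ s y (X y)) = endInParam Φ s y (X' y) ∧
      endInParam Φ s y (endInParam Φ s y (X' y)) = -endInParam Φ s y (X y))
    (hYm : ∀ y ∈ O, endInParam Φ s y (endInParam Φ s y (Y y)) = endInParam Φ s y (Y' y) ∧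
      endInParam Φ s y (endInParam Φ s y (Y' y)) = -endInParam Φ s y (Y y)) {y : E'} (hy : y ∈ O) :
    endInParam Φ s y (endInParam Φ s y (lieBracket ℝ X Y y - lieBracket ℝ X' Y' y)) =
        endInParam Φ s y (lieBracket ℝ X Y' y + lieBracket ℝ X' Y y) ∧
      endInParam Φ s y (endInParam Φ s y (lieBracket ℝ X Y' y + lieBracket ℝ X' Y y)) =
        -endInParam Φ s y (lieBracket ℝ X Y y - lieBracket ℝ X' Y' y) := by
  have : CompleteSpace E := FiniteDimensional.complete ℝ E
  have : CompleteSpace E' := FiniteDimensional.complete ℝ E'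
  let U : Set M := Φ.target ∩ Φ.symm ⁻¹' O
  have hU : IsOpen U := Φ.symm.isOpen_inter_preimage hO
  have hmem : ∀ z ∈ O, Φ z ∈ U := fun z hz => ⟨Φ.map_source (hOs hz), by
    rw [Set.mem_preimage, Φ.left_inv (hOs hz)]
    exact hz⟩
  let push : (E' → E') → ∀ m : M, TangentSpace I m := fun X => mpullback I 𝓘(ℝ, E') Φ.symm X
  have hpush : ∀ (X : E' → E') {z : E'}, z ∈ Φ.source → push X (Φ z) =
      mfderiv 𝓘(ℝ, E') I Φ z (X z) := by
    intro X z hz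
    change (mfderiv I 𝓘(ℝ, E') Φ.symm (Φ z)).inverse (X (Φ.symm (Φ z))) = _
    rw [Φ.left_inv hz]
    exact hΦ.inverse_symm_deriv hz _
  have hsm0 : ∀ {X : E' → E'}, ContDiffOn ℝ ∞ X O → ∀ z ∈ O, ContMDiffAt 𝓘(ℝ, E') 𝓘(ℝ, E').tangent ∞
      (fun y => (⟨y, X y⟩ : TangentBundle 𝓘(ℝ, E') E')) z := fun hX z hz =>
    contMDiffWithinAt_univ.1 (contMDiffWithinAt_vectorSpace_iff_contDiffWithinAt.2
      (hX.contDiffAt (hO.mem_nhds hz)).contDiffWithinAt)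
  have hsm : ∀ {X : E' → E'}, ContDiffOn ℝ ∞ X O → SmoothFieldOn (push X) U := by
    intro X hX m hm
    have h1 := hsm0 hX _ hm.2
    exact (h1.mpullback_vectorField_preimage (hΦ.contMDiffAt_symm hm.1)
      (hΦ.isInvertible_mfderiv_symm hm.1) (m := ∞) (n := ∞) (by simp)).contMDiffWithinAt
  have hbr : ∀ {X Y : E' → E'}, ContDiffOn ℝ ∞ X O → ContDiffOn ℝ ∞ Y O →
      mlieBracket I (push X) (push Y) (Φ y) = mfderiv 𝓘(ℝ, E') I Φ y (lieBracket (E := E') ℝ X Y y) := by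
    intro X Y hX hY
    have h0 : Φ.symm (Φ y) ∈ O := (hmem y hy).2
    have hI : IsManifold I (minSmoothness ℝ 2) M := by
      rw [minSmoothness_of_isRCLikeNormedField]
      infer_instance
    have hI' : IsManifold I (minSmoothness ℝ 3) M := by
      rw [minSmoothness_of_isRCLikeNormedField]
      infer_instance
    have h1 := mpullback_mlieBracket (I := I) (I' := 𝓘(ℝ, E')) (f := Φ.symm) (x₀ := Φ y) (n := ∞)
      ((hsm0 hX _ h0).mdifferentiableAt (by simp)) ((hsm0 hY _ h0).mdifferentiableAt (by simp))
      (hΦ.contMDiffAt_symm (Φ.map_source (hOs hy))) (by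
        rw [minSmoothness_of_isRCLikeNormedField]
        exact (mod_cast le_top : ((2 : ℕ∞) : WithTop ℕ∞) ≤ ∞))
    have h2 := congrArg (fun Z => mpullback I 𝓘(ℝ, E') Φ.symm Z (Φ y)) (bracket_vectorSpace X Y)
    exact h1.symm.trans (h2.trans (hpush (lieBracket (E := E') ℝ X Y) (hOs hy)))
  have key : ∀ {z : E'}, z ∈ Φ.source → ∀ u v : E',
      cvec (mfderiv 𝓘(ℝ, E') I Φ z u) (mfderiv 𝓘(ℝ, E') I Φ z v) ∈ fDistribution s (Φ z) ↔
      endInParam Φ s z (endInParam Φ s z u) = endInParam Φ s z v ∧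
        endInParam Φ s z (endInParam Φ s z v) = -endInParam Φ s z u := by
    intro z hz u v
    have e : ∀ a b : E', mfderiv 𝓘(ℝ, E') I Φ z a = mfderiv 𝓘(ℝ, E') I Φ z b ↔ a = b :=
      fun a b => (hΦ.deriv_injective hz).eq_iff
    have e1 : ∀ a : E', -(mfderiv 𝓘(ℝ, E') I Φ z a) = mfderiv 𝓘(ℝ, E') I Φ z (-a) :=
      fun a => (map_neg (mfderiv 𝓘(ℝ, E') I Φ z) a).symm
    refine (mem_fDistribution_cvec _ _ _).trans ?_
    change s (Φ z) (s (Φ z) _) = s (Φ z) _ ∧ s (Φ z) (s (Φ z) _) = -s (Φ z) _ ↔ _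
    rw [← hΦ.deriv_endInParam s hz, ← hΦ.deriv_endInParam s hz, ← hΦ.deriv_endInParam s hz,
      ← hΦ.deriv_endInParam s hz, e1, e, e]
  have hfield : ∀ {X X' : E' → E'}, (∀ y ∈ O, endInParam Φ s y (endInParam Φ s y (X y)) =
      endInParam Φ s y (X' y) ∧ endInParam Φ s y (endInParam Φ s y (X' y)) =
      -endInParam Φ s y (X y)) → ∀ m ∈ U,
      (⟨push X, push X'⟩ : CVectorField I M).val m ∈ fDistribution s m := by
    intro X X' h m hm
    obtain ⟨z, hz, rfl⟩ : ∃ z ∈ O, Φ z = m := ⟨Φ.symm m, hm.2, Φ.right_inv hm.1⟩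
    change cvec (push X (Φ z)) (push X' (Φ z)) ∈ _
    rw [hpush X (hOs hz), hpush X' (hOs hz)]
    exact (key (hOs hz) _ _).2 (h z hz)
  have h1 := hint U hU ⟨push X, push X'⟩ ⟨push Y, push Y'⟩ ⟨hsm hX, hsm hX'⟩ ⟨hsm hY, hsm hY'⟩
    (hfield hXm) (hfield hYm) (Φ y) (hmem y hy)
  rw [CVectorField.val, CVectorField.bracket] at h1
  simp only [hbr hX hY, hbr hX' hY', hbr hX hY', hbr hX' hY] at h1
  rw [← key (hOs hy)]
  convert h1 using 2
  · exact map_sub (mfderiv 𝓘(ℝ, E') I Φ y) _ _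
  · exact map_add (mfderiv 𝓘(ℝ, E') I Φ y) _ _

end IsSmoothParam

end Param

/-! ### Descent of an `f`-structure along a product projection. -/

section Flat

theorem smoothField_vectorSpace {B : Type*} [NormedAddCommGroup B] [NormedSpace ℝ B]
    {X : ∀ b : B, TangentSpace 𝓘(ℝ, B) b} {O : Set B} :
    SmoothFieldOn X O ↔ ContDiffOn ℝ ∞ (E := B) (F := B) X O :=
  ⟨fun h b hb => contMDiffWithinAt_vectorSpace_iff_contDiffWithinAt.1 (h b hb),
    fun h b hb => contMDiffWithinAt_vectorSpace_iff_contDiffWithinAt.2 (h b hb)⟩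

theorem smoothEnd_vectorSpace {B : Type*} [NormedAddCommGroup B] [NormedSpace ℝ B]
    {J : B → B →L[ℝ] B} (hJ : ContDiff ℝ ∞ J) :
    ContMDiff 𝓘(ℝ, B) (endModel 𝓘(ℝ, B)) ∞
      (fun b => (⟨b, J b⟩ : EndBundle 𝓘(ℝ, B) B)) := by
  intro b
  rw [contMDiffAt_hom_bundle]
  refine ⟨contMDiffAt_id, ?_⟩
  have h := inTangentCoordinates_model_space (I := 𝓘(ℝ, B)) (I' := 𝓘(ℝ, B)) (fun b : B => b)
    (fun b : B => b) J b
  have h2 := hJ.contMDiff b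
  rw [← h] at h2
  exact h2

variable {E : Type*} [NormedAddCommGroup E] [NormedSpace ℝ E] [FiniteDimensional ℝ E]
  {H : Type*} [TopologicalSpace H] {I : ModelWithCorners ℝ E H}
  {M : Type*} [TopologicalSpace M] [ChartedSpace H M] [IsManifold I ∞ M]
  {K B : Type*} [NormedAddCommGroup K] [NormedSpace ℝ K] [FiniteDimensional ℝ K]
  [NormedAddCommGroup B] [NormedSpace ℝ B] [FiniteDimensional ℝ B]

/-- An integrable `f`-structure whose kernel is the first factor, in a global parametrization by a
product of vector spaces, descends to a complex structure on the second factor. -/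
theorem exists_complexStructure_of_flat {s : ∀ x : M, EndFibre I x}
    (hs : ContMDiff I (endModel I) ∞ (fun y => (⟨y, s y⟩ : EndBundle I M)))
    (h3 : ∀ y v, s y (s y (s y v)) = -s y v) (hint : IsIntegrable (fDistribution s))
    {Φ : OpenPartialHomeomorph (K × B) M} (hΦ : IsSmoothParam I Φ) (hsrc : Φ.source = Set.univ)
    (hflat : ∀ y w, endInParam Φ s y w = 0 ↔ w.2 = 0) :
    ∃ (J : ∀ b : B, EndFibre 𝓘(ℝ, B) b) (φ : M → B), IsComplexStructure J ∧
      IsDefinedBy s φ Φ.target J := by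
  have hmem : ∀ y, y ∈ Φ.source := fun y => hsrc ▸ Set.mem_univ y
  obtain ⟨F, hF⟩ : ∃ F : K × B → (K × B) →L[ℝ] (K × B), F = endInParam Φ s := ⟨_, rfl⟩
  have hsm : ContDiff ℝ ∞ F := by
    rw [hF, ← contDiffOn_univ, ← hsrc]
    exact hΦ.contDiffOn_endInParam hs
  have cube : ∀ y w, F y (F y (F y w)) = -F y w := fun y w => by
    rw [hF]
    exact hΦ.endInParam_cube h3 (hmem y) w
  rw [← hF] at hflat
  have ker_eq : ∀ y a b, F y a = F y b ↔ a.2 = b.2 := fun y a b => by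
    rw [← sub_eq_zero, ← map_sub, hflat, Prod.snd_sub, sub_eq_zero]
  have snd_eq : ∀ y a b, a.2 = b.2 → (F y a).2 = (F y b).2 := fun y a b h => by
    rw [(ker_eq y a b).2 h]
  have sq : ∀ y w, (F y (F y w)).2 = -w.2 := fun y w => by
    rw [← Prod.snd_neg, ← ker_eq y, cube, map_neg]
  have bracket := fun {O : Set (K × B)} (hO : IsOpen O) {X X' Y Y' : K × B → K × B} hX hX' hY hY' =>
    hΦ.lieBracket_mem hint hO (fun y _ => hmem y) (X := X) (X' := X') (Y := Y) (Y' := Y')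
      hX hX' hY hY'
  rw [← hF] at bracket
  have memF : ∀ y u v, (F y (F y u) = F y v ∧ F y (F y v) = -F y u) ↔
      ((F y u).2 = v.2 ∧ (F y v).2 = -u.2) := fun y u v => by
    rw [ker_eq, ← map_neg, ker_eq, Prod.snd_neg]
  have hFd : ∀ b, ContDiff ℝ ∞ (fun y => F y (0, b)) := fun b => hsm.clm_apply contDiff_const
  -- The constant field (k, 0) is a section of T⁰ and, for W = F(0, b), W + iFW is a section of the
  -- -i-eigenbundle. Integrability gives F²(∂_k W) = F(∂_k(FW)). The B-component of FW is the
  -- constant -b, so the right side is zero and ∂_k W is in the kernel of F.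
  have hder : ∀ y (k : K) (b : B), fderiv ℝ (fun y => (F y (0, b)).2) y (k, 0) = 0 := by
    intro y k b
    have hFF : ContDiff ℝ ∞ (fun y => F y (F y (0, b))) := hsm.clm_apply (hFd b)
    have h1 := (bracket isOpen_univ (X := fun _ => (k, 0)) (X' := fun _ => 0)
      (Y := fun y => F y (0, b)) (Y' := fun y => F y (F y (0, b))) contDiffOn_const
      contDiffOn_const (hFd b).contDiffOn hFF.contDiffOn
      (fun z _ => (memF z _ _).2 (by
        have h0 : F z (k, 0) = 0 := (hflat z _).2 rfl
        rw [h0, map_zero]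
        simp))
      (fun z _ => ⟨rfl, cube z _⟩) (Set.mem_univ y)).1
    have e1 : ∀ W : K × B → K × B, lieBracket ℝ (fun _ => ((k, 0) : K × B)) W y =
        fderiv ℝ W y (k, 0) := fun W => by
      simp [lieBracket]
    have e2 : ∀ W : K × B → K × B, lieBracket ℝ (fun _ => (0 : K × B)) W y = 0 := fun W => by
      simp [lieBracket]
    rw [e1, e1, e2, e2, sub_zero, add_zero, ker_eq] at h1
    have e3 : ∀ {W : K × B → K × B}, ContDiff ℝ ∞ W → ∀ w,
        fderiv ℝ (fun y => (W y).2) y w = (fderiv ℝ W y w).2 := fun {W} hW w => by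
      have := (hW.differentiable (by simp) y).hasFDerivAt.snd
      rw [this.fderiv]
      rfl
    have e4 : (fun y => (F y (F y (0, b))).2) = fun _ => -b := by
      ext1 z
      rw [sq]
    rw [← e3 hFF, e4, fderiv_fun_const] at h1
    have e5 : F y (fderiv ℝ (fun y => F y (0, b)) y (k, 0)) = 0 := by
      have h2 := cube y (fderiv ℝ (fun y => F y (0, b)) y (k, 0))
      rw [(hflat y (F y _)).2 h1, map_zero] at h2
      exact neg_eq_zero.1 h2.symm
    rw [e3 (hFd b)]
    exact (hflat y _).1 e5
  -- J is read on the slice k = 0. By `hder` the B-component of F is constant along the factor K,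
  -- which is a whole vector space, so any slice gives the same J.
  let J : B → B →L[ℝ] B := fun b =>
    ContinuousLinearMap.snd ℝ K B ∘L F (0, b) ∘L ContinuousLinearMap.inr ℝ K B
  have hJ : ∀ y w, (F y w).2 = J y.2 w.2 := by
    rintro ⟨k, b⟩ w
    rw [snd_eq (k, b) w (0, w.2) rfl]
    change _ = (F (0, b) (0, w.2)).2
    have hd : ContDiff ℝ ∞ (fun y => (F y (0, w.2)).2) := (hFd w.2).snd
    have h1 : ∀ k' : K, fderiv ℝ (fun k' : K => (F (k', b) (0, w.2)).2) k' = 0 := by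
      intro k'
      have h2 := HasFDerivAt.comp (f := fun k' : K => (k', b)) k'
        (hd.differentiable (by simp) (k', b)).hasFDerivAt
        (hasFDerivAt_prodMk_left (𝕜 := ℝ) k' b)
      have h4 := h2.fderiv
      refine h4.trans ?_
      ext1 v
      exact hder (k', b) v w.2
    have hdk : Differentiable ℝ (fun k' : K => (F (k', b) (0, w.2)).2) :=
      (hd.comp (contDiff_id.prodMk contDiff_const)).differentiable (by simp)
    exact is_const_of_fderiv_eq_zero hdk h1 k 0
  have hJsm : ContDiff ℝ ∞ J :=
    contDiff_const.clm_comp ((hsm.comp (contDiff_const.prodMk contDiff_id)).clm_comp contDiff_const)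
  have hJsq : ∀ b v, J b (J b v) = -v := by
    intro b v
    have h1 := sq (0, b) (0, v)
    rwa [hJ, hJ] at h1
  have memJ : ∀ y u v, (F y (F y u) = F y v ∧ F y (F y v) = -F y u) ↔
      (J y.2 u.2 = v.2 ∧ J y.2 v.2 = -u.2) := fun y u v => by
    rw [memF, hJ, hJ]
  have hJint : IsIntegrable (I := 𝓘(ℝ, B)) (M := B)
      (fun b => eigen (x := b) (J b : EndFibre 𝓘(ℝ, B) b) (-Complex.I)) := by
    intro O hO X Y hX hY hXm hYm b hb
    -- A pair of lifts is in T⁰ ⊕ p exactly when the original pair is of type (0,1) for J, and the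
    -- B-component of a bracket of lifts is the bracket on B. Integrability therefore descends.
    let lift : (∀ b : B, TangentSpace 𝓘(ℝ, B) b) → K × B → K × B := fun Z y => (0, Z y.2)
    have hO' : IsOpen (Prod.snd ⁻¹' O : Set (K × B)) := hO.preimage continuous_snd
    have hl : ∀ {Z : ∀ b : B, TangentSpace 𝓘(ℝ, B) b}, SmoothFieldOn Z O →
        ContDiffOn ℝ ∞ (lift Z) (Prod.snd ⁻¹' O) := fun hZ =>
      contDiffOn_const.prodMk ((smoothField_vectorSpace.1 hZ).comp contDiff_snd.contDiffOn
        fun y hy => hy)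
    have hm : ∀ {Z : CVectorField 𝓘(ℝ, B) B}, (∀ b ∈ O, Z.val b ∈
        eigen (x := b) (J b : EndFibre 𝓘(ℝ, B) b) (-Complex.I)) → ∀ y ∈ (Prod.snd ⁻¹' O : Set (K × B)),
        F y (F y (lift Z.re y)) = F y (lift Z.im y) ∧
          F y (F y (lift Z.im y)) = -F y (lift Z.re y) := by
      intro Z hZ y hy
      rw [memJ]
      exact (eigen_cvec _ _ _).1 (hZ y.2 hy)
    have h1 := bracket hO' (hl hX.1) (hl hX.2) (hl hY.1) (hl hY.2) (hm hXm) (hm hYm)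
      (y := (0, b)) hb
    rw [memJ] at h1
    have e1 : ∀ {Z W : ∀ b : B, TangentSpace 𝓘(ℝ, B) b}, SmoothFieldOn Z O → SmoothFieldOn W O →
        (lieBracket ℝ (lift Z) (lift W) (0, b)).2 = mlieBracket 𝓘(ℝ, B) Z W b := by
      intro Z W hZ hW
      have hd : ∀ {Z : ∀ b : B, TangentSpace 𝓘(ℝ, B) b}, SmoothFieldOn Z O → ∀ w : K × B,
          (fderiv ℝ (lift Z) (0, b) w).2 = fderiv ℝ (E := B) (F := B) Z b w.2 := by
        intro Z hZ w
        have h2 : HasFDerivAt (E := B) (F := B) Z (fderiv ℝ (E := B) (F := B) Z b)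
          (((0, b) : K × B)).2 :=
          (((smoothField_vectorSpace.1 hZ).contDiffAt (hO.mem_nhds hb)).differentiableAt
            (by simp)).hasFDerivAt
        have h4 := (hasFDerivAt_const (0 : K) ((0, b) : K × B)).prodMk
          (h2.comp ((0, b) : K × B) hasFDerivAt_snd)
        have h5 := h4.fderiv
        exact congrArg Prod.snd (DFunLike.congr_fun h5 w)
      rw [bracket_vectorSpace]
      change (fderiv ℝ (lift W) (0, b) _ - fderiv ℝ (lift Z) (0, b) _).2 = _
      rw [Prod.snd_sub, hd hW, hd hZ]
      rfl
    rw [Prod.snd_sub, Prod.snd_add, e1 hX.1 hY.1, e1 hX.2 hY.2, e1 hX.1 hY.2, e1 hX.2 hY.1] at h1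
    exact (eigen_cvec _ _ _).2 h1
  have hder' : ∀ y (v : TangentSpace I (Φ y)), mfderiv I 𝓘(ℝ, B) (fun m => (Φ.symm m).2) (Φ y) v =
      (mfderiv I 𝓘(ℝ, K × B) Φ.symm (Φ y) v).2 := by
    intro y v
    have h1 := (hasFDerivAt_snd (𝕜 := ℝ) (p := Φ.symm (Φ y))).hasMFDerivAt.comp (Φ y)
      (hΦ.mdifferentiable.mdifferentiableAt_symm (Φ.map_source (hmem y))).hasMFDerivAt
    exact DFunLike.congr_fun h1.mfderiv v
  have hpar : ∀ m ∈ Φ.target, ∃ y, m = Φ y := fun m hm => ⟨Φ.symm m, (Φ.right_inv hm).symm⟩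
  have hFs : ∀ y (v : TangentSpace I (Φ y)), mfderiv I 𝓘(ℝ, K × B) Φ.symm (Φ y) (s (Φ y) v) =
      F y (mfderiv I 𝓘(ℝ, K × B) Φ.symm (Φ y) v) := by
    intro y v
    have h1 := hΦ.deriv_endInParam s (hmem y) (mfderiv I 𝓘(ℝ, K × B) Φ.symm (Φ y) v)
    rw [hΦ.deriv_symm_apply (hmem y), ← hF] at h1
    rw [← h1, hΦ.symm_deriv_apply (hmem y)]
  have hinj : ∀ y, Function.Injective (mfderiv I 𝓘(ℝ, K × B) Φ.symm (Φ y)) := fun y =>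
    Function.LeftInverse.injective (hΦ.deriv_symm_apply (hmem y))
  refine ⟨fun b => J b, fun m => (Φ.symm m).2,
    ⟨smoothEnd_vectorSpace hJsm, hJsq, hJint⟩, ⟨?_, ?_⟩, ?_, ?_, ?_⟩
  · exact (contDiff_snd (𝕜 := ℝ)).contMDiff.comp_contMDiffOn hΦ.smooth_symm
  · intro m hm w
    obtain ⟨y, rfl⟩ := hpar m hm
    refine ⟨mfderiv 𝓘(ℝ, K × B) I Φ y (0, w), ?_⟩
    rw [hder', hΦ.symm_deriv_apply (hmem y)]
  · refine Set.eq_univ_of_forall fun b => ⟨Φ (0, b), Φ.map_source (hmem _), ?_⟩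
    change (Φ.symm (Φ (0, b))).2 = b
    rw [Φ.left_inv (hmem _)]
  · rintro m hm _ ⟨z, hz, rfl⟩
    obtain ⟨y, rfl⟩ := hpar m hm
    obtain ⟨u, v, rfl⟩ : ∃ u w, z = cvec u w := ⟨_, _, (cvec_eta z).symm⟩
    have h1 := (mem_fDistribution_cvec _ _ _).1 hz
    change s (Φ y) (s (Φ y) u) = s (Φ y) v ∧ s (Φ y) (s (Φ y) v) = -s (Φ y) u at h1
    have h2 : F y (F y (mfderiv I 𝓘(ℝ, K × B) Φ.symm (Φ y) u)) =
        F y (mfderiv I 𝓘(ℝ, K × B) Φ.symm (Φ y) v) ∧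
        F y (F y (mfderiv I 𝓘(ℝ, K × B) Φ.symm (Φ y) v)) =
        -F y (mfderiv I 𝓘(ℝ, K × B) Φ.symm (Φ y) u) := by
      rw [← hFs, ← hFs, ← hFs, ← hFs, h1.1, h1.2, map_neg]
      exact ⟨rfl, rfl⟩
    replace h2 := (memJ _ _ _).1 h2
    refine eigen_le_fDistribution (s := fun b => (J b : EndFibre 𝓘(ℝ, B) b)) _ ?_
    rw [cdiff, baseChange_cvec']
    refine (eigen_cvec _ _ _).2 ?_
    change J _ (mfderiv I 𝓘(ℝ, B) (fun m => (Φ.symm m).2) (Φ y) u) =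
      mfderiv I 𝓘(ℝ, B) (fun m => (Φ.symm m).2) (Φ y) v ∧
      J _ (mfderiv I 𝓘(ℝ, B) (fun m => (Φ.symm m).2) (Φ y) v) =
      -mfderiv I 𝓘(ℝ, B) (fun m => (Φ.symm m).2) (Φ y) u
    have e : J (Φ.symm (Φ y)).2 = J y.2 := congrArg (fun z => J z.2) (Φ.left_inv (hmem y))
    rw [hder', hder']
    change J (Φ.symm (Φ y)).2 _ = _ ∧ J (Φ.symm (Φ y)).2 _ = _
    rw [e]
    exact h2
  · intro m hm
    obtain ⟨y, rfl⟩ := hpar m hm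
    ext v
    change mfderiv I 𝓘(ℝ, B) (fun m => (Φ.symm m).2) (Φ y) v = 0 ↔ s (Φ y) v = 0
    rw [hder']
    refine (hflat y _).symm.trans ?_
    rw [← hFs]
    exact map_eq_zero_iff _ (hinj y)

end Flat

/-! ### Ranks, changes of parametrization and product charts. -/

section Rank

variable {E : Type*} [NormedAddCommGroup E] [NormedSpace ℝ E] [FiniteDimensional ℝ E]
  {H : Type*} [TopologicalSpace H] {I : ModelWithCorners ℝ E H}
  {M : Type*} [TopologicalSpace M] [ChartedSpace H M] [IsManifold I 1 M]
  {c : ConformalStructure I M} {r : ℕ} {x : M}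

/-- The `f`-structure of an isotropic space of complex dimension `r` has real rank `2 r`. -/
theorem ConformalStructure.IsotropicSpace.finrank_range (q : c.IsotropicSpace r x) :
    Module.finrank ℝ (LinearMap.range q.fStructure.toLinearMap) = 2 * r := by
  let f : q.space.restrictScalars ℝ →ₗ[ℝ] TangentSpace I x :=
    cre ∘ₗ (q.space.restrictScalars ℝ).subtype
  have hf : Function.Injective f := by
    rw [← LinearMap.ker_eq_bot, LinearMap.ker_eq_bot']
    rintro ⟨z, hz⟩ h
    obtain ⟨u, v, rfl⟩ : ∃ u w, z = cvec u w := ⟨_, _, (cvec_eta z).symm⟩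
    have hu : u = 0 := (cre_cvec u v).symm.trans h
    have h1 := (q.cvec_mem_space_iff u v).1 hz
    have hv : v = 0 := by rw [← h1.1, hu, map_zero]
    apply Subtype.ext
    change cvec u v = 0
    rw [hu, hv]
    simp [cvec]
  have hr : LinearMap.range f = LinearMap.range q.fStructure.toLinearMap := by
    ext u
    constructor
    · rintro ⟨⟨z, hz⟩, rfl⟩
      obtain ⟨u, v, rfl⟩ : ∃ u w, z = cvec u w := ⟨_, _, (cvec_eta z).symm⟩
      have h1 := (q.cvec_mem_space_iff u v).1 hz
      refine ⟨-v, ?_⟩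
      change q.fStructure (-v) = cre (cvec u v)
      rw [cre_cvec, map_neg, h1.2, neg_neg]
    · rintro ⟨w, rfl⟩
      exact ⟨⟨cvec (q.fStructure w) (q.fStructure (q.fStructure w)),
        (q.cvec_mem_space_iff _ _).2 ⟨rfl, q.fStructure_cube w⟩⟩, cre_cvec _ _⟩
  rw [← hr, LinearMap.finrank_range_of_inj hf]
  exact (finrank_real_of_complex q.space).trans (congrArg (2 * ·) q.finrank_eq)

end Rank

section Trans

variable {E : Type*} [NormedAddCommGroup E] [NormedSpace ℝ E] [FiniteDimensional ℝ E]
  {H : Type*} [TopologicalSpace H] {I : ModelWithCorners ℝ E H}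
  {M : Type*} [TopologicalSpace M] [ChartedSpace H M] [IsManifold I ∞ M]
  {E₁ E₂ : Type*} [NormedAddCommGroup E₁] [NormedSpace ℝ E₁] [FiniteDimensional ℝ E₁]
  [NormedAddCommGroup E₂] [NormedSpace ℝ E₂] [FiniteDimensional ℝ E₂]
  {Φ : OpenPartialHomeomorph E₁ M} {χ : OpenPartialHomeomorph E₂ E₁}

omit [FiniteDimensional ℝ E] [IsManifold I ∞ M] [FiniteDimensional ℝ E₁]
  [FiniteDimensional ℝ E₂] in
theorem IsSmoothParam.trans (hΦ : IsSmoothParam I Φ) (hχ : ContDiffOn ℝ ∞ χ χ.source)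
    (hχ' : ContDiffOn ℝ ∞ χ.symm χ.target) : IsSmoothParam I (χ.trans Φ) where
  smooth := hΦ.smooth.comp (hχ.contMDiffOn.mono fun _ hy => hy.1) fun _ hy => hy.2
  smooth_symm := hχ'.contMDiffOn.comp (hΦ.smooth_symm.mono fun _ hy => hy.1) fun _ hy => hy.2

theorem IsSmoothParam.endInParam_eq_zero (hΦ : IsSmoothParam I Φ) (s : ∀ x : M, EndFibre I x)
    {y : E₁} (hy : y ∈ Φ.source) (w : E₁) :
    endInParam Φ s y w = 0 ↔ s (Φ y) (mfderiv 𝓘(ℝ, E₁) I Φ y w) = 0 := by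
  rw [← hΦ.deriv_endInParam s hy]
  exact (map_eq_zero_iff _ (hΦ.deriv_injective hy)).symm

theorem IsSmoothParam.finrank_range_endInParam (hΦ : IsSmoothParam I Φ)
    (s : ∀ x : M, EndFibre I x) {y : E₁} (hy : y ∈ Φ.source) :
    Module.finrank ℝ (LinearMap.range (endInParam Φ s y).toLinearMap) =
      Module.finrank ℝ (LinearMap.range (s (Φ y)).toLinearMap) := by
  let e : E₁ ≃L[ℝ] TangentSpace I (Φ y) := hΦ.mdifferentiable.mfderiv hy
  have he : ∀ w, e (endInParam Φ s y w) = s (Φ y) (e w) := hΦ.deriv_endInParam s hy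
  have hr : (LinearMap.range (endInParam Φ s y).toLinearMap).map e.toLinearEquiv.toLinearMap =
      LinearMap.range (s (Φ y)).toLinearMap := by
    ext v
    constructor
    · rintro ⟨_, ⟨w, rfl⟩, rfl⟩
      exact ⟨e w, (he w).symm⟩
    · rintro ⟨w, rfl⟩
      refine ⟨_, ⟨e.symm w, rfl⟩, ?_⟩
      exact (he _).trans (by rw [e.apply_symm_apply]; rfl)
  rw [← hr]
  exact (LinearEquiv.finrank_map_eq e.toLinearEquiv _).symm

theorem IsSmoothParam.endInParam_trans_eq_zero (hΦ : IsSmoothParam I Φ)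
    (hχ : ContDiffOn ℝ ∞ χ χ.source) (hχ' : ContDiffOn ℝ ∞ χ.symm χ.target)
    (s : ∀ x : M, EndFibre I x) {y : E₂} (hy : y ∈ (χ.trans Φ).source) (w : E₂) :
    endInParam (χ.trans Φ) s y w = 0 ↔ endInParam Φ s (χ y) (fderiv ℝ χ y w) = 0 := by
  have hy12 : y ∈ χ.source ∧ χ y ∈ Φ.source := hy
  obtain ⟨hy1, hy2⟩ := hy12
  rw [(hΦ.trans hχ hχ').endInParam_eq_zero s hy, hΦ.endInParam_eq_zero s hy2]
  have h1 : DifferentiableAt ℝ χ y :=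
    (hχ.contDiffAt (χ.open_source.mem_nhds hy1)).differentiableAt (by simp)
  have h2 := (hΦ.mdifferentiable.mdifferentiableAt hy2).hasMFDerivAt.comp y
    h1.hasFDerivAt.hasMFDerivAt
  have h3 := DFunLike.congr_fun h2.mfderiv w
  exact Eq.congr (congrArg (s (Φ (χ y))) h3) rfl

omit [FiniteDimensional ℝ E₁] [FiniteDimensional ℝ E₂] in
theorem fderiv_injective_of_openPartialHomeomorph (hχ : ContDiffOn ℝ ∞ χ χ.source)
    (hχ' : ContDiffOn ℝ ∞ χ.symm χ.target) {y : E₂} (hy : y ∈ χ.source) :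
    Function.Injective (fderiv ℝ χ y) := by
  have h1 : HasFDerivAt χ (fderiv ℝ χ y) y :=
    ((hχ.contDiffAt (χ.open_source.mem_nhds hy)).differentiableAt (by simp)).hasFDerivAt
  have h2 : HasFDerivAt χ.symm (fderiv ℝ χ.symm (χ y)) (χ y) :=
    ((hχ'.contDiffAt (χ.open_target.mem_nhds (χ.map_source hy))).differentiableAt
      (by simp)).hasFDerivAt
  have h3 : HasFDerivAt (χ.symm ∘ χ) (ContinuousLinearMap.id ℝ E₂) y :=
    (hasFDerivAt_id y).congr_of_eventuallyEq (by
      filter_upwards [χ.open_source.mem_nhds hy] with z hz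
      exact χ.left_inv hz)
  have h4 := (h2.comp y h1).unique h3
  exact Function.LeftInverse.injective (g := fderiv ℝ χ.symm (χ y))
    fun w => DFunLike.congr_fun h4 w

end Trans

section Existence

variable {K B E : Type*} [NormedAddCommGroup E] [NormedSpace ℝ E]
  [NormedAddCommGroup K] [InnerProductSpace ℝ K] [NormedAddCommGroup B] [InnerProductSpace ℝ B]

/-- A product of vector spaces is diffeomorphic to any small product of balls. -/
theorem exists_small_chart (L : (K × B) ≃L[ℝ] E) {O : Set E} (hO : O ∈ nhds (0 : E)) :
    ∃ χ : OpenPartialHomeomorph (K × B) E, χ.source = Set.univ ∧ χ.target ⊆ O ∧ χ 0 = 0 ∧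
      ContDiff ℝ ∞ χ ∧ ContDiffOn ℝ ∞ χ.symm χ.target ∧
      ∀ y w, (L.symm (fderiv ℝ χ y w)).2 = 0 ↔ w.2 = 0 := by
  have hO' : L ⁻¹' O ∈ nhds (0 : K × B) := L.continuous.continuousAt.preimage_mem_nhds
    (by rwa [map_zero])
  obtain ⟨δ, hδ, hb⟩ := Metric.mem_nhds_iff.1 hO'
  -- Contracting the two factors separately keeps the differential block diagonal, so the directions
  -- of K are preserved. The product norm is the maximum, hence the product of the balls is again a
  -- ball.
  let a := OpenPartialHomeomorph.univBall (0 : K) δ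
  let b := OpenPartialHomeomorph.univBall (0 : B) δ
  have ha : ContDiff ℝ ∞ a := OpenPartialHomeomorph.contDiff_univBall
  have hb' : ContDiff ℝ ∞ b := OpenPartialHomeomorph.contDiff_univBall
  have hat : a.target = Metric.ball 0 δ := OpenPartialHomeomorph.univBall_target _ hδ
  have hbt : b.target = Metric.ball 0 δ := OpenPartialHomeomorph.univBall_target _ hδ
  have has : ContDiffOn ℝ ∞ a.symm a.target := hat ▸ OpenPartialHomeomorph.contDiffOn_univBall_symm
  have hbs : ContDiffOn ℝ ∞ b.symm b.target := hbt ▸ OpenPartialHomeomorph.contDiffOn_univBall_symm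
  have hbu : b.source = Set.univ := OpenPartialHomeomorph.univBall_source _ _
  have hau : a.source = Set.univ := OpenPartialHomeomorph.univBall_source _ _
  have hab : ContDiff ℝ ∞ (fun y : K × B => (a y.1, b y.2)) :=
    (ha.comp contDiff_fst).prodMk (hb'.comp contDiff_snd)
  refine ⟨(a.prod b).transHomeomorph L.toHomeomorph, ?_, ?_, ?_, ?_, ?_, ?_⟩
  · change a.source ×ˢ b.source = Set.univ
    rw [hau, hbu, Set.univ_prod_univ]
  · rintro z hz
    have h1 : L.symm z ∈ a.target ×ˢ b.target := hz
    rw [hat, hbt, ball_prod_same] at h1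
    have h2 := hb h1
    rwa [Set.mem_preimage, L.apply_symm_apply] at h2
  · change L (a 0, b 0) = 0
    rw [OpenPartialHomeomorph.univBall_apply_zero, OpenPartialHomeomorph.univBall_apply_zero]
    exact map_zero L
  · exact L.contDiff.comp hab
  · have h1 : ContDiffOn ℝ ∞ (fun y : K × B => (a.symm y.1, b.symm y.2)) (a.target ×ˢ b.target) :=
      has.prodMap hbs
    exact h1.comp L.symm.contDiff.contDiffOn fun z hz => hz
  · intro y w
    have h1 : HasFDerivAt (fun y : K × B => L (a y.1, b y.2))
        (L.toContinuousLinearMap ∘L (((fderiv ℝ a y.1).comp (ContinuousLinearMap.fst ℝ K B)).prod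
          ((fderiv ℝ b y.2).comp (ContinuousLinearMap.snd ℝ K B)))) y := by
      have ha1 := (ha.differentiable (by simp) y.1).hasFDerivAt.comp y hasFDerivAt_fst
      have hb1 := (hb'.differentiable (by simp) y.2).hasFDerivAt.comp y hasFDerivAt_snd
      exact L.hasFDerivAt.comp y (ha1.prodMk hb1)
    have h2 : fderiv ℝ ((a.prod b).transHomeomorph L.toHomeomorph) y = _ := h1.fderiv
    rw [h2]
    change (L.symm (L (fderiv ℝ a y.1 w.1, fderiv ℝ b y.2 w.2))).2 = 0 ↔ _
    rw [L.symm_apply_apply]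
    exact map_eq_zero_iff _ (fderiv_injective_of_openPartialHomeomorph hb'.contDiffOn hbs
      (hbu ▸ Set.mem_univ _))

end Existence

/-! ### Flat parametrizations of integrable `f`-structures. -/

section Flat

variable {E : Type*} [NormedAddCommGroup E] [InnerProductSpace ℝ E] [FiniteDimensional ℝ E]
  {M : Type*} [TopologicalSpace M] [ChartedSpace E M] [IsManifold 𝓘(ℝ, E) ∞ M]
  {B : Type*} [NormedAddCommGroup B] [InnerProductSpace ℝ B] [FiniteDimensional ℝ B]

omit [FiniteDimensional ℝ E] in
theorem isSmoothParam_chart_symm (x : M) : IsSmoothParam 𝓘(ℝ, E) (chartAt E x).symm :=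
  ⟨contMDiffOn_chart_symm, contMDiffOn_chart⟩

/-- By rank and nullity, the orthogonal complement of the kernel is a copy of B. The inner product
of the model space serves only to choose a complement. -/
theorem exists_equiv_ker (F : E →L[ℝ] E)
    (hB : Module.finrank ℝ B = Module.finrank ℝ (LinearMap.range F.toLinearMap)) :
    ∃ L : (LinearMap.ker F.toLinearMap × B) ≃L[ℝ] E, ∀ w, F w = 0 ↔ (L.symm w).2 = 0 := by
  let K := LinearMap.ker F.toLinearMap
  have h1 : Module.finrank ℝ B = Module.finrank ℝ Kᗮ := by
    have h2 := F.toLinearMap.finrank_range_add_finrank_ker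
    have h4 := K.finrank_add_finrank_orthogonal
    change _ + Module.finrank ℝ K = _ at h2
    omega
  let e : B ≃ₗ[ℝ] Kᗮ := LinearEquiv.ofFinrankEq _ _ h1
  let L : (K × B) ≃ₗ[ℝ] E := ((LinearEquiv.refl ℝ K).prodCongr e).trans
    (K.prodEquivOfIsCompl Kᗮ K.isCompl_orthogonal)
  refine ⟨L.toContinuousLinearEquiv, fun w => ?_⟩
  obtain ⟨a, rfl⟩ := L.surjective w
  change _ ↔ (L.symm (L a)).2 = 0
  rw [L.symm_apply_apply]
  have h5 : L a = a.1 + e a.2 := rfl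
  have h6 : F (a.1 : E) = 0 := a.1.2
  rw [h5, map_add, h6, zero_add]
  constructor
  · intro h
    have h7 : (e a.2 : E) ∈ K ⊓ Kᗮ := ⟨h, (e a.2).2⟩
    rw [K.inf_orthogonal_eq_bot, Submodule.mem_bot] at h7
    exact (map_eq_zero_iff e e.injective).1 (Subtype.ext h7)
  · intro h
    simp [h]

/-- Around each point, there is a parametrization by a product of vector spaces in which the kernel
of an integrable `f`-structure is the first factor. -/
theorem exists_flat_param {s : ∀ x : M, EndFibre 𝓘(ℝ, E) x}
    (hs : ContMDiff 𝓘(ℝ, E) (endModel 𝓘(ℝ, E)) ∞ (fun y => (⟨y, s y⟩ : EndBundle 𝓘(ℝ, E) M)))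
    (h3 : ∀ y v, s y (s y (s y v)) = -s y v) (hint : IsIntegrable (fDistribution s)) (x : M)
    (hB : Module.finrank ℝ B = Module.finrank ℝ (LinearMap.range (s x).toLinearMap)) :
    ∃ (K : Submodule ℝ E) (Φ : OpenPartialHomeomorph (K × B) M), IsSmoothParam 𝓘(ℝ, E) Φ ∧
      Φ.source = Set.univ ∧ x ∈ Φ.target ∧ ∀ y w, endInParam Φ s y w = 0 ↔ w.2 = 0 := by
  let Φ₀ := (chartAt E x).symm
  have hΦ₀ : IsSmoothParam 𝓘(ℝ, E) Φ₀ := isSmoothParam_chart_symm x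
  obtain ⟨z₀, hz₀⟩ : ∃ z₀, z₀ = chartAt E x x := ⟨_, rfl⟩
  have hz₀s : z₀ ∈ Φ₀.source := hz₀ ▸ (chartAt E x).map_source (mem_chart_source E x)
  have hz₀x : Φ₀ z₀ = x := hz₀ ▸ (chartAt E x).left_inv (mem_chart_source E x)
  obtain ⟨F, hF⟩ : ∃ F : E → E →L[ℝ] E, F = endInParam Φ₀ s := ⟨_, rfl⟩
  have hsm : ContDiffOn ℝ ∞ F Φ₀.source := hF ▸ hΦ₀.contDiffOn_endInParam hs
  have cube : ∀ y ∈ Φ₀.source, ∀ w, F y (F y (F y w)) = -F y w := fun y hy w => by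
    rw [hF]
    exact hΦ₀.endInParam_cube h3 hy w
  -- The projection 1 + F² onto ker F depends smoothly on the point, as the Frobenius theorem
  -- requires.
  let P : E → E →L[ℝ] E := fun y => ContinuousLinearMap.id ℝ E + F y ∘L F y
  have hP : ∀ y w, P y w = w + F y (F y w) := fun _ _ => rfl
  have hPw : ∀ y ∈ Φ₀.source, ∀ w, P y w = w ↔ F y w = 0 := by
    intro y hy w
    rw [hP, add_eq_left]
    refine ⟨fun h => ?_, fun h => by rw [h, map_zero]⟩
    rw [← neg_eq_zero, ← cube y hy, h, map_zero]
  obtain ⟨Ψ, h0, h0z, hΨt, hΨ, hΨ', hflat⟩ := exists_flattening (P := P) Φ₀.open_source hz₀s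
    (contDiffOn_const.add (hsm.clm_comp hsm))
    (fun z hz w => by
      rw [hPw z hz, hP, map_add, cube z hz, add_neg_cancel])
    (by
      intro W hW hWo X Y hX hY hXP hYP z hz
      -- Integrability is applied to fields with zero imaginary part. Real sections of T⁰ ⊕ p are
      -- sections of ker F, so the complex condition contains the involutivity of ker F.
      have h1 := hΦ₀.lieBracket_mem hint hWo hW hX (contDiffOn_const (c := (0 : E))) hY
        (contDiffOn_const (c := (0 : E)))
      rw [← hF] at h1
      have h2 : ∀ {X : E → E}, (∀ z ∈ W, P z (X z) = X z) → ∀ y ∈ W, F y (F y (X y)) = F y 0 ∧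
          F y (F y 0) = -F y (X y) := fun h y hy => by
        have h4 := (hPw y (hW hy) _).1 (h y hy)
        simp [h4]
      have h4 := (h1 (h2 hXP) (h2 hYP) hz).2
      have e1 : ∀ X : E → E, lieBracket ℝ X (fun _ => 0) z = 0 := fun X => by
        simp [lieBracket]
      have e2 : ∀ X : E → E, lieBracket ℝ (fun _ => 0) X z = 0 := fun X => by
        simp [lieBracket]
      rw [e1, e2, e1, add_zero, map_zero, map_zero, sub_zero] at h4
      rw [hPw z (hW hz)]
      exact neg_eq_zero.1 h4.symm)
  have hflat' : ∀ v ∈ (Ψ.trans Φ₀).source, ∀ w, endInParam (Ψ.trans Φ₀) s v w = 0 ↔ F z₀ w = 0 := by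
    intro v hv w
    have hv12 : v ∈ Ψ.source ∧ Ψ v ∈ Φ₀.source := hv
    obtain ⟨hv1, hv2⟩ := hv12
    rw [hΦ₀.endInParam_trans_eq_zero hΨ hΨ' s hv, ← hF, ← hPw _ hv2, hflat v hv1, ← hPw z₀ hz₀s]
    constructor
    · rintro ⟨k, hk, hkw⟩
      rwa [← fderiv_injective_of_openPartialHomeomorph hΨ hΨ' hv1 hkw]
    · intro h
      exact ⟨w, h, rfl⟩
  have hrank : Module.finrank ℝ B = Module.finrank ℝ (LinearMap.range (F z₀).toLinearMap) := by
    have h1 := hΦ₀.finrank_range_endInParam s hz₀s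
    rw [hz₀x] at h1
    rw [hB, hF, h1]
  obtain ⟨L, hL⟩ := exists_equiv_ker (F z₀) hrank
  -- Precomposing with this chart makes the source all of K × B. The leaf space is then the vector
  -- space B, and the leaves are connected.
  obtain ⟨χ, hχu, hχt, hχ0, hχ, hχ', hχL⟩ := exists_small_chart L
    ((Ψ.trans Φ₀).open_source.mem_nhds (x := 0) ⟨h0, by
      change Ψ 0 ∈ Φ₀.source
      rwa [h0z]⟩)
  have hχs : ∀ y, y ∈ χ.source := fun y => hχu ▸ Set.mem_univ y
  have hsrc : (χ.trans (Ψ.trans Φ₀)).source = Set.univ := Set.eq_univ_of_forall fun y =>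
    ⟨hχs y, hχt (χ.map_source (hχs y))⟩
  refine ⟨_, χ.trans (Ψ.trans Φ₀), (hΦ₀.trans hΨ hΨ').trans hχ.contDiffOn hχ', hsrc, ?_, ?_⟩
  · have h1 := (χ.trans (Ψ.trans Φ₀)).map_source (x := 0) (hsrc ▸ Set.mem_univ _)
    change Φ₀ (Ψ (χ 0)) ∈ _ at h1
    rwa [hχ0, h0z, hz₀x] at h1
  · intro y w
    have hy : y ∈ (χ.trans (Ψ.trans Φ₀)).source := hsrc ▸ Set.mem_univ y
    rw [(hΦ₀.trans hΨ hΨ').endInParam_trans_eq_zero hχ.contDiffOn hχ' s hy, hflat' _ (hχt (χ.map_source (hχs y))), hL, hχL]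

end Flat

end FTwistor

/-! ### The equivalence. -/

theorem topology_of_normedSpace (B : Type*) [NormedAddCommGroup B] [NormedSpace ℝ B] :
    T2Space B ∧ ConnectedSpace B := ⟨inferInstance, inferInstance⟩

theorem proposition5p6 {m r : ℕ} (hr : 1 ≤ r) (hrm : 2 * r < m)
    {M : Type*} [TopologicalSpace M] [T2Space M] [SecondCountableTopology M]
    [ChartedSpace (EuclideanSpace ℝ (Fin m)) M] [IsManifold (𝓡 m) ∞ M]
    (c : ConformalStructure (𝓡 m) M)
    (D : CovariantDerivative (𝓡 m) (EuclideanSpace ℝ (Fin m)) (TangentSpace (𝓡 m) : M → Type _))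
    (hD : c.IsWeylConnection D)
    (p : ∀ x : M, c.IsotropicSpace r x)
    (hp : ContMDiff (𝓡 m) (endModel (𝓡 m)) ∞ (fun x => (p x).point)) :
    IsHolomorphicOn (𝓡 m) (endModel (𝓡 m)) (fun x => (p x).point) Set.univ
        (fDistribution fun x => (p x).fStructure) (fun x => (p x).distribution D) ↔
      IsIntegrable (fDistribution fun x => (p x).fStructure) ∧
      ∀ x : M, ∃ U : Set M, IsOpen U ∧ x ∈ U ∧
        ∃ (N : Type) (_ : TopologicalSpace N) (_ : T2Space N) (_ : SecondCountableTopology N)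
          (_ : ConnectedSpace N) (_ : ChartedSpace (EuclideanSpace ℝ (Fin (2 * r))) N)
          (_ : IsManifold (𝓡 (2 * r)) ∞ N) (J : ∀ y : N, EndFibre (𝓡 (2 * r)) y) (φ : M → N),
          IsComplexStructure J ∧
          IsDefinedBy (fun x => (p x).fStructure) φ U J ∧
          IsPseudoHorizontallyConformalOn c φ U J ∧
          HasGeodesicFibresOn (𝓡 (2 * r)) D φ U ∧
          HasOneOneIntegrabilityTensorOn c φ U J := by
  have hs : ContMDiff (𝓡 m) (endModel (𝓡 m)) ∞
    (fun x => (⟨x, (p x).fStructure⟩ : EndBundle (𝓡 m) M)) := hp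
  have hsk : ∀ y, c.IsSkew (p y).fStructure := fun y => (p y).fStructure_skew
  have h3 : ∀ y v, (p y).fStructure ((p y).fStructure ((p y).fStructure v)) =
    -(p y).fStructure v := fun y => (p y).fStructure_cube
  constructor
  · intro h
    have hpt : ∀ x, PreservesType D (SmoothEndAt.diffEnd (hs x)) := fun x =>
      (distribution_mem_iff hD p (hs x)).1 (h x (Set.mem_univ x))
    have hint := isIntegrable_of_preservesType hD hs hsk h3 hpt
    refine ⟨hint, fun x => ?_⟩
    -- The local leaf space is modelled on a space of real dimension 2r, because this is the real
    -- rank of the `f`-structure of an isotropic space of complex dimension r.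
    obtain ⟨K, Φ, hΦ, hsrc, hx, hflat⟩ := exists_flat_param
      (B := EuclideanSpace ℝ (Fin (2 * r))) hs h3 hint x
      (finrank_euclideanSpace_fin.trans (p x).finrank_range.symm)
    obtain ⟨J, φ, hJ, hφ⟩ := exists_complexStructure_of_flat hs h3 hint hΦ hsrc hflat
    exact ⟨Φ.target, Φ.open_target, hx, EuclideanSpace ℝ (Fin (2 * r)), inferInstance,
      (topology_of_normedSpace _).1, inferInstance, (topology_of_normedSpace _).2,
      inferInstance, inferInstance, J, φ, hJ, hφ,
      hφ.pseudoHorizontallyConformal hJ.sq hsk h3,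
      hφ.hasGeodesicFibres hD hs hsk h3 hpt,
      hφ.hasOneOneIntegrabilityTensor hJ.sq hD hs hsk h3 hpt⟩
  · rintro ⟨hint, h⟩ x -
    obtain ⟨U, hU, hx, N, _, _, _, _, _, _, J, φ, hJ, hφ, -, hgeo, hone⟩ := h x
    exact (distribution_mem_iff hD p (hs x)).2
      (preservesType_of_submersion hD hs hsk h3 hint hU hJ.sq hφ hgeo hone hx)
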